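/- **Théorème 8.1.** Write $s=\sigma+i\tau$. Let $a\in\mathbb{R}$ and let $h(s)$ be a meromorphic function on $\mathbb{C}$, real on the real line, with only finitely many poles, and without zeros for $\sigma$ large enough. Put $$ f(s)=f^{\pm}(s)=h(s)\pm h(2a-s),\qquad F(s)=\frac{h(2a-s)}{h(s)}, $$ both regarded as meromorphic functions. Suppose that (i) for every $\eta>0$ there is $\sigma_0>a$ such that $|F(s)|<\eta$ for all $s$ with $\sigma\ge\sigma_0$, $\tau\in\mathbb{R}$; (ii') $\phi:\mathbb{R}\to\mathbb{R}$ is a nondecreasing function such that for every $\sigma_0>a$ there are a constant $K>0$ and a real sequence $(T_n)$ with $\lim_{n\to\infty}T_n=+\infty$, $T_n\le T_{n+1}\le\phi(T_n)$ for all $n$, and $$ |F(s)|<e^{K|s|}\quad\text{for } a\le\sigma\le\sigma_0,\ |\tau|=T_n, \text{ for all } n . $$ For $T>0$ let $N(T)$ be the number of zeros of $f$ with $0<\tau<T$, counted with multiplicity, and $N_0'(T)$ the number of zeros of $f$ on the line $\sigma=a$ with $0<\tau<T$, counted without multiplicity. For real $T$ let $N_h(a,T)$ be the number of zeros of $h$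 with $\sigma\ge a$ and $0<\tau<T$, counted with multiplicity. Then all these numbers are finite and $$ N(T)-N_0'(T)\le 4\,N_h\bigl(a,\phi(2T)\bigr)+O(1)\qquad (T>0), $$ that is, there is a constant $C$, independent of $T$, such that $N(T)-N_0'(T)\le 4N_h(a,\phi(2T))+C$ for every $T>0$. This holds for each choice of the sign $\pm$. -/

import Mathlib

open Filter Topology

/-- The set of zeros of a meromorphic function: the points of positive order. The value that the
Lean function `f` happens to take at a pole or at a removable singularity plays no role. -/
def zerosOf (f : ℂ → ℂ) : Set ℂ := {s | 0 < meromorphicOrderAt f s}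

/-- The set of poles of a meromorphic function: the points of negative order. -/
def polesOf (f : ℂ → ℂ) : Set ℂ := {s | meromorphicOrderAt f s < 0}

/-- The number of zeros of `f` in the set `S`, counted with multiplicity
(meaningful when `zerosOf f ∩ S` is finite). -/
noncomputable def countZeros (f : ℂ → ℂ) (S : Set ℂ) : ℕ :=
  ∑ᶠ s ∈ zerosOf f ∩ S, (meromorphicOrderAt f s).untop₀.toNat

/-- The horizontal strip `0 < Im s < T`. -/
def openStrip (T : ℝ) : Set ℂ := {s | 0 < s.im ∧ s.im < T}

/-- `N(T)`: zeros of `f` with `0 < Im s < T`, counted with multiplicity. -/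
noncomputable def zeroCount (f : ℂ → ℂ) (T : ℝ) : ℕ := countZeros f (openStrip T)

/-- `N₀'(T)`: zeros of `f` on the line `Re s = a` with `0 < Im s < T`, counted without
multiplicity. -/
noncomputable def distinctCriticalZeroCount (f : ℂ → ℂ) (a T : ℝ) : ℕ :=
  (zerosOf f ∩ {s | s.re = a} ∩ openStrip T).ncard

/-- `N_h(a, T)`: zeros of `h` with `Re s ≥ a` and `0 < Im s < T`, counted with multiplicity. -/
noncomputable def rightZeroCount (h : ℂ → ℂ) (a T : ℝ) : ℕ :=
  countZeros h ({s | a ≤ s.re} ∩ openStrip T)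

/-- `f(s) = h(s) + ε h(2a - s)`; the two functions `f^±` are the cases `ε = 1` and `ε = -1`. -/
def reflectedSum (h : ℂ → ℂ) (a : ℝ) (ε : ℂ) : ℂ → ℂ :=
  fun s => h s + ε * h (2 * (a : ℂ) - s)

/-- `F(s) = h(2a - s) / h(s)`. -/
noncomputable def reflectedQuotient (h : ℂ → ℂ) (a : ℝ) : ℂ → ℂ :=
  fun s => h (2 * (a : ℂ) - s) / h s

/-- `|F(s)| < c` for a meromorphic function `F`: `F` has no pole at `s`, and its value there, which
is its limit along the punctured neighbourhoods of `s`, has modulus less than `c`. -/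
def MeroNormLt (F : ℂ → ℂ) (s : ℂ) (c : ℝ) : Prop :=
  ∃ w : ℂ, Tendsto F (𝓝[≠] s) (𝓝 w) ∧ ‖w‖ < c

/-- `|F(s)|` tends to `0` as `Re s → +∞`, uniformly in `Im s`. -/
def UniformDecay (F : ℂ → ℂ) (a : ℝ) : Prop :=
  ∀ η : ℝ, 0 < η → ∃ σ₀ : ℝ, a < σ₀ ∧ ∀ s : ℂ, σ₀ ≤ s.re → MeroNormLt F s η

/-- For every `σ₀ > a` there are `K > 0` and a sequence `T_n → +∞` with
`T_n ≤ T_{n+1} ≤ φ(T_n)` such that `|F(s)| < exp (K |s|)` whenever `a ≤ Re s ≤ σ₀` and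
`|Im s| = T_n`. -/
def GrowthOnSegments (F : ℂ → ℂ) (a : ℝ) (φ : ℝ → ℝ) : Prop :=
  ∀ σ₀ : ℝ, a < σ₀ → ∃ (K : ℝ) (t : ℕ → ℝ), 0 < K ∧ Tendsto t atTop atTop ∧
    (∀ n, t n ≤ t (n + 1) ∧ t (n + 1) ≤ φ (t n)) ∧
    ∀ (n : ℕ) (s : ℂ), a ≤ s.re → s.re ≤ σ₀ → |s.im| = t n →
      MeroNormLt F s (Real.exp (K * ‖s‖))

/-! ### The right half of the Cassini oval as a parametrised arc. -/

section OvalArc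

open Complex Real MeasureTheory Metric

/-! Write f = h p with p = 1 + εF. Since h commutes with conjugation, |F| = 1 on Re s = a, so p - 1
is unimodular there and p² = |p|² (p - 1) (`sq_eq_of_norm_sub_one`). Twice the argument of p is thus
the argument of p - 1, and p vanishes exactly where p - 1 passes through -1. Along a segment of the
line with k distinct zeros of p this phase cannot drop by more than 2π(k + 1)
(`card_unimodular_level`). The loss of argument is therefore paid for by zeros on the line, each
used once. What remains in a Jensen formula on the right side of the line is twice the zeros off the
line plus the surplus multiplicities on it; by the symmetry s ↦ 2a - conj s this is what N - N₀'
counts.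

The Jensen formula lives on the right half of the oval |s² - 4| < 7, translated to a and scaled by
T. Its Green function log⁺(7/|u² - 4|) is even in u, hence satisfies a Neumann condition on the
axis, so that only the argument of p, and not log |p|, enters there (`integral_re_comp_ovalArc`,
`oval_count`).

On the arc, log |p| is at most log 2 beyond a fixed distance w from the line, where |F| is small.
The rest of the arc has angular size O(1/T). There a Phragmén–Lindelöf argument in a rectangle of
height H with 2T < H ≤ φ(2T) bounds log⁺ |F| by O(T) plus the Blaschke logarithms of the poles of F
(`posLog_le_of_rectangle`). The first term contributes O(1). Each Blaschke logarithm contributes at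
most a prescribed δ once T is large, uniformly in the pole (`integral_log_norm_arc_le`).

Passing from p back to f costs the zeros of h in the oval. In the limit of large T a zero of f below
height T has weight at least log(7/5), and a zero of h has weight at most log(7/4), and none above
height 2T. Counting conjugates too, the ratio is 2 log(7/4)/log(7/5), which is below 4 because 7/4 <
(7/5)²; the slack absorbs the Blaschke terms. -/

/-- The right half of the Cassini oval `|s ^ 2 - 4| = 7`, parametrised by the argument of
`s ^ 2 - 4`. -/
noncomputable def ovalArc (φ : ℝ) : ℂ := Complex.exp (Complex.log (4 + 7 * Complex.exp (φ * I)) / 2)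

lemma ovalArc_base_re (φ : ℝ) : (4 + 7 * Complex.exp (φ * I)).re = 4 + 7 * Real.cos φ := by
  simp [Complex.exp_ofReal_mul_I_re]

lemma ovalArc_base_im (φ : ℝ) : (4 + 7 * Complex.exp (φ * I)).im = 7 * Real.sin φ := by
  simp [Complex.exp_ofReal_mul_I_im]

lemma ovalArc_base_ne_zero (φ : ℝ) : (4 + 7 * Complex.exp (φ * I)) ≠ 0 := by
  intro h
  have h1 := congrArg Complex.re h
  have h2 := congrArg Complex.im h
  rw [ovalArc_base_re] at h1
  rw [ovalArc_base_im] at h2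
  simp only [Complex.zero_re, Complex.zero_im] at h1 h2
  nlinarith [Real.sin_sq_add_cos_sq φ]

lemma ovalArc_sq (φ : ℝ) : ovalArc φ ^ 2 = 4 + 7 * Complex.exp (φ * I) := by
  rw [ovalArc, ← Complex.exp_nat_mul]
  rw [show ((2 : ℕ) : ℂ) * (Complex.log (4 + 7 * Complex.exp (φ * I)) / 2)
    = Complex.log (4 + 7 * Complex.exp (φ * I)) by push_cast; ring]
  exact Complex.exp_log (ovalArc_base_ne_zero φ)

lemma ovalArc_re_nonneg (φ : ℝ) : 0 ≤ (ovalArc φ).re := by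
  rw [ovalArc, Complex.exp_re]
  refine mul_nonneg (Real.exp_pos _).le (Real.cos_nonneg_of_mem_Icc ?_)
  have h1 := Complex.neg_pi_lt_arg (4 + 7 * Complex.exp (φ * I))
  have h2 := Complex.arg_le_pi (4 + 7 * Complex.exp (φ * I))
  have h3 : (Complex.log (4 + 7 * Complex.exp (φ * I)) / 2).im
      = Complex.arg (4 + 7 * Complex.exp (φ * I)) / 2 := by
    rw [show (2 : ℂ) = ((2 : ℝ) : ℂ) by norm_num, Complex.div_ofReal_im, Complex.log_im]
  rw [h3]
  constructor <;> linarith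

lemma norm_ovalArc_sq_le (φ : ℝ) : ‖ovalArc φ‖ ^ 2 ≤ 11 := by
  rw [← norm_pow, ovalArc_sq]
  refine (norm_add_le _ _).trans ?_
  rw [norm_mul, Complex.norm_exp_ofReal_mul_I]
  norm_num

lemma norm_ovalArc_sq_sub (φ : ℝ) : ‖ovalArc φ ^ 2 - 4‖ = 7 := by
  rw [ovalArc_sq, add_sub_cancel_left, norm_mul, Complex.norm_exp_ofReal_mul_I]
  norm_num

lemma ovalArc_base_mem_slitPlane {φ : ℝ} (hφ : φ ∈ Set.Ioo (-π) π) :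
    (4 + 7 * Complex.exp (φ * I)) ∈ slitPlane := by
  rw [Complex.mem_slitPlane_iff, ovalArc_base_re, ovalArc_base_im]
  by_cases h : Real.sin φ = 0
  · left
    rw [Real.sin_eq_zero_iff_of_lt_of_lt hφ.1 hφ.2] at h
    simp [h]; norm_num
  · right; simpa using h

/-- Differentiating s² - 4 = 7 exp(iφ) gives 2 s s' = i (s² - 4). The endpoints are excluded because
4 + 7 exp(iφ) meets the cut of the logarithm there. -/
lemma hasDerivAt_ovalArc {φ : ℝ} (hφ : φ ∈ Set.Ioo (-π) π) :
    HasDerivAt ovalArc (I * (ovalArc φ ^ 2 - 4) / (2 * ovalArc φ)) φ := by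
  have h1 : HasDerivAt (fun x : ℝ => 4 + 7 * Complex.exp (x * I))
      (7 * (Complex.exp (φ * I) * (1 * I))) φ := by
    have : HasDerivAt (fun x : ℝ => (x : ℂ) * I) (1 * I) φ := (Complex.ofRealCLM.hasDerivAt).mul_const I
    exact (this.cexp.const_mul 7).const_add 4
  have h2 := (h1.clog_real (ovalArc_base_mem_slitPlane hφ)).div_const 2
  have h3 := h2.cexp
  refine h3.congr_deriv ?_
  have hs : ovalArc φ ≠ 0 := Complex.exp_ne_zero _
  rw [← ovalArc_sq, show Complex.exp (Complex.log (ovalArc φ ^ 2) / 2) = ovalArc φ by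
    rw [ovalArc_sq]; rfl]
  have h4 := ovalArc_sq φ
  have h5 : 7 * Complex.exp (φ * I) = ovalArc φ ^ 2 - 4 := by rw [h4]; ring
  field_simp
  linear_combination h5

lemma continuousOn_ovalArc : ContinuousOn ovalArc (Set.Ioo (-π) π) :=
  fun _ hφ => (hasDerivAt_ovalArc hφ).continuousAt.continuousWithinAt

lemma ovalArc_ne_zero (φ : ℝ) : ovalArc φ ≠ 0 := Complex.exp_ne_zero _

lemma ovalArc_neg {φ : ℝ} (hφ : φ ∈ Set.Ioo (-π) π) :
    ovalArc (-φ) = (starRingEnd ℂ) (ovalArc φ) := by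
  have h : (4 + 7 * Complex.exp ((-φ : ℝ) * I)) = (starRingEnd ℂ) (4 + 7 * Complex.exp (φ * I)) := by
    rw [map_add, map_mul, ← Complex.exp_conj, map_ofNat, map_ofNat]
    simp
  rw [ovalArc, h, Complex.log_conj _ (slitPlane_arg_ne_pi (ovalArc_base_mem_slitPlane hφ)), ovalArc,
    ← Complex.exp_conj, map_div₀, map_ofNat]

lemma exp_log_three_div_two (y : ℝ) (hy : y = 1 ∨ y = -1) :
    Complex.exp ((Real.log 3 + (y * π : ℝ) * I) / 2) = (y * √3 : ℝ) * I := by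
  rw [add_div, Complex.exp_add]
  have h1 : Complex.exp ((Real.log 3 : ℂ) / 2) = (√3 : ℝ) := by
    rw [show ((Real.log 3 : ℂ) / 2) = ((Real.log 3 / 2 : ℝ) : ℂ) by push_cast; rfl,
      ← Complex.ofReal_exp, ← Real.log_sqrt (by norm_num), Real.exp_log (by positivity)]
  have h2 : Complex.exp (((y * π : ℝ) : ℂ) * I / 2) = y * I := by
    rw [show (((y * π : ℝ) : ℂ) * I / 2) = ((y * π / 2 : ℝ) : ℂ) * I by push_cast; ring,
      Complex.exp_mul_I, ← Complex.ofReal_cos, ← Complex.ofReal_sin]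
    rcases hy with rfl | rfl
    · simp
    · rw [show (-1 : ℝ) * π / 2 = -(π / 2) by ring]; simp
  rw [h1, h2]; push_cast; ring

lemma tendsto_ovalArc_pi : Tendsto ovalArc (𝓝[<] π) (𝓝 ((√3 : ℝ) * I)) := by
  have hb : Tendsto (fun x : ℝ => 4 + 7 * Complex.exp (x * I)) (𝓝[<] π) (𝓝[{z : ℂ | 0 ≤ z.im}] (-3)) := by
    refine tendsto_nhdsWithin_iff.2 ⟨?_, ?_⟩
    · have : Continuous (fun x : ℝ => 4 + 7 * Complex.exp (x * I)) := by fun_prop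
      have h2 := (this.tendsto π).mono_left (nhdsWithin_le_nhds (s := Set.Iio π))
      rwa [Complex.exp_pi_mul_I, show (4 + 7 * (-1) : ℂ) = -3 by norm_num] at h2
    · filter_upwards [Ioo_mem_nhdsLT Real.pi_pos] with x hx
      simp only [ovalArc_base_im]
      have := Real.sin_pos_of_mem_Ioo hx
      positivity
  have hl := (Complex.tendsto_log_nhdsWithin_im_nonneg_of_re_neg_of_im_zero
    (z := -3) (by norm_num) (by norm_num)).comp hb
  have he := (hl.div_const 2).cexp
  have h3 := exp_log_three_div_two 1 (Or.inl rfl)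
  simp only [one_mul] at h3
  have h4 : Complex.exp ((↑(Real.log ‖(-3 : ℂ)‖) + ↑π * I) / 2) = (√3 : ℝ) * I := by
    rw [← h3]; simp
  rwa [h4] at he

/-- Only the limit gives the lower corner: at -π itself the principal logarithm of -3 makes
`ovalArc` take the value i√3 of the upper corner. -/
lemma tendsto_ovalArc_neg_pi : Tendsto ovalArc (𝓝[>] (-π)) (𝓝 ((-√3 : ℝ) * I)) := by
  have hb : Tendsto (fun x : ℝ => 4 + 7 * Complex.exp (x * I)) (𝓝[>] (-π))
      (𝓝[{z : ℂ | z.im < 0}] (-3)) := by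
    refine tendsto_nhdsWithin_iff.2 ⟨?_, ?_⟩
    · have : Continuous (fun x : ℝ => 4 + 7 * Complex.exp (x * I)) := by fun_prop
      have h2 := (this.tendsto (-π)).mono_left (nhdsWithin_le_nhds (s := Set.Ioi (-π)))
      rwa [Complex.ofReal_neg, neg_mul, Complex.exp_neg, Complex.exp_pi_mul_I,
        show (4 + 7 * (-1)⁻¹ : ℂ) = -3 by norm_num] at h2
    · filter_upwards [Ioo_mem_nhdsGT (neg_lt_zero.2 Real.pi_pos)] with x hx
      simp only [ovalArc_base_im]
      have := Real.sin_neg_of_neg_of_neg_pi_lt hx.2 hx.1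
      linarith
  have hl := (Complex.tendsto_log_nhdsWithin_im_neg_of_re_neg_of_im_zero
    (z := -3) (by norm_num) (by norm_num)).comp hb
  have he := (hl.div_const 2).cexp
  have h3 := exp_log_three_div_two (-1) (Or.inr rfl)
  simp only [neg_mul, one_mul] at h3
  have h4 : Complex.exp ((↑(Real.log ‖(-3 : ℂ)‖) - ↑π * I) / 2) = (-√3 : ℝ) * I := by
    rw [← h3]; simp [sub_eq_add_neg]
  rwa [h4] at he

end OvalArc

/-! ### Cauchy's theorem and the mean value formula on the half oval. -/

section OvalIntegrals

open Complex Real MeasureTheory Metric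

lemma measurable_ovalArc : Measurable ovalArc := by
  unfold ovalArc
  have : Measurable (fun φ : ℝ => (4 + 7 * Complex.exp (φ * I) : ℂ)) := by fun_prop
  exact (this.clog.div_const 2).cexp

/-- The closed right half disc `Re s ≥ 0`, `|s| ^ 2 ≤ 11`, which contains the right half of the
Cassini oval `|s ^ 2 - 4| ≤ 7`. -/
def halfDisc : Set ℂ := {s | 0 ≤ s.re ∧ ‖s‖ ^ 2 ≤ 11}

lemma ovalArc_mem_halfDisc (φ : ℝ) : ovalArc φ ∈ halfDisc :=
  ⟨ovalArc_re_nonneg φ, norm_ovalArc_sq_le φ⟩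

lemma mul_I_mem_halfDisc {t : ℝ} (ht : t ^ 2 ≤ 3) : (t : ℂ) * I ∈ halfDisc := by
  refine ⟨by simp, ?_⟩
  rw [norm_mul, norm_I, mul_one, Complex.norm_real, Real.norm_eq_abs, sq_abs]
  linarith

lemma isCompact_halfDisc : IsCompact halfDisc := by
  have hc : IsClosed halfDisc :=
    (isClosed_le continuous_const Complex.continuous_re).inter
      (isClosed_le (continuous_norm.pow 2) continuous_const)
  refine (isCompact_closedBall (0 : ℂ) 4).of_isClosed_subset hc ?_
  rintro s ⟨-, hs⟩
  rw [mem_closedBall_zero_iff]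
  nlinarith [norm_nonneg s]

lemma intervalIntegrable_of_bounded_on_halfDisc {E : Type*} [NormedAddCommGroup E] {f : ℝ → E}
    {C : ℝ} (hm : AEStronglyMeasurable f (volume.restrict (Set.Ioo (-π) π)))
    (hb : ∀ φ ∈ Set.Ioo (-π) π, ‖f φ‖ ≤ C) : IntervalIntegrable f volume (-π) π := by
  rw [intervalIntegrable_iff_integrableOn_Ioo_of_le (by linarith [Real.pi_pos])]
  refine IntegrableOn.of_bound (by simp) hm C ?_
  exact (ae_restrict_iff' measurableSet_Ioo).2 (Eventually.of_forall hb)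

lemma intervalIntegrable_comp_ovalArc {L : ℂ → ℂ} (hL : ContinuousOn L halfDisc) :
    IntervalIntegrable (fun φ => L (ovalArc φ)) volume (-π) π := by
  obtain ⟨C, hC⟩ := isCompact_halfDisc.exists_bound_of_continuousOn hL
  refine intervalIntegrable_of_bounded_on_halfDisc (C := C) ?_
    (fun φ _ => hC _ (ovalArc_mem_halfDisc φ))
  exact (hL.comp continuousOn_ovalArc fun φ _ => ovalArc_mem_halfDisc φ).aestronglyMeasurable
    measurableSet_Ioo

lemma sq_le_three_of_mem {t : ℝ} (ht : t ∈ Set.Icc (-√3) (√3)) : t ^ 2 ≤ 3 := by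
  have h3 : √3 ^ 2 = 3 := Real.sq_sqrt (by norm_num)
  nlinarith [ht.1, ht.2]

lemma integral_two_mul_div_sq_add_four :
    ∫ t in (-√3)..√3, ((2 * t / (t ^ 2 + 4) : ℝ) : ℂ) = 0 := by
  have h := intervalIntegral.integral_comp_neg (a := -√3) (b := √3)
    (fun t : ℝ => ((2 * t / (t ^ 2 + 4) : ℝ) : ℂ))
  simp only [neg_neg] at h
  have h2 : ∫ t in (-√3)..√3, ((2 * (-t) / ((-t) ^ 2 + 4) : ℝ) : ℂ)
      = -∫ t in (-√3)..√3, ((2 * t / (t ^ 2 + 4) : ℝ) : ℂ) := by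
    rw [← intervalIntegral.integral_neg]
    congr 1; ext t; push_cast; ring
  rw [h2] at h
  exact self_eq_neg.1 h.symm

/-- A primitive of H on the ball has the same increment along the arc and along the chord from -i√3
to i√3. -/
lemma ovalArc_contour {H : ℂ → ℂ} {c : ℂ} {r : ℝ} (hK : halfDisc ⊆ ball c r)
    (hH : DifferentiableOn ℂ H (ball c r)) :
    ∫ φ in (-π)..π, H (ovalArc φ) * (I * (ovalArc φ ^ 2 - 4) / (2 * ovalArc φ))
      = ∫ t in (-√3)..√3, H (t * I) * I := by
  obtain ⟨Φ, hΦ⟩ := hH.isExactOn_ball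
  have hcont : ContinuousOn H halfDisc := hH.continuousOn.mono hK
  have h3 : (√3) ^ 2 ≤ 3 := (Real.sq_sqrt (by norm_num)).le
  have hp : ((√3 : ℝ) : ℂ) * I ∈ ball c r := hK (mul_I_mem_halfDisc h3)
  have hn : ((-√3 : ℝ) : ℂ) * I ∈ ball c r := hK (mul_I_mem_halfDisc (by simp))
  have harc : ∫ φ in (-π)..π, H (ovalArc φ) * (I * (ovalArc φ ^ 2 - 4) / (2 * ovalArc φ))
      = Φ ((√3 : ℝ) * I) - Φ ((-√3 : ℝ) * I) := by
    refine intervalIntegral.integral_eq_sub_of_hasDerivAt_of_tendsto (f := fun φ => Φ (ovalArc φ))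
      (by linarith [Real.pi_pos]) (fun φ hφ => ?_) ?_ ?_ ?_
    · exact (hΦ _ (hK (ovalArc_mem_halfDisc φ))).comp φ (hasDerivAt_ovalArc hφ)
    · have hm : ContinuousOn (fun φ : ℝ =>
          H (ovalArc φ) * (I * (ovalArc φ ^ 2 - 4) / (2 * ovalArc φ))) (Set.Ioo (-π) π) := by
        refine (hcont.comp continuousOn_ovalArc fun φ _ => ovalArc_mem_halfDisc φ).mul ?_
        refine ContinuousOn.div ?_ ?_ fun φ _ => by simpa using ovalArc_ne_zero φ
        · exact continuousOn_const.mul ((continuousOn_ovalArc.pow 2).sub continuousOn_const)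
        · exact continuousOn_const.mul continuousOn_ovalArc
      obtain ⟨C, hC⟩ := isCompact_halfDisc.exists_bound_of_continuousOn hcont
      refine intervalIntegrable_of_bounded_on_halfDisc (C := C * 7)
        (hm.aestronglyMeasurable measurableSet_Ioo) fun φ _ => ?_
      rw [norm_mul]
      refine mul_le_mul (hC _ (ovalArc_mem_halfDisc φ)) ?_ (norm_nonneg _)
        ((norm_nonneg _).trans (hC _ (ovalArc_mem_halfDisc φ)))
      rw [norm_div, norm_mul, norm_I, one_mul, norm_ovalArc_sq_sub, norm_mul]
      -- The relation |s² - 4| = 7 forces |s|² ≥ 3, so s' is bounded on the arc.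
      have h1 : 1 ≤ ‖ovalArc φ‖ := by
        have h2 : 3 ≤ ‖ovalArc φ‖ ^ 2 := by
          have := norm_sub_le (ovalArc φ ^ 2) 4
          rw [norm_ovalArc_sq_sub, norm_pow] at this
          norm_num at this; linarith
        nlinarith [norm_nonneg (ovalArc φ)]
      rw [div_le_iff₀ (by simpa using ovalArc_ne_zero φ)]
      norm_num; linarith
    · exact ((hΦ _ hn).continuousAt.tendsto).comp (by simpa using tendsto_ovalArc_neg_pi)
    · exact ((hΦ _ hp).continuousAt.tendsto).comp tendsto_ovalArc_pi
  rw [harc]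
  symm
  have hle : -√3 ≤ √3 := by linarith [Real.sqrt_nonneg 3]
  refine intervalIntegral.integral_eq_sub_of_hasDerivAt (f := fun t : ℝ => Φ (t * I))
    (fun t ht => ?_) ?_
  · rw [Set.uIcc_of_le hle] at ht
    have h1 : HasDerivAt (fun x : ℝ => (x : ℂ) * I) (1 * I) t :=
      (Complex.ofRealCLM.hasDerivAt).mul_const I
    rw [one_mul] at h1
    exact (hΦ _ (hK (mul_I_mem_halfDisc (sq_le_three_of_mem ht)))).comp t h1
  · refine ContinuousOn.intervalIntegrable ?_
    rw [Set.uIcc_of_le hle]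
    refine ContinuousOn.mul ?_ continuousOn_const
    exact hcont.comp (by fun_prop) fun t ht => mul_I_mem_halfDisc (sq_le_three_of_mem ht)

/-- The mean value formula for a holomorphic function on the right half of the Cassini oval:
the value at the focus `2` in terms of the values on the arc and on the imaginary axis. -/
lemma integral_comp_ovalArc {L : ℂ → ℂ} {c : ℂ} {r : ℝ} (hK : halfDisc ⊆ ball c r)
    (h2 : (-2 : ℂ) ∉ ball c r) (hL : DifferentiableOn ℂ L (ball c r)) :
    ∫ φ in (-π)..π, L (ovalArc φ)
      = 2 * π * L 2 - I * ∫ t in (-√3)..√3, L (t * I) * ((2 * t / (t ^ 2 + 4) : ℝ) : ℂ) := by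
  have hmem2 : (2 : ℂ) ∈ ball c r := hK ⟨by simp, by norm_num⟩
  have hcont : ContinuousOn L halfDisc := hL.continuousOn.mono hK
  -- The integrand is (L(s) - L(2)) 2s/(s² - 4), where 2s ds/(s² - 4) = d log(s² - 4). This form
  -- equals i dφ on the arc and becomes the odd real kernel 2t/(t² + 4) dt on the axis. The pole at
  -- 2 is removed by the difference quotient, the one at -2 lies outside the ball.
  have hH : DifferentiableOn ℂ (fun s => dslope L 2 s * (2 * s / (s + 2))) (ball c r) := by
    refine ((Complex.differentiableOn_dslope (isOpen_ball.mem_nhds hmem2)).2 hL).mul ?_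
    refine DifferentiableOn.div (by fun_prop) (by fun_prop) fun s hs h => h2 ?_
    rwa [← eq_neg_of_add_eq_zero_left h]
  have hslope : ∀ s : ℂ, s ≠ 2 → dslope L 2 s = (L s - L 2) / (s - 2) := fun s hs => by
    rw [dslope_of_ne _ hs, slope_def_field]
  have key := ovalArc_contour hK hH
  have hl : ∫ φ in (-π)..π, dslope L 2 (ovalArc φ) * (2 * ovalArc φ / (ovalArc φ + 2)) *
      (I * (ovalArc φ ^ 2 - 4) / (2 * ovalArc φ)) = I * ((∫ φ in (-π)..π, L (ovalArc φ)) - 2 * π * L 2) := by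
    have h1 : ∀ φ : ℝ, dslope L 2 (ovalArc φ) * (2 * ovalArc φ / (ovalArc φ + 2)) *
      (I * (ovalArc φ ^ 2 - 4) / (2 * ovalArc φ)) = I * (L (ovalArc φ) - L 2) := by
      intro φ
      have hne : ovalArc φ ^ 2 - 4 ≠ 0 := by
        rw [← norm_ne_zero_iff, norm_ovalArc_sq_sub]; norm_num
      have hf : ovalArc φ ^ 2 - 4 = (ovalArc φ - 2) * (ovalArc φ + 2) := by ring
      rw [hf] at hne ⊢
      have ha := left_ne_zero_of_mul hne
      have hb := right_ne_zero_of_mul hne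
      have hc := ovalArc_ne_zero φ
      rw [hslope _ (sub_ne_zero.1 ha)]
      field_simp
    simp_rw [h1]
    rw [intervalIntegral.integral_const_mul, intervalIntegral.integral_sub
      (intervalIntegrable_comp_ovalArc hcont) intervalIntegrable_const]
    simp only [intervalIntegral.integral_const, sub_neg_eq_add, real_smul]
    push_cast; ring
  have hr : ∫ t in (-√3)..√3, dslope L 2 (t * I) * (2 * (t * I) / (t * I + 2)) * I
      = ∫ t in (-√3)..√3, L (t * I) * ((2 * t / (t ^ 2 + 4) : ℝ) : ℂ) := by
    have h1 : ∀ t : ℝ, dslope L 2 (t * I) * (2 * (t * I) / (t * I + 2)) * I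
        = L (t * I) * ((2 * t / (t ^ 2 + 4) : ℝ) : ℂ) - L 2 * ((2 * t / (t ^ 2 + 4) : ℝ) : ℂ) := by
      intro t
      have ha : (t : ℂ) * I - 2 ≠ 0 := fun h => by simpa using congrArg Complex.re h
      have hb : (t : ℂ) * I + 2 ≠ 0 := fun h => by simpa using congrArg Complex.re h
      have hc : ((t : ℂ) ^ 2 + 4) ≠ 0 := by
        have : (t ^ 2 + 4 : ℝ) ≠ 0 := by positivity
        exact_mod_cast this
      rw [hslope _ (sub_ne_zero.1 ha)]
      push_cast
      field_simp
      have hI : I ^ 2 = -1 := I_sq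
      linear_combination (4 * t * (L (t * I) - L 2)) * hI
    simp_rw [h1]
    have hle : -√3 ≤ √3 := by linarith [Real.sqrt_nonneg 3]
    have hq : Continuous fun t : ℝ => ((2 * t / (t ^ 2 + 4) : ℝ) : ℂ) := by
      refine Complex.continuous_ofReal.comp (Continuous.div (by fun_prop) (by fun_prop) fun t => ?_)
      positivity
    rw [intervalIntegral.integral_sub, intervalIntegral.integral_const_mul,
      integral_two_mul_div_sq_add_four, mul_zero, sub_zero]
    · refine ContinuousOn.intervalIntegrable (ContinuousOn.mul ?_ hq.continuousOn)
      rw [Set.uIcc_of_le hle]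
      exact hcont.comp (by fun_prop) fun t ht => mul_I_mem_halfDisc (sq_le_three_of_mem ht)
    · exact (continuous_const.mul hq).intervalIntegrable _ _
  rw [hl, hr] at key
  rw [← key]
  linear_combination ((∫ φ in (-π)..π, L (ovalArc φ)) - 2 * π * L 2) * I_sq

/-- This is the Neumann condition at work: since the kernel on the axis is real and carries a factor
i, the real part of L is expressed there by its harmonic conjugate only. For L a logarithm, that is
an argument. -/
lemma integral_re_comp_ovalArc {L : ℂ → ℂ} {c : ℂ} {r : ℝ} (hK : halfDisc ⊆ ball c r)
    (h2 : (-2 : ℂ) ∉ ball c r) (hL : DifferentiableOn ℂ L (ball c r)) :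
    ∫ φ in (-π)..π, (L (ovalArc φ)).re
      = 2 * π * (L 2).re + ∫ t in (-√3)..√3, (L (t * I)).im * (2 * t / (t ^ 2 + 4)) := by
  have hcont : ContinuousOn L halfDisc := hL.continuousOn.mono hK
  have h := congrArg Complex.re (integral_comp_ovalArc hK h2 hL)
  have hle : -√3 ≤ √3 := by linarith [Real.sqrt_nonneg 3]
  have hi : IntervalIntegrable (fun t : ℝ => L (t * I) * ((2 * t / (t ^ 2 + 4) : ℝ) : ℂ))
      volume (-√3) √3 := by
    have hq : Continuous fun t : ℝ => ((2 * t / (t ^ 2 + 4) : ℝ) : ℂ) := by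
      refine Complex.continuous_ofReal.comp (Continuous.div (by fun_prop) (by fun_prop) fun t => ?_)
      positivity
    refine ContinuousOn.intervalIntegrable (ContinuousOn.mul ?_ hq.continuousOn)
    rw [Set.uIcc_of_le hle]
    exact hcont.comp (by fun_prop) fun t ht => mul_I_mem_halfDisc (sq_le_three_of_mem ht)
  have h1 := Complex.reCLM.intervalIntegral_comp_comm (intervalIntegrable_comp_ovalArc hcont)
  have h3 := Complex.imCLM.intervalIntegral_comp_comm hi
  simp only [reCLM_apply, imCLM_apply, im_mul_ofReal] at h1 h3
  rw [h1, h3, h, Complex.sub_re, Complex.mul_re (I : ℂ)]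
  simp

end OvalIntegrals

/-! ### Logarithmic potentials of the arc and the Green function. -/

section OvalLog

open Complex Real MeasureTheory Metric

/-- The square of the arc is the circle of centre 4 and radius 7, so the classical circle average
applies. -/
lemma intervalIntegrable_log_norm_ovalArc_sq_sub (c : ℂ) :
    IntervalIntegrable (fun φ => Real.log ‖ovalArc φ ^ 2 - c‖) volume (-π) π ∧
    ∫ φ in (-π)..π, Real.log ‖ovalArc φ ^ 2 - c‖
      = 2 * π * (Real.log 7 + Real.posLog (7⁻¹ * ‖4 - c‖)) := by
  have hfun : (fun φ : ℝ => Real.log ‖ovalArc φ ^ 2 - c‖)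
      = fun φ => Real.log ‖circleMap 4 7 φ - c‖ := by
    ext φ; rw [ovalArc_sq, circleMap]; norm_num
  have hper : Function.Periodic (fun φ => Real.log ‖circleMap 4 7 φ - c‖) (2 * π) := fun φ => by
    simp only [periodic_circleMap 4 7 φ]
  have hci : CircleIntegrable (fun z => Real.log ‖z - c‖) 4 7 := by
    refine MeromorphicOn.circleIntegrable_log_norm fun z _ => ?_
    exact (MeromorphicAt.id z).sub (MeromorphicAt.const c z)
  constructor
  · rw [hfun]
    refine hper.intervalIntegrable (t := 0) (by positivity) ?_ _ _
    rw [zero_add]; exact hci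
  · have h := circleAverage_log_norm_sub_const_eq_log_radius_add_posLog (a := c) (c := 4)
      (R := 7) (by norm_num)
    rw [Real.circleAverage, smul_eq_mul, inv_mul_eq_iff_eq_mul₀ (by positivity)] at h
    rw [hfun, ← h]
    have h1 := hper.intervalIntegral_add_eq (-π) 0
    rw [zero_add, show -π + 2 * π = π by ring] at h1
    exact h1

lemma three_le_norm_ovalArc_sq (φ : ℝ) : 3 ≤ ‖ovalArc φ‖ ^ 2 := by
  have := norm_sub_le (ovalArc φ ^ 2) 4
  rw [norm_ovalArc_sq_sub, norm_pow] at this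
  norm_num at this; linarith

lemma norm_ovalArc_le (φ : ℝ) : ‖ovalArc φ‖ ≤ 4 := by
  nlinarith [norm_ovalArc_sq_le φ, norm_nonneg (ovalArc φ)]

/-- The factorisation s² - u² = (s - u)(s + u) reduces integrability to the circle: the second
factor is bounded above, so log |s - u| is bounded below by the logarithm on the circle minus a
constant. -/
lemma intervalIntegrable_log_norm_ovalArc_sub (u : ℂ) :
    IntervalIntegrable (fun φ => Real.log ‖ovalArc φ - u‖) volume (-π) π := by
  have h0 := (intervalIntegrable_log_norm_ovalArc_sq_sub (u ^ 2)).1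
  have h1 : IntervalIntegrable (fun φ => ‖Real.log ‖ovalArc φ ^ 2 - u ^ 2‖‖ + Real.log (4 + ‖u‖))
      volume (-π) π := h0.norm.add intervalIntegrable_const
  refine h1.mono_fun' ?_ (ae_of_all _ fun φ => ?_)
  · exact (Real.measurable_log.comp (measurable_ovalArc.sub_const u).norm).aestronglyMeasurable
  have hs := norm_ovalArc_le φ
  have hu := norm_nonneg u
  have hC : 0 ≤ Real.log (4 + ‖u‖) := Real.log_nonneg (by linarith)
  have hle : ∀ v : ℂ, ‖v‖ = ‖u‖ → Real.log ‖ovalArc φ - v‖ ≤ Real.log (4 + ‖u‖) := by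
    intro v hv
    rcases eq_or_ne (ovalArc φ - v) 0 with h | h
    · simp [h, hC]
    · refine Real.log_le_log (norm_pos_iff.2 h) ((norm_sub_le _ _).trans ?_)
      rw [hv]; linarith
  have hle1 := hle u rfl
  have hle2 := hle (-u) (norm_neg u)
  have hn : 0 ≤ ‖Real.log ‖ovalArc φ ^ 2 - u ^ 2‖‖ := norm_nonneg _
  simp only
  rw [Real.norm_eq_abs (Real.log ‖ovalArc φ - u‖), abs_le]
  refine ⟨?_, by linarith⟩
  rcases eq_or_ne (ovalArc φ - u) 0 with h | h
  · rw [h]; simp only [norm_zero, Real.log_zero]; linarith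
  -- At s = -u the majorant degenerates, since `Real.log 0 = 0`; but there |s - u| = 2|s| is at
  -- least 1.
  rcases eq_or_ne (ovalArc φ - -u) 0 with h' | h'
  · have : 1 ≤ ‖ovalArc φ - u‖ := by
      have e : ovalArc φ - u = 2 * ovalArc φ := by linear_combination -h'
      rw [e, norm_mul, Complex.norm_two]
      nlinarith [three_le_norm_ovalArc_sq φ, norm_nonneg (ovalArc φ)]
    have := Real.log_nonneg this
    linarith
  · have e : Real.log ‖ovalArc φ ^ 2 - u ^ 2‖
        = Real.log ‖ovalArc φ - u‖ + Real.log ‖ovalArc φ - -u‖ := by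
      rw [← Real.log_mul (norm_ne_zero_iff.2 h) (norm_ne_zero_iff.2 h'), ← norm_mul]
      congr 2; ring
    rw [Real.norm_eq_abs]
    have := neg_abs_le (Real.log ‖ovalArc φ ^ 2 - u ^ 2‖)
    linarith

lemma finite_ovalArc_preimage (S : Set ℂ) (hS : S.Finite) :
    {φ ∈ Set.Ioc (-π) π | ovalArc φ ∈ S}.Finite := by
  refine Set.Finite.of_finite_image (f := ovalArc) (hS.subset ?_) ?_
  · rintro _ ⟨φ, hφ, rfl⟩; exact hφ.2
  · intro x hx y hy hxy
    have h : Complex.exp (x * I) = Complex.exp (y * I) := by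
      have h1 := ovalArc_sq x
      rw [hxy, ovalArc_sq y] at h1
      linear_combination -(1 / 7 : ℂ) * h1
    have hx' := Complex.arg_exp_mul_I x
    rw [h, Complex.arg_exp_mul_I, toIocMod_eq_self _ |>.2, toIocMod_eq_self _ |>.2] at hx'
    · exact hx'.symm
    · rw [show -π + 2 * π = π by ring]; exact hx.1
    · rw [show -π + 2 * π = π by ring]; exact hy.1

lemma ae_ovalArc_notMem {S : Set ℂ} (hS : S.Finite) :
    ∀ᵐ φ : ℝ, φ ∈ Set.Ioc (-π) π → ovalArc φ ∉ S := by
  have h := (finite_ovalArc_preimage S hS).measure_zero volume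
  rw [← compl_mem_ae_iff] at h
  filter_upwards [h] with φ hφ h1 h2
  exact hφ ⟨h1, h2⟩

lemma integral_congr_off_finite {f g : ℝ → ℝ} {S : Set ℂ} (hS : S.Finite)
    (h : ∀ φ, ovalArc φ ∉ S → f φ = g φ) : ∫ φ in (-π)..π, f φ = ∫ φ in (-π)..π, g φ := by
  refine intervalIntegral.integral_congr_ae ?_
  rw [Set.uIoc_of_le (by linarith [Real.pi_pos])]
  filter_upwards [ae_ovalArc_notMem hS] with φ hφ h1
  exact h φ (hφ h1)

/-- The integral of `log |s - u|` over the arc. -/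
noncomputable def ovalLog (u : ℂ) : ℝ := ∫ φ in (-π)..π, Real.log ‖ovalArc φ - u‖

lemma ovalLog_conj (u : ℂ) : ovalLog ((starRingEnd ℂ) u) = ovalLog u := by
  unfold ovalLog
  have h := intervalIntegral.integral_comp_neg (a := -π) (b := π)
    (fun φ => Real.log ‖ovalArc φ - u‖)
  rw [neg_neg] at h
  rw [← h]
  refine intervalIntegral.integral_congr_ae ?_
  rw [Set.uIoc_of_le (by linarith [Real.pi_pos])]
  have h2 : ∀ᵐ φ : ℝ, φ ≠ π := by simp [ae_iff]
  filter_upwards [h2] with φ hne hφ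
  rw [ovalArc_neg ⟨hφ.1, lt_of_le_of_ne hφ.2 hne⟩, ← Complex.norm_conj, map_sub, conj_conj]

lemma ovalLog_add_ovalLog_neg (u : ℂ) :
    ovalLog u + ovalLog (-u) = 2 * π * (Real.log 7 + Real.posLog (7⁻¹ * ‖4 - u ^ 2‖)) := by
  rw [← (intervalIntegrable_log_norm_ovalArc_sq_sub (u ^ 2)).2, ovalLog, ovalLog,
    ← intervalIntegral.integral_add (intervalIntegrable_log_norm_ovalArc_sub u)
      (intervalIntegrable_log_norm_ovalArc_sub (-u))]
  refine integral_congr_off_finite (S := {u, -u}) (by simp) fun φ hφ => ?_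
  simp only [Set.mem_insert_iff, Set.mem_singleton_iff, not_or] at hφ
  rw [← Real.log_mul (norm_ne_zero_iff.2 (sub_ne_zero.2 hφ.1))
    (norm_ne_zero_iff.2 (sub_ne_zero.2 hφ.2)), ← norm_mul]
  congr 2; ring

/-- The Green function with pole at `2` of the right half of the Cassini oval
`|s ^ 2 - 4| < 7`, with Neumann condition on the imaginary axis. -/
noncomputable def ovalWeight (u : ℂ) : ℝ := Real.posLog (7 / ‖u ^ 2 - 4‖)

lemma ovalWeight_nonneg (u : ℂ) : 0 ≤ ovalWeight u := Real.posLog_nonneg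

lemma ovalLog_add_ovalLog_neg_eq_weight {u : ℂ} (hu : u ^ 2 ≠ 4) :
    ovalLog u + ovalLog (-u) = 2 * π * (ovalWeight u + Real.log ‖2 - u‖ + Real.log ‖2 + u‖) := by
  have h0 : u ^ 2 - 4 ≠ 0 := sub_ne_zero.2 hu
  have h1 : (2 - u) * (2 + u) ≠ 0 := by
    intro h; apply h0; linear_combination -h
  have e : ‖4 - u ^ 2‖ = ‖u ^ 2 - 4‖ := norm_sub_rev _ _
  rw [ovalLog_add_ovalLog_neg, add_assoc, ← Real.log_mul
    (norm_ne_zero_iff.2 (left_ne_zero_of_mul h1)) (norm_ne_zero_iff.2 (right_ne_zero_of_mul h1)),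
    ← norm_mul, show (2 - u) * (2 + u) = 4 - u ^ 2 by ring, ovalWeight, e]
  congr 1
  have h2 := Real.posLog_sub_posLog_inv (x := 7 / ‖u ^ 2 - 4‖)
  rw [inv_div, Real.log_div (by norm_num) (norm_ne_zero_iff.2 h0)] at h2
  rw [inv_mul_eq_div]
  linarith

/-- A large ball imitates the half plane Re s > -δ: with c = 11/δ one has |s - c|² ≤ 11 + c² on the
half disc, which is less than (c + δ)² = c² + 22 + δ². -/
lemma halfDisc_subset_ball {δ : ℝ} (hδ : 0 < δ) :
    halfDisc ⊆ ball ((11 / δ : ℝ) : ℂ) (11 / δ + δ) := by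
  rintro s ⟨h1, h2⟩
  rw [mem_ball, dist_eq_norm]
  refine lt_of_pow_lt_pow_left₀ 2 (by positivity) ?_
  rw [← Complex.normSq_eq_norm_sq, Complex.normSq_apply] at h2 ⊢
  simp only [sub_re, ofReal_re, sub_im, ofReal_im, sub_zero]
  have h3 : 11 / δ * δ = 11 := by field_simp
  have h4 : 0 ≤ 11 / δ := by positivity
  nlinarith [mul_nonneg h1 h4]

lemma ball_subset_re_gt {δ : ℝ} {s : ℂ} (hs : s ∈ ball ((11 / δ : ℝ) : ℂ) (11 / δ + δ)) :
    -δ < s.re := by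
  rw [mem_ball, dist_eq_norm] at hs
  have h := (Complex.abs_re_le_norm _).trans_lt hs
  rw [sub_re, ofReal_re] at h
  linarith [(abs_lt.1 h).1]

lemma ovalLog_of_re_neg {u : ℂ} (hu : u.re < 0) :
    ovalLog u = 2 * π * Real.log ‖2 - u‖
      + ∫ t in (-√3)..√3, Complex.arg (t * I - u) * (2 * t / (t ^ 2 + 4)) := by
  -- The bound -Re u keeps s - u in the right half plane over the whole ball, so the principal
  -- logarithm is holomorphic; the bound 2 keeps -2 outside.
  have hδ : 0 < min (-u.re) 2 := lt_min (by linarith) (by norm_num)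
  have h := integral_re_comp_ovalArc (L := fun s => Complex.log (s - u)) (halfDisc_subset_ball hδ)
    (fun hm => ?_) (fun s hs => ?_)
  · simp only [Complex.log_re, Complex.log_im] at h
    exact h
  · have h1 := ball_subset_re_gt hm
    have h2 : min (-u.re) 2 ≤ 2 := min_le_right _ _
    norm_num at h1
  · have h1 := ball_subset_re_gt hs
    have h2 : min (-u.re) 2 ≤ -u.re := min_le_left _ _
    refine (DifferentiableAt.clog (by fun_prop) ?_).differentiableWithinAt
    rw [Complex.mem_slitPlane_iff]
    left; rw [sub_re]; linarith

/-- With u in the right half plane no branch of log(s - u) is available, but -u falls under the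
previous case and the sum of the two potentials is known. Conjugation symmetry lets -conj u replace
-u. -/
lemma ovalLog_of_re_pos {u : ℂ} (hu : 0 < u.re) (h2 : u ≠ 2) :
    ovalLog u = 2 * π * (ovalWeight u + Real.log ‖2 - u‖)
      - ∫ t in (-√3)..√3, Complex.arg (t * I + (starRingEnd ℂ) u) * (2 * t / (t ^ 2 + 4)) := by
  have hsq : u ^ 2 ≠ 4 := by
    intro h
    have : (u - 2) * (u + 2) = 0 := by linear_combination h
    rcases mul_eq_zero.1 this with h | h
    · exact h2 (sub_eq_zero.1 h)
    · have := congrArg Complex.re h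
      simp at this; linarith
  have h1 := ovalLog_add_ovalLog_neg_eq_weight hsq
  have h3 := ovalLog_of_re_neg (u := -(starRingEnd ℂ) u) (by simpa using hu)
  rw [← map_neg, ovalLog_conj] at h3
  simp only [map_neg, sub_neg_eq_add] at h3
  have h4 : ‖2 + (starRingEnd ℂ) u‖ = ‖2 + u‖ := by
    rw [← Complex.norm_conj, map_add, conj_conj, map_ofNat]
  rw [h4] at h3
  linarith

/-- On the axis -u is the conjugate of u, so the two potentials coincide and each carries half of
the weight. -/
lemma ovalLog_of_re_eq_zero {u : ℂ} (hu : u.re = 0) :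
    ovalLog u = 2 * π * (ovalWeight u / 2 + Real.log ‖2 - u‖) := by
  have hconj : (starRingEnd ℂ) u = -u := by
    apply Complex.ext <;> simp [hu]
  have hsq : u ^ 2 ≠ 4 := by
    intro h
    have := congrArg Complex.re h
    rw [sq, Complex.mul_re, hu] at this
    norm_num at this
    nlinarith
  have h1 := ovalLog_add_ovalLog_neg_eq_weight hsq
  have h4 : ‖2 + u‖ = ‖2 - u‖ := by
    rw [← Complex.norm_conj, map_add, hconj, map_ofNat, sub_eq_add_neg]
  have h3 := ovalLog_conj u
  rw [hconj] at h3
  rw [h4] at h1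
  linarith

end OvalLog

/-! ### Variation of a unimodular phase along the imaginary axis. -/

section LineCount

open Complex Real MeasureTheory

/-- A larger drop of θ would cross, by the intermediate value theorem, one more level of an
arithmetic progression of step 2π than Z has elements. On each such level c exp(iθ) equals -1. -/
lemma card_unimodular_level {θ : ℝ → ℝ} {a b : ℝ} (hab : a ≤ b) (hθ : ContinuousOn θ (Set.Icc a b))
    {c : ℂ} (hc : ‖c‖ = 1) (Z : Finset ℝ)
    (hZ : ∀ t ∈ Set.Ioo a b, c * Complex.exp (θ t * I) = -1 → t ∈ Z) :
    -(2 * π * (Z.card + 1)) ≤ θ b - θ a := by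
  by_contra! hlt
  have hpi := Real.pi_pos
  have hcne : c ≠ 0 := by rw [← norm_ne_zero_iff, hc]; norm_num
  set x₀ : ℝ := Complex.arg (-c⁻¹) with hx₀
  have hx : c * Complex.exp (x₀ * I) = -1 := by
    have h1 := Complex.norm_mul_exp_arg_mul_I (-c⁻¹)
    rw [norm_neg, norm_inv, hc, inv_one, ofReal_one, one_mul, ← hx₀] at h1
    rw [h1]; field_simp
  -- This is the first level strictly above θ b. It exceeds θ b by at most 2π, so it and the next
  -- `Z.card` levels all stay below θ a.
  set k₀ : ℤ := ⌊(θ b - x₀) / (2 * π)⌋ + 1 with hk₀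
  have hfl1 := Int.floor_le ((θ b - x₀) / (2 * π))
  have hfl2 := Int.lt_floor_add_one ((θ b - x₀) / (2 * π))
  rw [le_div_iff₀ (by positivity)] at hfl1
  rw [div_lt_iff₀ (by positivity)] at hfl2
  have hk : (k₀ : ℝ) = ⌊(θ b - x₀) / (2 * π)⌋ + 1 := by rw [hk₀]; push_cast; ring
  have hex : ∀ j : Fin (Z.card + 1), ∃ t ∈ Set.Ioo a b, θ t = x₀ + 2 * π * (k₀ + (j : ℕ)) := by
    intro j
    have hj : ((j : ℕ) : ℝ) ≤ Z.card := by exact_mod_cast Nat.lt_succ_iff.1 j.2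
    have hj0 : (0 : ℝ) ≤ ((j : ℕ) : ℝ) := by positivity
    refine intermediate_value_Ioo' hab hθ ⟨?_, ?_⟩
    · rw [hk]; nlinarith
    · rw [hk]; nlinarith
  choose t ht hθt using hex
  have hmem : ∀ j, t j ∈ Z := by
    intro j
    refine hZ _ (ht j) ?_
    rw [hθt, ← hx]
    congr 1
    rw [Complex.exp_eq_exp_iff_exists_int]
    exact ⟨k₀ + (j : ℕ), by push_cast; ring⟩
  have hinj : Function.Injective t := by
    intro i j hij
    have h1 := hθt i
    rw [hij, hθt j] at h1
    have h2 : ((i : ℕ) : ℝ) = ((j : ℕ) : ℝ) := by nlinarith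
    exact Fin.ext (by exact_mod_cast h2)
  have := Finset.card_le_card_of_injOn t (s := Finset.univ) (t := Z) (fun j _ => hmem j)
    hinj.injOn
  simp at this

lemma integral_two_mul_div_sq_add_four' (x : ℝ) :
    ∫ t in (0 : ℝ)..x, 2 * t / (t ^ 2 + 4) = Real.log ((x ^ 2 + 4) / 4) := by
  have hd : ∀ t ∈ Set.uIcc 0 x, HasDerivAt (fun t : ℝ => Real.log (t ^ 2 + 4))
      (2 * t / (t ^ 2 + 4)) t := fun t _ => by
    have h1 : HasDerivAt (fun t : ℝ => t ^ 2 + 4) (2 * t) t := by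
      simpa using (hasDerivAt_pow 2 t).add_const 4
    exact h1.log (by positivity)
  rw [intervalIntegral.integral_eq_sub_of_hasDerivAt hd, Real.log_div (by positivity) (by norm_num)]
  · norm_num
  · refine Continuous.intervalIntegrable ?_ _ _
    exact Continuous.div (by fun_prop) (by fun_prop) fun t => by positivity

lemma ovalWeight_mul_I {t : ℝ} (ht : t ^ 2 ≤ 3) :
    ovalWeight (t * I) = Real.log (7 / 4) - Real.log ((t ^ 2 + 4) / 4) := by
  have h1 : ‖((t : ℂ) * I) ^ 2 - 4‖ = t ^ 2 + 4 := by
    rw [mul_pow, I_sq, show ((t : ℂ) ^ 2 * -1 - 4) = -((t ^ 2 + 4 : ℝ) : ℂ) by push_cast; ring,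
      norm_neg, Complex.norm_real, Real.norm_of_nonneg (by positivity)]
  have h2 : 1 ≤ |7 / (t ^ 2 + 4)| := by
    rw [abs_of_nonneg (by positivity), le_div_iff₀ (by positivity)]; linarith
  rw [ovalWeight, h1, Real.posLog_eq_log h2, ← Real.log_div (by norm_num) (by positivity)]
  congr 1; field_simp

/-- The kernel is odd, so the integral is that of (θ(t) - θ(-t)) 2t/(t² + 4) over 0 < t < √3, and
the previous count applies on (-t, t). An ordinate z counts for t > |z|, and the kernel has mass
log(7/(z² + 4)) there, which is the weight of iz. The extra unit in the count yields log(7/4), the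
total mass. -/
lemma integral_phase_ge {θ : ℝ → ℝ} (hθ : ContinuousOn θ (Set.Icc (-√3) √3))
    {c : ℂ} (hc : ‖c‖ = 1) (Z : Finset ℝ)
    (hZ : ∀ t ∈ Set.Ioo (-√3) √3, c * Complex.exp (θ t * I) = -1 → t ∈ Z) :
    -(2 * π * (∑ t ∈ Z, ovalWeight (t * I) + Real.log (7 / 4)))
      ≤ ∫ t in (-√3)..√3, θ t * (2 * t / (t ^ 2 + 4)) := by
  have h3 : (√3) ^ 2 = 3 := Real.sq_sqrt (by norm_num)
  have hs : 0 ≤ √3 := Real.sqrt_nonneg 3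
  have hpi := Real.pi_pos
  have hq : Continuous fun t : ℝ => 2 * t / (t ^ 2 + 4) :=
    Continuous.div (by fun_prop) (by fun_prop) fun t => by positivity
  have hi : ∀ a b, a ∈ Set.Icc (-√3) √3 → b ∈ Set.Icc (-√3) √3 → a ≤ b →
      IntervalIntegrable (fun t => θ t * (2 * t / (t ^ 2 + 4))) volume a b := by
    intro a b ha hb hab
    refine ContinuousOn.intervalIntegrable ?_
    rw [Set.uIcc_of_le hab]
    exact (hθ.mono (Set.Icc_subset_Icc ha.1 hb.2)).mul hq.continuousOn
  have hi1 := hi (-√3) 0 ⟨le_rfl, by linarith⟩ ⟨by linarith, hs⟩ (by linarith)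
  have hi2 := hi 0 √3 ⟨by linarith, hs⟩ ⟨by linarith, le_rfl⟩ hs
  have hneg : ∫ t in (-√3)..0, θ t * (2 * t / (t ^ 2 + 4))
      = ∫ t in (0 : ℝ)..√3, -(θ (-t) * (2 * t / (t ^ 2 + 4))) := by
    have := intervalIntegral.integral_comp_neg (a := 0) (b := √3)
      (fun t => θ t * (2 * t / (t ^ 2 + 4)))
    rw [neg_zero] at this
    rw [← this]; congr 1; ext t; rw [neg_sq]; ring
  have hineg : IntervalIntegrable (fun t => -(θ (-t) * (2 * t / (t ^ 2 + 4)))) volume 0 √3 := by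
    have := (hi1.comp_sub_left 0).symm
    simp only [sub_neg_eq_add, zero_add, sub_zero, zero_sub] at this
    refine this.congr fun t _ => ?_
    simp only [neg_sq]; ring
  rw [← intervalIntegral.integral_add_adjacent_intervals hi1 hi2, hneg,
    ← intervalIntegral.integral_add hineg hi2]
  -- Ordinates beyond the corners of the oval never enter the count; dropping them is harmless
  -- because weights are nonnegative.
  set Z' := Z.filter fun t => |t| < √3 with hZ'
  let ind : ℝ → ℝ → ℝ := fun z t => 2 * t / (t ^ 2 + 4)
    - Set.indicator {x | x ≤ |z|} (fun t => 2 * t / (t ^ 2 + 4)) t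
  have hind : ∀ z ∈ Z', ∫ t in (0 : ℝ)..√3, ind z t = ovalWeight (z * I) := by
    intro z hz
    have hz' := (Finset.mem_filter.1 hz).2
    have hz2 : z ^ 2 ≤ 3 := by rw [← sq_abs, ← h3]; exact pow_le_pow_left₀ (abs_nonneg z) hz'.le 2
    rw [intervalIntegral.integral_sub (hq.intervalIntegrable _ _),
      intervalIntegral.integral_indicator ⟨abs_nonneg z, hz'.le⟩, integral_two_mul_div_sq_add_four',
      integral_two_mul_div_sq_add_four', h3, sq_abs, ovalWeight_mul_I hz2]
    · norm_num
    · rw [intervalIntegrable_iff]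
      exact (intervalIntegrable_iff.1 (hq.intervalIntegrable _ _)).indicator measurableSet_Iic
  have hindi : ∀ z, IntervalIntegrable (ind z) volume 0 √3 := by
    intro z
    refine (hq.intervalIntegrable _ _).sub ?_
    rw [intervalIntegrable_iff]
    exact (intervalIntegrable_iff.1 (hq.intervalIntegrable _ _)).indicator measurableSet_Iic
  have hsumi : IntervalIntegrable (fun t => ∑ z ∈ Z', ind z t) volume 0 √3 := by
    have := IntervalIntegrable.sum Z' (f := ind) (μ := volume) (a := 0) (b := √3) fun z _ => hindi z
    have e : (∑ z ∈ Z', ind z) = fun t => ∑ z ∈ Z', ind z t := by ext t; simp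
    rwa [e] at this
  have hlow : ∫ t in (0 : ℝ)..√3, -(2 * π) * ((∑ z ∈ Z', ind z t) + 2 * t / (t ^ 2 + 4))
      = -(2 * π) * (∑ z ∈ Z', ovalWeight (z * I) + Real.log (7 / 4)) := by
    rw [intervalIntegral.integral_const_mul, intervalIntegral.integral_add hsumi
      (hq.intervalIntegrable _ _), intervalIntegral.integral_finsetSum fun z _ => hindi z,
      integral_two_mul_div_sq_add_four', h3, Finset.sum_congr rfl hind]
    norm_num
  have hZle : ∑ z ∈ Z', ovalWeight (z * I) ≤ ∑ t ∈ Z, ovalWeight (t * I) :=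
    Finset.sum_le_sum_of_subset_of_nonneg (Finset.filter_subset _ _)
      fun t _ _ => ovalWeight_nonneg _
  refine le_trans ?_ (hlow.symm.le.trans ?_)
  · nlinarith
  refine intervalIntegral.integral_mono_on_of_le_Ioo hs
    ((hsumi.add (hq.intervalIntegrable _ _)).const_mul _) (hineg.add hi2) fun t ht => ?_
  have hcount := card_unimodular_level (a := -t) (b := t) (by linarith [ht.1])
    (hθ.mono (Set.Icc_subset_Icc (by linarith [ht.2]) ht.2.le)) hc
    (Z'.filter fun z => |z| < t) fun z hz hz1 => by
      have hzt : |z| < t := abs_lt.2 hz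
      have hz3 : |z| < √3 := hzt.trans ht.2
      exact Finset.mem_filter.2 ⟨Finset.mem_filter.2 ⟨hZ z (abs_lt.1 hz3) hz1, hz3⟩, hzt⟩
  have hsum : ∑ z ∈ Z', ind z t = (Z'.filter fun z => |z| < t).card * (2 * t / (t ^ 2 + 4)) := by
    rw [Finset.card_filter, Nat.cast_sum, Finset.sum_mul]
    refine Finset.sum_congr rfl fun z _ => ?_
    by_cases h : |z| < t
    · simp [ind, h]
    · simp [ind, h, not_lt.1 h]
  rw [hsum]
  have hk : 0 ≤ 2 * t / (t ^ 2 + 4) := by have := ht.1; positivity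
  have := mul_le_mul_of_nonneg_right hcount hk
  linarith

end LineCount

/-! ### Factorisation of a meromorphic function and the phases of its factors. -/

section OvalCount

open Complex Real MeasureTheory Metric

/-- The order of a meromorphic function as an integer (`0` when it is infinite). -/
noncomputable def ordZ (f : ℂ → ℂ) (s : ℂ) : ℤ := (meromorphicOrderAt f s).untop₀

lemma coe_ordZ {f : ℂ → ℂ} {s : ℂ} (h : meromorphicOrderAt f s ≠ ⊤) :
    (ordZ f s : WithTop ℤ) = meromorphicOrderAt f s := WithTop.coe_untop₀_of_ne_top h

lemma finite_ordZ_ne_zero {f : ℂ → ℂ} (hf : Meromorphic f) {K : Set ℂ} (hK : IsCompact K) :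
    {s ∈ K | ordZ f s ≠ 0}.Finite := by
  refine ((MeromorphicOn.divisor f K).finiteSupport hK).subset ?_
  rintro s ⟨hs, h⟩
  rw [Function.mem_support, MeromorphicOn.divisor_apply hf.meromorphicOn hs]
  exact h

lemma exists_log_on_ball {g : ℂ → ℂ} {c : ℂ} {r : ℝ} (hr : 0 < r)
    (hg : DifferentiableOn ℂ g (ball c r)) (h0 : ∀ s ∈ ball c r, g s ≠ 0) :
    ∃ l : ℂ → ℂ, DifferentiableOn ℂ l (ball c r) ∧ ∀ s ∈ ball c r, g s = Complex.exp (l s) := by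
  have hd : DifferentiableOn ℂ (fun s => deriv g s / g s) (ball c r) :=
    (hg.deriv isOpen_ball).div hg h0
  have hc : c ∈ ball c r := mem_ball_self hr
  obtain ⟨l, hl⟩ := hd.isExactOn_ball.with_val_at c (Complex.log (g c))
  refine ⟨l, fun s hs => (hl.2 s hs).differentiableAt.differentiableWithinAt, fun s hs => ?_⟩
  have hconst : Set.EqOn (deriv fun s => g s * Complex.exp (-l s)) 0 (ball c r) := by
    intro s hs
    have h1 := ((hg.differentiableAt (isOpen_ball.mem_nhds hs)).hasDerivAt).mul
      ((hl.2 s hs).neg.cexp)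
    refine h1.deriv.trans ?_
    have := h0 s hs
    simp only [Pi.zero_apply, Pi.neg_apply]
    field_simp; ring
  have hdiff : DifferentiableOn ℂ (fun s => g s * Complex.exp (-l s)) (ball c r) := fun s hs =>
    ((hg.differentiableAt (isOpen_ball.mem_nhds hs)).mul
      ((hl.2 s hs).differentiableAt.neg.cexp)).differentiableWithinAt
  have := isOpen_ball.is_const_of_deriv_eq_zero (convex_ball c r).isPreconnected hdiff hconst hs hc
  simp only [hl.1, Complex.exp_neg, Complex.exp_log (h0 c hc)] at this
  rw [mul_inv_cancel₀ (h0 c hc)] at this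
  have he := Complex.exp_ne_zero (l s)
  field_simp at this
  exact this

/-- Extracting zeros and poles gives an identity off a discrete set only. The hypothesis `hnf` makes
q analytic, hence continuous, at every point outside S, which turns it into a pointwise identity.
The zero-free factor has a logarithm on the ball. -/
lemma exists_factorization {q : ℂ → ℂ} (hq : Meromorphic q)
    (htop : ∀ s, meromorphicOrderAt q s ≠ ⊤) (hnf : ∀ s, 0 ≤ ordZ q s → AnalyticAt ℂ q s)
    (c : ℂ) {r : ℝ} (hr : 0 < r) :
    ∃ (S : Finset ℂ) (l : ℂ → ℂ), (∀ s, s ∈ S ↔ s ∈ closedBall c r ∧ ordZ q s ≠ 0) ∧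
      DifferentiableOn ℂ l (ball c r) ∧
      ∀ s ∈ ball c r, s ∉ S → q s = (∏ u ∈ S, (s - u) ^ ordZ q u) * Complex.exp (l s) := by
  set U := closedBall c r
  have hfin := (MeromorphicOn.divisor q U).finiteSupport (isCompact_closedBall c r)
  obtain ⟨g, hg, hg0, heq⟩ := MeromorphicOn.extract_zeros_poles (f := q) (U := U)
    hq.meromorphicOn (fun u => htop u) hfin
  obtain ⟨l, hl, hgl⟩ := exists_log_on_ball (g := g) (c := c) hr
    (fun s hs => (hg s (ball_subset_closedBall hs)).differentiableAt.differentiableWithinAt)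
    (fun s hs => hg0 ⟨s, ball_subset_closedBall hs⟩)
  have hS : ∀ s, s ∈ hfin.toFinset ↔ s ∈ U ∧ ordZ q s ≠ 0 := by
    intro s
    rw [Set.Finite.mem_toFinset, Function.mem_support]
    constructor
    · intro h
      have hs : s ∈ U := (MeromorphicOn.divisor q U).supportWithinDomain h
      rw [MeromorphicOn.divisor_apply hq.meromorphicOn hs] at h
      exact ⟨hs, h⟩
    · rintro ⟨hs, h⟩
      rw [MeromorphicOn.divisor_apply hq.meromorphicOn hs]
      exact h
  refine ⟨hfin.toFinset, l, hS, hl, fun s hs hsS => ?_⟩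
  have hprod : (∏ᶠ u, (· - u) ^ (MeromorphicOn.divisor q U) u : ℂ → ℂ)
      = fun s => ∏ u ∈ hfin.toFinset, (s - u) ^ ordZ q u := by
    rw [finprod_eq_prod_of_mulSupport_subset (s := hfin.toFinset)]
    · ext s
      rw [Finset.prod_apply]
      refine Finset.prod_congr rfl fun u hu => ?_
      rw [MeromorphicOn.divisor_apply hq.meromorphicOn ((hS u).1 hu).1]
      rfl
    · intro u hu
      rw [Set.Finite.coe_toFinset, Function.mem_support]
      intro h
      apply hu
      simp only [h, zpow_zero]
  have hU : U ∈ 𝓝 s := mem_of_superset (isOpen_ball.mem_nhds hs) ball_subset_closedBall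
  have hsU : s ∈ U := ball_subset_closedBall hs
  rw [hprod] at heq
  have hane : ∀ u ∈ hfin.toFinset, s - u ≠ 0 := fun u hu h => hsS (by rwa [sub_eq_zero.1 h])
  have hPan : AnalyticAt ℂ (fun s => ∏ u ∈ hfin.toFinset, (s - u) ^ ordZ q u) s := by
    refine Finset.analyticAt_fun_prod _ fun u hu => ?_
    exact (analyticAt_id.sub analyticAt_const).zpow (hane u hu)
  have hgan := hg s hsU
  have hord : ordZ q s = 0 := by
    by_contra h
    exact hsS ((hS s).2 ⟨hsU, h⟩)
  have hqan := hnf s hord.ge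
  have hev := (hq s).eventuallyEq_nhdsNE_of_eventuallyEq_codiscreteWithin
    ((hPan.smul hgan).meromorphicAt) hsU
    (by
      rw [AccPt, inf_eq_left.2 (le_principal_iff.2 (mem_nhdsWithin_of_mem_nhds hU))]
      infer_instance) heq
  have h3 := (hqan.continuousAt.eventuallyEq_nhds_iff_eventuallyEq_nhdsNE
    (hPan.smul hgan).continuousAt).1 hev
  have h4 := h3.eq_of_nhds
  rw [h4]
  simp only [Pi.smul_apply', smul_eq_mul]
  rw [← hgl s hs]

/-- The phase on the imaginary axis of the factor `s - u`. -/
noncomputable def linePhase (u : ℂ) (t : ℝ) : ℝ :=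
  if 0 < u.re then -Complex.arg (t * I + (starRingEnd ℂ) u)
  else if u.re < 0 then Complex.arg (t * I - u) else 0

/-- The sign that goes with `linePhase`. -/
noncomputable def lineSign (u : ℂ) : ℂ := if u.re = 0 then -1 else 1

lemma continuous_linePhase (u : ℂ) : Continuous (linePhase u) := by
  unfold linePhase
  split_ifs with h1 h2
  · refine Continuous.neg (continuous_iff_continuousAt.2 fun t => ?_)
    refine ContinuousAt.comp (Complex.continuousAt_arg ?_) (by fun_prop)
    rw [Complex.mem_slitPlane_iff]; left; simpa using h1
  · refine continuous_iff_continuousAt.2 fun t => ?_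
    refine ContinuousAt.comp (Complex.continuousAt_arg ?_) (by fun_prop)
    rw [Complex.mem_slitPlane_iff]; left; simpa using h2
  · exact continuous_const

lemma ovalLog_eq {u : ℂ} (h2 : u ≠ 2) :
    ovalLog u = 2 * π * ((if 0 < u.re then ovalWeight u else if u.re = 0 then ovalWeight u / 2 else 0)
      + Real.log ‖2 - u‖) + ∫ t in (-√3)..√3, linePhase u t * (2 * t / (t ^ 2 + 4)) := by
  unfold linePhase
  rcases lt_trichotomy u.re 0 with h | h | h
  · simp only [h, h.not_gt, h.ne, if_true, if_false]
    rw [ovalLog_of_re_neg h]; ring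
  · simp only [h, lt_irrefl, if_true, if_false]
    rw [ovalLog_of_re_eq_zero h]; simp
  · simp only [h, if_true]
    rw [ovalLog_of_re_pos h h2]
    simp only [neg_mul, intervalIntegral.integral_neg]; ring

lemma sq_eq_norm_sq_mul_exp_arg (z : ℂ) :
    z ^ 2 = (‖z‖ : ℂ) ^ 2 * Complex.exp (((2 * Complex.arg z : ℝ) : ℂ) * I) := by
  conv_lhs => rw [← Complex.norm_mul_exp_arg_mul_I z]
  rw [mul_pow, ← Complex.exp_nat_mul]
  congr 2; push_cast; ring

/-- Squaring removes the ambiguity of sign. For Re u > 0 the factor is -conj(it + conj u), whose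
argument is continuous up to π; for Re u = 0 it is a real multiple of i, with constant squared phase
-1 even across its zero. -/
lemma line_sub_sq (u : ℂ) (t : ℝ) : (t * I - u) ^ 2
    = (‖t * I - u‖ : ℂ) ^ 2 * (lineSign u * Complex.exp (((2 * linePhase u t : ℝ) : ℂ) * I)) := by
  unfold linePhase lineSign
  rcases lt_trichotomy u.re 0 with h | h | h
  · simp only [h, h.not_gt, h.ne, if_true, if_false, one_mul]
    exact sq_eq_norm_sq_mul_exp_arg _
  · simp only [h, lt_irrefl, if_true, if_false]
    have hu : u = u.im * I := by apply Complex.ext <;> simp [h]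
    have e : (t : ℂ) * I - u = ((t - u.im : ℝ) : ℂ) * I := by rw [hu]; push_cast; simp; ring
    rw [e, norm_mul, norm_I, mul_one, Complex.norm_real, ← ofReal_pow, Real.norm_eq_abs, sq_abs,
      mul_pow, I_sq]
    simp
  · simp only [h, h.ne', if_true, if_false, one_mul]
    have e : (t : ℂ) * I - u = -(starRingEnd ℂ) (t * I + (starRingEnd ℂ) u) := by
      simp; ring
    have h1 := congrArg (starRingEnd ℂ) (sq_eq_norm_sq_mul_exp_arg (t * I + (starRingEnd ℂ) u))
    rw [e, neg_sq, norm_neg, Complex.norm_conj, ← map_pow, h1, map_mul, map_pow, conj_ofReal,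
      ← Complex.exp_conj, map_mul, conj_ofReal, conj_I]
    congr 2; push_cast; ring

lemma lineSign_sq (u : ℂ) : ‖lineSign u‖ = 1 := by
  unfold lineSign; split_ifs <;> simp

end OvalCount

/-! ### Jensen's formula on the half oval and the weighted zero count. -/

section WeightedCount

open Complex Real MeasureTheory Metric

lemma zpow_sq_comm (z : ℂ) (n : ℤ) : (z ^ n) ^ 2 = (z ^ 2) ^ n := by
  rw [← zpow_natCast, ← zpow_natCast, zpow_comm]

lemma prod_line_sq (S : Finset ℂ) (D : ℂ → ℤ) (w : ℂ) (t : ℝ) :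
    ((∏ u ∈ S, (t * I - u) ^ D u) * Complex.exp w) ^ 2
      = (‖(∏ u ∈ S, (t * I - u) ^ D u) * Complex.exp w‖ : ℂ) ^ 2 *
        ((∏ u ∈ S, lineSign u ^ D u) *
          Complex.exp (((2 * (w.im + ∑ u ∈ S, D u * linePhase u t) : ℝ) : ℂ) * I)) := by
  have h1 : ∀ u ∈ S, ((t * I - u) ^ D u) ^ 2 = (‖(t * I - u) ^ D u‖ : ℂ) ^ 2 *
      (lineSign u ^ D u * Complex.exp (((2 * (D u * linePhase u t) : ℝ) : ℂ) * I)) := by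
    intro u _
    rw [zpow_sq_comm, line_sub_sq, mul_zpow, mul_zpow, norm_zpow, ofReal_zpow, zpow_sq_comm,
      ← Complex.exp_int_mul]
    congr 3; push_cast; ring
  have h2 : Complex.exp w ^ 2 = (‖Complex.exp w‖ : ℂ) ^ 2 * Complex.exp (((2 * w.im : ℝ) : ℂ) * I) := by
    rw [Complex.norm_exp, ofReal_exp, ← Complex.exp_nat_mul, ← Complex.exp_nat_mul, ← Complex.exp_add]
    congr 1
    conv_lhs => rw [← Complex.re_add_im w]
    push_cast; ring
  have h3 : Complex.exp (((2 * (w.im + ∑ u ∈ S, D u * linePhase u t) : ℝ) : ℂ) * I)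
      = (∏ u ∈ S, Complex.exp (((2 * (D u * linePhase u t) : ℝ) : ℂ) * I))
        * Complex.exp (((2 * w.im : ℝ) : ℂ) * I) := by
    rw [← Complex.exp_sum, ← Complex.exp_add]
    congr 1
    rw [← Finset.sum_mul, ← add_mul, mul_add, Finset.mul_sum]
    push_cast; ring
  rw [mul_pow, ← Finset.prod_pow, Finset.prod_congr rfl h1, h2, norm_mul, norm_prod, h3,
    Finset.prod_mul_distrib, Finset.prod_mul_distrib, Finset.prod_pow]
  push_cast; ring

/-- Geometrically, 1 + exp(iα) has argument α/2 modulo π. This identifies the phase of q² with q - 1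
on the axis. -/
lemma sq_eq_of_norm_sub_one {z : ℂ} (h : ‖z - 1‖ = 1) : z ^ 2 = (‖z‖ : ℂ) ^ 2 * (z - 1) := by
  have h1 : (z - 1) * (starRingEnd ℂ) (z - 1) = 1 := by
    rw [Complex.mul_conj, Complex.normSq_eq_norm_sq, h]; simp
  have h2 : (‖z‖ : ℂ) ^ 2 = z * (starRingEnd ℂ) z := by
    rw [Complex.mul_conj, Complex.normSq_eq_norm_sq]; push_cast; rfl
  rw [map_sub, map_one] at h1
  rw [h2]
  linear_combination -z * h1

lemma ovalWeight_eq_zero_of_notMem {u : ℂ} (hu : 0 ≤ u.re) (h : u ∉ halfDisc) :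
    ovalWeight u = 0 := by
  have h1 : 11 < ‖u‖ ^ 2 := by
    by_contra! h2; exact h ⟨hu, h2⟩
  have h2 : 7 < ‖u ^ 2 - 4‖ := by
    have := norm_sub_norm_le (u ^ 2) 4
    rw [norm_pow] at this
    norm_num at this
    linarith
  rw [ovalWeight, Real.posLog_eq_zero_iff, abs_of_nonneg (by positivity), div_le_one (by linarith)]
  exact h2.le

lemma halfDisc_subset_ball_three : halfDisc ⊆ ball (3 : ℂ) 5 := by
  rintro s ⟨h1, h2⟩
  rw [mem_ball, dist_eq_norm]
  refine lt_of_pow_lt_pow_left₀ 2 (by positivity) ?_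
  rw [← Complex.normSq_eq_norm_sq, Complex.normSq_apply] at h2 ⊢
  simp
  nlinarith

lemma lineCount_sum (S : Finset ℂ) (D : ℂ → ℤ) :
    ∑ t ∈ (S.filter fun u => u.re = 0 ∧ 0 < D u).image Complex.im, ovalWeight (t * I)
      = ∑ u ∈ S, if u.re = 0 ∧ 0 < D u then ovalWeight u else 0 := by
  rw [Finset.sum_image, ← Finset.sum_filter]
  · refine Finset.sum_congr rfl fun u hu => ?_
    have h := (Finset.mem_filter.1 hu).2.1
    congr 1
    apply Complex.ext <;> simp [h]
  · intro u hu v hv huv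
    rw [Finset.mem_coe, Finset.mem_filter] at hu hv
    exact Complex.ext (by rw [hu.2.1, hv.2.1]) huv

/-- A weighted count of the zeros of `q` in the right half of the Cassini oval, when `q - 1` is
unimodular on the imaginary axis. -/
theorem oval_count {q : ℂ → ℂ} (hq : Meromorphic q)
    (htop : ∀ s, meromorphicOrderAt q s ≠ ⊤) (hnf : ∀ s, 0 ≤ ordZ q s → AnalyticAt ℂ q s)
    (hline : ∀ t : ℝ, AnalyticAt ℂ q (t * I) ∧ ‖q (t * I) - 1‖ = 1)
    (h2 : AnalyticAt ℂ q 2) (h2' : q 2 ≠ 0) (S : Finset ℂ)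
    (hS : ∀ s ∈ halfDisc, ordZ q s ≠ 0 → s ∈ S) :
    2 * π * ∑ u ∈ S, ((if 0 < u.re then 2 * (ordZ q u * ovalWeight u) else 0)
      + (if u.re = 0 then (ordZ q u - if 0 < ordZ q u then 1 else 0) * ovalWeight u else 0))
      ≤ 2 * (∫ φ in (-π)..π, Real.log ‖q (ovalArc φ)‖) - 4 * π * Real.log ‖q 2‖
        + 2 * π * Real.log (7 / 4) := by
  obtain ⟨S₀, l, hS₀, hl, hfac⟩ := exists_factorization hq htop hnf 3 (r := 5) (by norm_num)
  set D := ordZ q with hD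
  have hsub := halfDisc_subset_ball_three
  have hm2 : (-2 : ℂ) ∉ ball (3 : ℂ) 5 := by
    rw [mem_ball, dist_eq_norm]; norm_num
  have h2mem : (2 : ℂ) ∈ ball (3 : ℂ) 5 := hsub ⟨by simp, by norm_num⟩
  have hord0 : ∀ s, AnalyticAt ℂ q s → q s ≠ 0 → D s = 0 := by
    intro s hs h
    have := (hs.meromorphicNFAt.meromorphicOrderAt_eq_zero_iff).2 h
    simp [hD, ordZ, this]
  have h2S : (2 : ℂ) ∉ S₀ := fun h => ((hS₀ 2).1 h).2 (hord0 2 h2 h2')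
  -- reduce to the sum over `S₀`
  have hsum : ∑ u ∈ S, ((if 0 < u.re then 2 * (D u * ovalWeight u) else 0)
      + (if u.re = 0 then (D u - if 0 < D u then 1 else 0) * ovalWeight u else 0))
      = ∑ u ∈ S₀, ((if 0 < u.re then 2 * (D u * ovalWeight u) else 0)
      + (if u.re = 0 then (D u - if 0 < D u then 1 else 0) * ovalWeight u else 0)) := by
    have hz : ∀ u : ℂ, (u ∉ halfDisc ∨ D u = 0) →
        ((if 0 < u.re then 2 * (D u * ovalWeight u) else 0)
      + (if u.re = 0 then (D u - if 0 < D u then 1 else 0) * ovalWeight u else 0)) = 0 := by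
      intro u hu
      rcases hu with hu | hu
      · by_cases h : 0 ≤ u.re
        · simp [ovalWeight_eq_zero_of_notMem h hu]
        · simp [show ¬ 0 < u.re from fun h' => h h'.le, show ¬ u.re = 0 from fun h' => h h'.ge]
      · simp [hu]
    classical
    rw [Finset.sum_subset (Finset.subset_union_left (s₁ := S) (s₂ := S₀)),
      Finset.sum_subset (Finset.subset_union_right (s₁ := S) (s₂ := S₀))]
    · intro u _ hu
      apply hz
      by_contra! h
      exact hu ((hS₀ u).2 ⟨ball_subset_closedBall (hsub h.1), h.2⟩)
    · intro u _ hu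
      apply hz
      by_contra! h
      exact hu (hS u h.1 h.2)
  rw [hsum]
  -- the logarithmic mean of `q`
  have hlog : ∀ s ∈ ball (3 : ℂ) 5, s ∉ S₀ →
      Real.log ‖q s‖ = ∑ u ∈ S₀, D u * Real.log ‖s - u‖ + (l s).re := by
    intro s hs hsS
    have hne : ∀ u ∈ S₀, ‖(s - u) ^ D u‖ ≠ 0 := fun u hu =>
      norm_ne_zero_iff.2 (zpow_ne_zero _ fun h => hsS (by rwa [sub_eq_zero.1 h]))
    rw [hfac s hs hsS, norm_mul, norm_prod, Real.log_mul (Finset.prod_ne_zero_iff.2 hne)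
      (norm_ne_zero_iff.2 (Complex.exp_ne_zero _)), Real.log_prod hne, Complex.norm_exp,
      Real.log_exp]
    congr 1
    refine Finset.sum_congr rfl fun u _ => ?_
    rw [norm_zpow, Real.log_zpow]
  have hre := integral_re_comp_ovalArc hsub hm2 hl
  have hlcont : ContinuousOn l halfDisc := hl.continuousOn.mono hsub
  have hq2 := hlog 2 h2mem h2S
  have hle : -√3 ≤ √3 := by linarith [Real.sqrt_nonneg 3]
  have hk : Continuous fun t : ℝ => 2 * t / (t ^ 2 + 4) :=
    Continuous.div (by fun_prop) (by fun_prop) fun t => by positivity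
  -- Up to the unimodular constant c below, θ is the phase of q². Unlike arg q, which may jump by π
  -- at a zero on the axis, it is continuous.
  set θ : ℝ → ℝ := fun t => 2 * ((l (t * I)).im + ∑ u ∈ S₀, D u * linePhase u t) with hθ
  have hlI : ContinuousOn (fun t : ℝ => (l (t * I)).im) (Set.Icc (-√3) √3) := by
    refine Complex.continuous_im.comp_continuousOn (hlcont.comp (by fun_prop) ?_)
    exact fun t ht => mul_I_mem_halfDisc (sq_le_three_of_mem ht)
  have hθc : ContinuousOn θ (Set.Icc (-√3) √3) := by
    refine continuousOn_const.mul (hlI.add ?_)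
    exact continuousOn_finsetSum _ fun u _ =>
      continuousOn_const.mul (continuous_linePhase u).continuousOn
  -- Jensen's formula, doubled: points on the axis have half the weight of interior points, hence
  -- the factors 1 and 2.
  have hint : 2 * ∫ φ in (-π)..π, Real.log ‖q (ovalArc φ)‖
      = 4 * π * Real.log ‖q 2‖ + 2 * π * ∑ u ∈ S₀, ((if 0 < u.re then 2 * (D u * ovalWeight u) else 0)
        + (if u.re = 0 then D u * ovalWeight u else 0))
        + ∫ t in (-√3)..√3, θ t * (2 * t / (t ^ 2 + 4)) := by
    have h1 : ∫ φ in (-π)..π, Real.log ‖q (ovalArc φ)‖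
        = ∑ u ∈ S₀, D u * ovalLog u + ∫ φ in (-π)..π, (l (ovalArc φ)).re := by
      rw [integral_congr_off_finite (S := S₀) (S₀.finite_toSet)
        (g := fun φ => ∑ u ∈ S₀, D u * Real.log ‖ovalArc φ - u‖ + (l (ovalArc φ)).re)
        (fun φ hφ => hlog _ (hsub (ovalArc_mem_halfDisc φ)) (by simpa using hφ))]
      have hs : IntervalIntegrable (fun φ => ∑ u ∈ S₀, D u * Real.log ‖ovalArc φ - u‖)
          volume (-π) π := by
        have := IntervalIntegrable.sum S₀ (f := fun u φ => D u * Real.log ‖ovalArc φ - u‖)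
          (μ := volume) (a := -π) (b := π)
          fun u _ => (intervalIntegrable_log_norm_ovalArc_sub u).const_mul _
        have e : (∑ u ∈ S₀, fun φ => D u * Real.log ‖ovalArc φ - u‖)
          = fun φ => ∑ u ∈ S₀, D u * Real.log ‖ovalArc φ - u‖ := by ext t; simp
        rwa [e] at this
      rw [intervalIntegral.integral_add hs, intervalIntegral.integral_finsetSum]
      · congr 1
        exact Finset.sum_congr rfl fun u _ => intervalIntegral.integral_const_mul _ _
      · exact fun u _ => (intervalIntegrable_log_norm_ovalArc_sub u).const_mul _
      · have h := intervalIntegrable_comp_ovalArc hlcont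
        rw [intervalIntegrable_iff] at h ⊢
        exact h.re
    have h3 : ∫ t in (-√3)..√3, θ t * (2 * t / (t ^ 2 + 4))
        = 2 * (∫ t in (-√3)..√3, (l (t * I)).im * (2 * t / (t ^ 2 + 4)))
          + 2 * ∑ u ∈ S₀, (D u : ℝ) * ∫ t in (-√3)..√3, linePhase u t * (2 * t / (t ^ 2 + 4)) := by
      have e : ∀ t : ℝ, θ t * (2 * t / (t ^ 2 + 4)) = 2 * ((l (t * I)).im * (2 * t / (t ^ 2 + 4)))
          + ∑ u ∈ S₀, (2 * D u) * (linePhase u t * (2 * t / (t ^ 2 + 4))) := by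
        intro t
        simp only [hθ]
        rw [mul_add, add_mul, Finset.mul_sum, Finset.sum_mul]
        congr 1
        · ring
        · exact Finset.sum_congr rfl fun u _ => by ring
      simp_rw [e]
      have hi : ∀ u ∈ S₀, IntervalIntegrable
          (fun t => (2 * D u : ℝ) * (linePhase u t * (2 * t / (t ^ 2 + 4)))) volume (-√3) √3 :=
        fun u _ => (continuous_const.mul ((continuous_linePhase u).mul hk)).intervalIntegrable _ _
      rw [intervalIntegral.integral_add, intervalIntegral.integral_const_mul,
        intervalIntegral.integral_finsetSum hi, Finset.mul_sum]
      · congr 1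
        refine Finset.sum_congr rfl fun u _ => ?_
        rw [intervalIntegral.integral_const_mul]; ring
      · refine ContinuousOn.intervalIntegrable ?_
        rw [Set.uIcc_of_le hle]
        exact continuousOn_const.mul (hlI.mul hk.continuousOn)
      · refine Continuous.intervalIntegrable ?_ _ _
        exact continuous_finsetSum _ fun u _ =>
          continuous_const.mul ((continuous_linePhase u).mul hk)
    have h4 : ∑ u ∈ S₀, D u * ovalLog u = ∑ u ∈ S₀, (π * ((if 0 < u.re then 2 * (D u * ovalWeight u) else 0)
        + (if u.re = 0 then D u * ovalWeight u else 0)) + 2 * π * (D u * Real.log ‖2 - u‖)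
        + (D u : ℝ) * ∫ t in (-√3)..√3, linePhase u t * (2 * t / (t ^ 2 + 4))) := by
      refine Finset.sum_congr rfl fun u hu => ?_
      rw [ovalLog_eq (fun h => h2S (h ▸ hu))]
      rcases lt_trichotomy u.re 0 with h | h | h
      · simp only [h.not_gt, h.ne, if_false]; ring
      · simp only [h, lt_irrefl, if_false, if_true]; ring
      · simp only [h, h.ne', if_false, if_true]; ring
    rw [Finset.sum_add_distrib, Finset.sum_add_distrib, ← Finset.mul_sum, ← Finset.mul_sum] at h4
    rw [h1, hre, h3, hq2, h4]; ring
  -- the phase of `q - 1` on the imaginary axis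
  set c : ℂ := ∏ u ∈ S₀, lineSign u ^ D u with hc
  have hc1 : ‖c‖ = 1 := by
    rw [hc, norm_prod]
    exact Finset.prod_eq_one fun u _ => by rw [norm_zpow, lineSign_sq, one_zpow]
  have hIoo : ∀ t ∈ Set.Ioo (-√3) √3, (t : ℂ) * I ∈ ball (3 : ℂ) 5 := fun t ht =>
    hsub (mul_I_mem_halfDisc (sq_le_three_of_mem (Set.Ioo_subset_Icc_self ht)))
  have hphase0 : ∀ t ∈ Set.Ioo (-√3) √3, (t : ℂ) * I ∉ S₀ →
      c * Complex.exp (θ t * I) = q (t * I) - 1 := by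
    intro t ht htS
    have hf := hfac _ (hIoo t ht) htS
    have h1 := prod_line_sq S₀ D (l (t * I)) t
    rw [← hf, sq_eq_of_norm_sub_one (hline t).2] at h1
    have hne : q (t * I) ≠ 0 := by
      rw [hf]
      refine mul_ne_zero (Finset.prod_ne_zero_iff.2 fun u hu => zpow_ne_zero _ fun h => htS ?_)
        (Complex.exp_ne_zero _)
      rwa [sub_eq_zero.1 h]
    have hne' : (‖q (t * I)‖ : ℂ) ^ 2 ≠ 0 := by
      simpa using hne
    exact (mul_left_cancel₀ hne' h1).symm
  -- At a zero the relation between q² and |q|² is empty, so the identity is carried across these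
  -- finitely many points by continuity.
  have hphase : ∀ t ∈ Set.Ioo (-√3) √3, c * Complex.exp (θ t * I) = q (t * I) - 1 := by
    intro t ht
    have hnhds : Set.Ioo (-√3) √3 ∈ 𝓝 t := Ioo_mem_nhds ht.1 ht.2
    have hfin : {x : ℝ | (x : ℂ) * I ∈ S₀}.Finite := by
      refine (S₀.finite_toSet).preimage (f := fun x : ℝ => (x : ℂ) * I) ?_
      intro x _ y _ hxy
      have := congrArg Complex.im hxy
      simpa using this
    have hev : (fun x : ℝ => c * Complex.exp (θ x * I)) =ᶠ[𝓝[≠] t] fun x => q (x * I) - 1 := by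
      have h1 : ({x : ℝ | (x : ℂ) * I ∈ S₀} \ {t})ᶜ ∈ 𝓝 t :=
        (hfin.subset Set.sdiff_subset).isClosed.isOpen_compl.mem_nhds (by simp)
      filter_upwards [mem_nhdsWithin_of_mem_nhds h1, mem_nhdsWithin_of_mem_nhds hnhds,
        self_mem_nhdsWithin] with x hx1 hx2 hx3
      exact hphase0 x hx2 fun h => hx1 ⟨h, hx3⟩
    have hc1 : ContinuousAt (fun x : ℝ => c * Complex.exp (θ x * I)) t := by
      have := hθc.continuousAt (mem_of_superset hnhds Set.Ioo_subset_Icc_self)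
      fun_prop
    have hc2 : ContinuousAt (fun x : ℝ => q (x * I) - 1) t := by
      refine ContinuousAt.sub (ContinuousAt.comp (f := fun x : ℝ => (x : ℂ) * I) ?_ (by fun_prop))
        continuousAt_const
      exact (hline t).1.continuousAt
    exact ((hc1.eventuallyEq_nhds_iff_eventuallyEq_nhdsNE hc2).1 hev).eq_of_nhds
  have hcount := integral_phase_ge hθc hc1
    ((S₀.filter fun u => u.re = 0 ∧ 0 < D u).image Complex.im) (by
      intro t ht h
      rw [hphase t ht] at h
      have hq0 : q (t * I) = 0 := by linear_combination h
      have hnn : 0 ≤ D (t * I) := by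
        have := (hline t).1.meromorphicOrderAt_nonneg
        rw [← coe_ordZ (htop _)] at this
        exact_mod_cast this
      have hne : D (t * I) ≠ 0 := by
        intro h0
        have h3 : meromorphicOrderAt q (t * I) = 0 := by
          rw [← coe_ordZ (htop _)]; exact_mod_cast h0
        exact ((hline t).1.meromorphicNFAt.meromorphicOrderAt_eq_zero_iff).1 h3 hq0
      refine Finset.mem_image.2 ⟨t * I, Finset.mem_filter.2 ⟨(hS₀ _).2 ⟨?_, hne⟩, ?_, ?_⟩, ?_⟩
      · exact ball_subset_closedBall (hIoo t ht)
      · simp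
      · omega
      · simp)
  rw [lineCount_sum] at hcount
  have hsplit : ∑ u ∈ S₀, ((if 0 < u.re then 2 * (D u * ovalWeight u) else 0)
      + (if u.re = 0 then (D u - if 0 < D u then 1 else 0) * ovalWeight u else 0))
      = ∑ u ∈ S₀, ((if 0 < u.re then 2 * (D u * ovalWeight u) else 0)
        + (if u.re = 0 then D u * ovalWeight u else 0))
        - ∑ u ∈ S₀, if u.re = 0 ∧ 0 < D u then ovalWeight u else 0 := by
    rw [← Finset.sum_sub_distrib]
    refine Finset.sum_congr rfl fun u _ => ?_
    by_cases h1 : u.re = 0 <;> by_cases h3 : 0 < D u <;> simp [h1, h3]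
    ring
  rw [hsplit]
  linarith

end WeightedCount

/-! ### A Phragmén–Lindelöf bound in a rectangle, in the presence of poles. -/

section HalfPlaneMax

open Complex Real MeasureTheory Metric

/-- The logarithm of the inverse of the Blaschke factor of the right half plane with zero `r`. -/
noncomputable def blaschkeLog (r s : ℂ) : ℝ := Real.log (‖s + (starRingEnd ℂ) r‖ / ‖s - r‖)

lemma norm_sub_le_norm_add_conj {r s : ℂ} (hr : 0 ≤ r.re) (hs : 0 ≤ s.re) :
    ‖s - r‖ ≤ ‖s + (starRingEnd ℂ) r‖ := by
  refine le_of_sq_le_sq ?_ (norm_nonneg _)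
  rw [← Complex.normSq_eq_norm_sq, ← Complex.normSq_eq_norm_sq, Complex.normSq_apply,
    Complex.normSq_apply]
  simp
  nlinarith [mul_nonneg hr hs]

lemma blaschkeLog_nonneg {r s : ℂ} (hr : 0 ≤ r.re) (hs : 0 ≤ s.re) : 0 ≤ blaschkeLog r s := by
  rcases eq_or_ne (s - r) 0 with h | h
  · simp [blaschkeLog, h]
  · exact Real.log_nonneg ((one_le_div (norm_pos_iff.2 h)).2 (norm_sub_le_norm_add_conj hr hs))

lemma add_conj_ne_zero {r s : ℂ} (hr : 0 < r.re) (hs : 0 ≤ s.re) : s + (starRingEnd ℂ) r ≠ 0 := by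
  intro h
  have := congrArg Complex.re h
  simp at this
  linarith

/-- The function majorising the growth on the horizontal sides of a rectangle of width `w`. -/
lemma cos_majorant_re {w H : ℝ} (hw : 0 < w) (s : ℂ) :
    (Complex.cos ((s - (w / 2 : ℝ)) / w) / (Real.cosh H : ℝ)).re
      = Real.cos ((s.re - w / 2) / w) * Real.cosh (s.im / w) / Real.cosh H := by
  rw [Complex.div_ofReal_re]
  congr 1
  have e : (s - (w / 2 : ℝ)) / w = (((s.re - w / 2) / w : ℝ) : ℂ) + ((s.im / w : ℝ) : ℂ) * I := by
    conv_lhs => rw [← Complex.re_add_im s]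
    have : (w : ℂ) ≠ 0 := by exact_mod_cast hw.ne'
    push_cast; field_simp; ring
  rw [e]
  generalize (s.re - w / 2) / w = x
  generalize s.im / w = y
  rw [Complex.cos_add, Complex.cos_mul_I, Complex.sin_mul_I]
  simp [-Complex.ofReal_cos, -Complex.ofReal_sin, -Complex.ofReal_cosh, -Complex.ofReal_sinh,
    Complex.cos_ofReal_re, Complex.cos_ofReal_im, Complex.sin_ofReal_re, Complex.sin_ofReal_im,
    Complex.cosh_ofReal_re, Complex.cosh_ofReal_im, Complex.sinh_ofReal_im]

lemma half_le_cos {w x : ℝ} (hw : 0 < w) (h0 : 0 ≤ x) (h1 : x ≤ w) :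
    1 / 2 ≤ Real.cos ((x - w / 2) / w) := by
  refine le_trans ?_ Real.one_sub_sq_div_two_le_cos
  have h2 : |(x - w / 2) / w| ≤ 1 / 2 := by
    rw [abs_div, abs_of_pos hw, div_le_iff₀ hw, abs_le]
    constructor <;> linarith
  have h3 := sq_abs ((x - w / 2) / w)
  nlinarith [abs_nonneg ((x - w / 2) / w)]

/-- Blaschke factors of the right half plane cancel the poles of F and have modulus at most one
there. Dividing further by exp W, where Re W ≥ 0 throughout and Re W ≥ M on the horizontal sides,
leaves a function bounded by 1 on the boundary, and the maximum principle applies. -/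
theorem posLog_le_of_rectangle {F : ℂ → ℂ} (hF : Meromorphic F)
    (htop : ∀ s, meromorphicOrderAt F s ≠ ⊤) (hnf : ∀ s, 0 ≤ ordZ F s → AnalyticAt ℂ F s)
    {w H M : ℝ} (hw : 0 < w) (hM : 0 ≤ M)
    (hleft : ∀ s : ℂ, s.re = 0 → AnalyticAt ℂ F s ∧ ‖F s‖ ≤ 1)
    (hright : ∀ s : ℂ, s.re = w → AnalyticAt ℂ F s ∧ ‖F s‖ ≤ 1)
    (hhor : ∀ s : ℂ, 0 ≤ s.re → s.re ≤ w → |s.im| = H → AnalyticAt ℂ F s ∧ ‖F s‖ ≤ Real.exp M)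
    (P : Finset ℂ) (hP : ∀ s, s ∈ P ↔ (0 < s.re ∧ s.re < w ∧ |s.im| < H) ∧ ordZ F s < 0)
    {s : ℂ} (hs0 : 0 ≤ s.re) (hsw : s.re ≤ w) (hsH : |s.im| < H) (hsP : s ∉ P) :
    Real.posLog ‖F s‖ ≤ 2 * M * Real.cosh (s.im / w) / Real.cosh (H / w)
      + ∑ r ∈ P, ((-ordZ F r).toNat : ℝ) * blaschkeLog r s := by
  have hHpos : 0 < H := (abs_nonneg _).trans_lt hsH
  set R : Set ℂ := Set.Ioo 0 w ×ℂ Set.Ioo (-H) H with hR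
  have hRcl : closure R = Set.Icc 0 w ×ℂ Set.Icc (-H) H := by
    rw [hR, Complex.closure_reProdIm, closure_Ioo hw.ne, closure_Ioo (by linarith)]
  have hPR : ∀ r ∈ P, 0 < r.re ∧ r.re < w ∧ |r.im| < H := fun r hr => ((hP r).1 hr).1
  let n : ℂ → ℕ := fun r => (-ordZ F r).toNat
  let B : ℂ → ℂ := fun s => ∏ r ∈ P, ((s - r) / (s + (starRingEnd ℂ) r)) ^ n r
  have hBfac : ∀ (r z : ℂ), r ∈ P → 0 ≤ z.re →
      AnalyticAt ℂ (fun s => ((s - r) / (s + (starRingEnd ℂ) r)) ^ n r) z := fun r z hr hz =>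
    ((analyticAt_id.sub analyticAt_const).div (analyticAt_id.add analyticAt_const)
      (add_conj_ne_zero (hPR r hr).1 hz)).pow _
  have hBan : ∀ z : ℂ, 0 ≤ z.re → AnalyticAt ℂ B z := fun z hz =>
    Finset.analyticAt_fun_prod _ fun r hr => hBfac r z hr hz
  have hBmer : Meromorphic B := by
    intro z
    refine MeromorphicAt.fun_prod fun r _ => ?_
    exact (((MeromorphicAt.id z).sub (MeromorphicAt.const r z)).div
      ((MeromorphicAt.id z).add (MeromorphicAt.const _ z))).pow _
  have hFB : Meromorphic (F * B) := hF.mul hBmer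
  -- The normal form supplies the values at the cancelled poles, so that G is truly analytic there.
  set G : ℂ → ℂ := toMeromorphicNFOn (F * B) Set.univ with hG
  have hGnf : MeromorphicNFOn G Set.univ := meromorphicNFOn_toMeromorphicNFOn _ _
  -- off the poles of `F` nothing changes
  have hoff : ∀ z : ℂ, 0 ≤ z.re → AnalyticAt ℂ F z → AnalyticAt ℂ G z ∧ G z = F z * B z := by
    intro z hz hFz
    have hFBz : AnalyticAt ℂ (F * B) z := hFz.mul (hBan z hz)
    have hGz : AnalyticAt ℂ G z := by
      refine ((hGnf (Set.mem_univ z)).meromorphicOrderAt_nonneg_iff_analyticAt).1 ?_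
      rw [hG, meromorphicOrderAt_toMeromorphicNFOn hFB.meromorphicOn (Set.mem_univ z)]
      exact hFBz.meromorphicOrderAt_nonneg
    refine ⟨hGz, ?_⟩
    have h1 := MeromorphicOn.toMeromorphicNFOn_eq_self_on_nhdsNE
      hFB.meromorphicOn (Set.mem_univ z)
    exact ((hGz.continuousAt.eventuallyEq_nhds_iff_eventuallyEq_nhdsNE
      hFBz.continuousAt).1 h1).eq_of_nhds
  have hFan : ∀ z : ℂ, 0 ≤ z.re → z.re ≤ w → |z.im| ≤ H → z ∉ P → AnalyticAt ℂ F z := by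
    intro z h1 h2 h3 h4
    by_cases ho : 0 ≤ ordZ F z
    · exact hnf z ho
    push Not at ho
    rcases h1.eq_or_lt with h1 | h1
    · exact (hleft z h1.symm).1
    rcases h2.eq_or_lt with h2 | h2
    · exact (hright z h2).1
    rcases h3.eq_or_lt with h3 | h3
    · exact (hhor z h1.le h2.le h3).1
    exact absurd ((hP z).2 ⟨⟨h1, h2, h3⟩, ho⟩) h4
  have hGan : ∀ z ∈ closure R, AnalyticAt ℂ G z := by
    intro z hz
    rw [hRcl, Complex.mem_reProdIm] at hz
    by_cases hzP : z ∈ P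
    · refine ((hGnf (Set.mem_univ z)).meromorphicOrderAt_nonneg_iff_analyticAt).1 ?_
      rw [hG, meromorphicOrderAt_toMeromorphicNFOn hFB.meromorphicOn (Set.mem_univ z),
        meromorphicOrderAt_mul (hF z) (hBmer z)]
      have hBz : meromorphicOrderAt B z ≥ ((n z : ℤ) : WithTop ℤ) := by
        change meromorphicOrderAt (fun a => ∏ i ∈ P, ((a - i) / (a + (starRingEnd ℂ) i)) ^ n i) z ≥ _
        rw [meromorphicOrderAt_fun_prod fun r hr => (hBfac r z hr hz.1.1).meromorphicAt,
          ← Finset.add_sum_erase P _ hzP]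
        have h1 : meromorphicOrderAt (fun s => ((s - z) / (s + (starRingEnd ℂ) z)) ^ n z) z
            = ((n z : ℤ) : WithTop ℤ) := by
          rw [meromorphicOrderAt_eq_int_iff (hBfac z z hzP hz.1.1).meromorphicAt]
          refine ⟨fun s => (s + (starRingEnd ℂ) z)⁻¹ ^ n z, ?_, ?_, ?_⟩
          · exact ((analyticAt_id.add analyticAt_const).inv
              (add_conj_ne_zero (hPR z hzP).1 hz.1.1)).pow _
          · exact pow_ne_zero _ (inv_ne_zero (add_conj_ne_zero (hPR z hzP).1 hz.1.1))
          · refine Eventually.of_forall fun s => ?_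
            simp only [zpow_natCast, smul_eq_mul]
            rw [← mul_pow, div_eq_mul_inv]
        rw [h1]
        exact le_add_of_nonneg_right (Finset.sum_nonneg fun r hr =>
          (hBfac r z (Finset.mem_of_mem_erase hr) hz.1.1).meromorphicOrderAt_nonneg)
      rw [← coe_ordZ (htop z)]
      refine le_trans ?_ (add_le_add_right hBz _)
      have : (0 : ℤ) ≤ ordZ F z + (n z : ℤ) := by simp only [n]; omega
      exact_mod_cast this
    · exact (hoff z hz.1.1 (hFan z hz.1.1 hz.1.2 (abs_le.2 hz.2) hzP)).1
  have hBle : ∀ z : ℂ, 0 ≤ z.re → ‖B z‖ ≤ 1 := by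
    intro z hz
    rw [norm_prod]
    refine Finset.prod_le_one (fun r _ => norm_nonneg _) fun r hr => ?_
    rw [norm_pow, norm_div]
    exact pow_le_one₀ (by positivity)
      (div_le_one_of_le₀ (norm_sub_le_norm_add_conj (hPR r hr).1.le hz) (norm_nonneg _))
  -- On the rectangle the real part of the argument of the cosine lies in [-1/2, 1/2], where the
  -- real cosine is at least 1/2; the factor 2 compensates.
  let W : ℂ → ℂ := fun s => (2 * M : ℝ) * (Complex.cos ((s - (w / 2 : ℝ)) / w) / (Real.cosh (H / w) : ℝ))
  have hWre : ∀ z : ℂ, (W z).re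
      = 2 * M * (Real.cos ((z.re - w / 2) / w) * Real.cosh (z.im / w) / Real.cosh (H / w)) := by
    intro z
    rw [show W z = (2 * M : ℝ) * (Complex.cos ((z - (w / 2 : ℝ)) / w) / (Real.cosh (H / w) : ℝ)) from rfl,
      Complex.re_ofReal_mul, cos_majorant_re hw]
  have hWdiff : Differentiable ℂ W := by
    intro z; fun_prop
  have hcosh : 0 < Real.cosh (H / w) := Real.cosh_pos _
  have hWnn : ∀ z : ℂ, 0 ≤ z.re → z.re ≤ w → 0 ≤ (W z).re := by
    intro z h1 h2
    rw [hWre]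
    have := half_le_cos hw h1 h2
    have := Real.cosh_pos (z.im / w)
    positivity
  have hmax := Complex.norm_le_of_forall_mem_frontier_norm_le (U := R)
    (f := fun z => G z * Complex.exp (-W z)) (C := 1) ?_ ?_ ?_ (z := s) ?_
  · have hF' := hFan s hs0 hsw hsH.le hsP
    rw [(hoff s hs0 hF').2, norm_mul, norm_mul, Complex.norm_exp, Complex.neg_re, Real.exp_neg,
      mul_inv_le_iff₀ (Real.exp_pos _), one_mul] at hmax
    have hsum : 0 ≤ ∑ r ∈ P, (n r : ℝ) * blaschkeLog r s := Finset.sum_nonneg fun r hr =>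
      mul_nonneg (Nat.cast_nonneg _) (blaschkeLog_nonneg (hPR r hr).1.le hs0)
    have hWle : (W s).re ≤ 2 * M * Real.cosh (s.im / w) / Real.cosh (H / w) := by
      rw [hWre, mul_div_assoc (2 * M)]
      refine mul_le_mul_of_nonneg_left (div_le_div_of_nonneg_right ?_ hcosh.le) (by linarith)
      have h1 := Real.cos_le_one ((s.re - w / 2) / w)
      have h2 := Real.cosh_pos (s.im / w)
      nlinarith
    have hBs : Real.log ‖B s‖ = -∑ r ∈ P, (n r : ℝ) * blaschkeLog r s := by
      have hne : ∀ r ∈ P, ‖((s - r) / (s + (starRingEnd ℂ) r)) ^ n r‖ ≠ 0 := fun r hr =>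
        norm_ne_zero_iff.2 (pow_ne_zero _ (div_ne_zero
          (sub_ne_zero.2 fun h => hsP (h ▸ hr)) (add_conj_ne_zero (hPR r hr).1 hs0)))
      change Real.log ‖∏ r ∈ P, ((s - r) / (s + (starRingEnd ℂ) r)) ^ n r‖ = _
      rw [norm_prod, Real.log_prod hne, ← Finset.sum_neg_distrib]
      refine Finset.sum_congr rfl fun r _ => ?_
      rw [norm_pow, Real.log_pow, norm_div, blaschkeLog, ← inv_div, Real.log_inv]
      ring
    have hB0 : B s ≠ 0 := Finset.prod_ne_zero_iff.2 fun r hr => pow_ne_zero _ (div_ne_zero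
          (sub_ne_zero.2 fun h => hsP (h ▸ hr)) (add_conj_ne_zero (hPR r hr).1 hs0))
    change max 0 (Real.log ‖F s‖) ≤ _ + ∑ r ∈ P, (n r : ℝ) * blaschkeLog r s
    refine max_le ?_ ?_
    · have := hWnn s hs0 hsw
      linarith
    rcases eq_or_ne (F s) 0 with h0 | h0
    · rw [h0, norm_zero, Real.log_zero]
      have := hWnn s hs0 hsw
      linarith
    · have h1 := Real.log_le_log (mul_pos (norm_pos_iff.2 h0) (norm_pos_iff.2 hB0)) hmax
      rw [Real.log_exp, Real.log_mul (norm_ne_zero_iff.2 h0) (norm_ne_zero_iff.2 hB0), hBs] at h1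
      linarith
  · exact (isBounded_Ioo 0 w).reProdIm (isBounded_Ioo (-H) H)
  · refine DifferentiableOn.diffContOnCl fun z hz => ?_
    exact ((hGan z hz).differentiableAt.mul
      (hWdiff z).neg.cexp).differentiableWithinAt
  · intro z hz
    have hzcl : z ∈ closure R := frontier_subset_closure hz
    have hz' := hzcl
    rw [hRcl, Complex.mem_reProdIm] at hz'
    have hzP : z ∉ P := by
      intro h
      have h1 := hPR z h
      rw [frontier, (isOpen_Ioo.reProdIm isOpen_Ioo).interior_eq] at hz
      exact hz.2 (Complex.mem_reProdIm.2 ⟨⟨h1.1, h1.2.1⟩, abs_lt.1 h1.2.2⟩)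
    have hF' := hFan z hz'.1.1 hz'.1.2 (abs_le.2 hz'.2) hzP
    rw [(hoff z hz'.1.1 hF').2, norm_mul, norm_mul, Complex.norm_exp, Complex.neg_re, Real.exp_neg,
      mul_inv_le_iff₀ (Real.exp_pos _), one_mul]
    have hFz : ‖F z‖ ≤ Real.exp (W z).re := by
      have hnn := Real.one_le_exp (hWnn z hz'.1.1 hz'.1.2)
      rcases hz'.1.1.eq_or_lt with h1 | h1
      · exact (hleft z h1.symm).2.trans hnn
      rcases hz'.1.2.eq_or_lt with h2 | h2
      · exact (hright z h2).2.trans hnn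
      have h3 : |z.im| = H := by
        refine le_antisymm (abs_le.2 hz'.2) ?_
        by_contra! h3
        rw [frontier, (isOpen_Ioo.reProdIm isOpen_Ioo).interior_eq] at hz
        exact hz.2 (Complex.mem_reProdIm.2 ⟨⟨h1, h2⟩, abs_lt.1 h3⟩)
      refine (hhor z h1.le h2.le h3).2.trans (Real.exp_le_exp.2 ?_)
      rw [hWre, ← Real.cosh_abs (z.im / w), abs_div, h3, abs_of_pos hw, mul_div_assoc,
        div_self hcosh.ne', mul_one]
      have := half_le_cos hw h1.le h2.le
      nlinarith
    calc ‖F z‖ * ‖B z‖ ≤ ‖F z‖ * 1 :=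
          mul_le_mul_of_nonneg_left (hBle z hz'.1.1) (norm_nonneg _)
      _ ≤ _ := by rw [mul_one]; exact hFz
  · rw [hRcl, Complex.mem_reProdIm]
    exact ⟨⟨hs0, hsw⟩, abs_le.1 hsH.le⟩

/-- The majorant is of linear size at height `y`, however large `H` is. -/
lemma mul_cosh_div_cosh_le {w y H : ℝ} (hw : 0 < w) (hy : 0 ≤ y) (hyH : y ≤ H) :
    H * Real.cosh (y / w) / Real.cosh (H / w) ≤ 2 * (y + w) := by
  have h1 : Real.cosh (y / w) ≤ Real.exp (y / w) := by
    rw [Real.cosh_eq]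
    have : Real.exp (-(y / w)) ≤ Real.exp (y / w) := Real.exp_le_exp.2 (by
      have : 0 ≤ y / w := by positivity
      linarith)
    linarith
  have h2 : Real.exp (H / w) / 2 ≤ Real.cosh (H / w) := by
    rw [Real.cosh_eq]
    have := Real.exp_pos (-(H / w))
    linarith
  have h3 : (H - y) / w + 1 ≤ Real.exp ((H - y) / w) := Real.add_one_le_exp _
  have h4 : Real.exp (H / w) = Real.exp (y / w) * Real.exp ((H - y) / w) := by
    rw [← Real.exp_add]; congr 1; ring
  have h5 : H ≤ (y + w) * Real.exp ((H - y) / w) := by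
    have h6 : (y + w) * ((H - y) / w + 1) ≤ (y + w) * Real.exp ((H - y) / w) :=
      mul_le_mul_of_nonneg_left h3 (by linarith)
    refine le_trans ?_ h6
    have : (y + w) * ((H - y) / w + 1) = H + w + y * ((H - y) / w) := by field_simp; ring
    rw [this]
    have : 0 ≤ y * ((H - y) / w) := mul_nonneg hy (div_nonneg (by linarith) hw.le)
    linarith
  rw [div_le_iff₀ (Real.cosh_pos _)]
  have hH : 0 ≤ H := hy.trans hyH
  calc H * Real.cosh (y / w) ≤ ((y + w) * Real.exp ((H - y) / w)) * Real.exp (y / w) :=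
        mul_le_mul h5 h1 (Real.cosh_pos _).le (by positivity)
    _ = 2 * (y + w) * (Real.exp (H / w) / 2) := by rw [h4]; ring
    _ ≤ 2 * (y + w) * Real.cosh (H / w) := mul_le_mul_of_nonneg_left h2 (by linarith)

end HalfPlaneMax

/-! ### The logarithmic mean over the part of the arc near the axis. -/

section ArcError

open Complex Real MeasureTheory Metric

/-- The part of the arc close to the imaginary axis. -/
def arcNear (η : ℝ) : Set ℝ := {φ | φ ∈ Set.Ioc (-π) π ∧ |Real.sin φ| ≤ η}

lemma measurableSet_arcNear (η : ℝ) : MeasurableSet (arcNear η) :=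
  measurableSet_Ioc.inter (measurableSet_le (f := fun φ : ℝ => |Real.sin φ|)
    (Real.continuous_sin.abs.measurable) measurable_const)

/-- By Jordan's inequality sin x ≥ 2x/π, each of φ = -π, 0, π is within πη/2 of the points near it.
The neighbourhood of 0, which corresponds to the real vertex, is included only because the sine does
not separate it. -/
lemma volume_arcNear_le {η : ℝ} (hη : 0 ≤ η) : volume (arcNear η) ≤ ENNReal.ofReal (2 * π * η) := by
  have hpi := Real.pi_pos
  have hsub : arcNear η ⊆ (Set.Icc (-π) (-π + π / 2 * η) ∪ Set.Icc (-(π / 2 * η)) (π / 2 * η))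
      ∪ Set.Icc (π - π / 2 * η) π := by
    rintro φ ⟨⟨h1, h2⟩, h3⟩
    have key : ∀ x, 0 ≤ x → x ≤ π / 2 → Real.sin x ≤ η → x ≤ π / 2 * η := by
      intro x hx0 hx1 hx2
      have := (Real.mul_le_sin hx0 hx1).trans hx2
      rw [div_mul_eq_mul_div, div_le_iff₀ hpi] at this
      linarith
    rw [abs_le] at h3
    rcases le_or_gt φ (-(π / 2)) with h | h
    · left; left
      have := key (φ + π) (by linarith) (by linarith) (by rw [Real.sin_add_pi]; linarith)
      exact ⟨h1.le, by linarith⟩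
    rcases le_or_gt φ 0 with h' | h'
    · left; right
      have := key (-φ) (by linarith) (by linarith) (by rw [Real.sin_neg]; linarith)
      exact ⟨by linarith, by nlinarith⟩
    rcases le_or_gt φ (π / 2) with h'' | h''
    · left; right
      have := key φ (by linarith) (by linarith) h3.2
      exact ⟨by nlinarith, by linarith⟩
    · right
      have := key (π - φ) (by linarith) (by linarith) (by rw [Real.sin_pi_sub]; exact h3.2)
      exact ⟨by linarith, h2⟩
  refine (measure_mono hsub).trans ((measure_union_le _ _).trans
    ((add_le_add (measure_union_le _ _) le_rfl).trans ?_))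
  rw [Real.volume_Icc, Real.volume_Icc, Real.volume_Icc, ← ENNReal.ofReal_add, ← ENNReal.ofReal_add]
  · refine ENNReal.ofReal_le_ofReal ?_
    linarith
  all_goals (ring_nf; positivity)

/-- Absolute continuity of one integral, that of |log sin| over [-2π, 2π], serves all ψ at once
because that interval contains every translate of A. -/
lemma exists_setIntegral_log_sin_le {ε : ℝ} (hε : 0 < ε) : ∃ κ : ℝ, 0 < κ ∧
    ∀ A : Set ℝ, MeasurableSet A → A ⊆ Set.Ioc (-π) π → volume A < ENNReal.ofReal κ →
      ∀ ψ ∈ Set.Icc (-π) π, IntegrableOn (fun φ => |Real.log (Real.sin (φ - ψ))|) A ∧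
        ∫ φ in A, |Real.log (Real.sin (φ - ψ))| ≤ ε := by
  have hpi := Real.pi_pos
  set J := Set.Icc (-(2 * π)) (2 * π) with hJ
  let f : ℝ → ENNReal := fun x => ‖Real.log (Real.sin x)‖ₑ
  have hfm : Measurable f := by fun_prop
  have hint : ∫⁻ x, f x ∂(volume.restrict J) ≠ ⊤ := by
    have h1 : IntegrableOn (Real.log ∘ Real.sin) J := by
      rw [← intervalIntegrable_iff_integrableOn_Icc_of_le (by linarith)]
      exact intervalIntegrable_log_sin
    exact h1.2.ne
  obtain ⟨κ, hκ, hκ'⟩ := exists_pos_setLIntegral_lt_of_measure_lt hint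
    (ENNReal.ofReal_pos.2 hε).ne'
  have hmin : 0 < min κ 1 := lt_min hκ one_pos
  have hminT : min κ 1 ≠ ⊤ := ne_top_of_le_ne_top ENNReal.one_ne_top (min_le_right _ _)
  refine ⟨(min κ 1).toReal, ENNReal.toReal_pos hmin.ne' hminT, fun A hA hAsub hvol ψ hψ => ?_⟩
  rw [ENNReal.ofReal_toReal hminT] at hvol
  set s : Set ℝ := (fun x => x + ψ) ⁻¹' A with hs
  have hsm : MeasurableSet s := (measurable_add_const ψ) hA
  have hsJ : s ⊆ J := by
    intro x hx
    have := hAsub hx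
    exact ⟨by linarith [this.1, hψ.2], by linarith [this.2, hψ.1]⟩
  have hvs : volume s = volume A := measure_preimage_add_right volume ψ A
  have hlint : ∫⁻ φ in A, f (φ - ψ) < ENNReal.ofReal ε := by
    have h1 : ∫⁻ φ in A, f (φ - ψ) = ∫⁻ x in s, f x := by
      rw [← lintegral_indicator hA, ← lintegral_indicator hsm,
        ← lintegral_sub_right_eq_self (s.indicator f) ψ]
      congr 1; ext φ
      by_cases h : φ ∈ A
      · rw [Set.indicator_of_mem h, Set.indicator_of_mem (by simpa [hs] using h)]
      · rw [Set.indicator_of_notMem h, Set.indicator_of_notMem (by simpa [hs] using h)]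
    rw [h1]
    have h2 := hκ' s (by
      rw [Measure.restrict_apply hsm, Set.inter_eq_left.2 hsJ, hvs]
      exact hvol.trans_le (min_le_left _ _))
    rwa [Measure.restrict_restrict hsm, Set.inter_eq_left.2 hsJ] at h2
  have hmeas : Measurable fun φ => Real.log (Real.sin (φ - ψ)) := by fun_prop
  have hI : IntegrableOn (fun φ => Real.log (Real.sin (φ - ψ))) A :=
    ⟨hmeas.aestronglyMeasurable, hlint.trans ENNReal.ofReal_lt_top⟩
  refine ⟨hI.norm, ?_⟩
  have h3 := integral_norm_eq_lintegral_enorm (μ := volume.restrict A) hmeas.aestronglyMeasurable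
  simp only [Real.norm_eq_abs] at h3
  rw [h3]
  exact ENNReal.toReal_le_of_le_ofReal hε.le hlint.le

lemma integrableOn_blaschkeLog {r : ℂ} (hr : 0 < r.re) :
    IntegrableOn (fun φ => blaschkeLog r (ovalArc φ)) (Set.Ioc (-π) π) := by
  have h1 := (intervalIntegrable_log_norm_ovalArc_sub (-(starRingEnd ℂ) r)).sub
    (intervalIntegrable_log_norm_ovalArc_sub r)
  rw [intervalIntegrable_iff_integrableOn_Ioc_of_le (by linarith [Real.pi_pos])] at h1
  refine h1.congr ?_
  rw [EventuallyEq, ae_restrict_iff' measurableSet_Ioc]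
  filter_upwards [ae_ovalArc_notMem (Set.finite_singleton r)] with φ hφ hφ'
  have hne : ovalArc φ - r ≠ 0 := sub_ne_zero.2 (hφ hφ')
  simp only [sub_neg_eq_add]
  rw [blaschkeLog, Real.log_div (norm_ne_zero_iff.2 (add_conj_ne_zero hr (ovalArc_re_nonneg φ)))
    (norm_ne_zero_iff.2 hne)]

/-- After a rotation making c real and nonnegative, the distance is at least the modulus of the
imaginary part. -/
lemma norm_circle_sub_ge (c : ℂ) (φ : ℝ) :
    7 * |Real.sin (φ - Complex.arg c)| ≤ ‖7 * Complex.exp (φ * I) - c‖ := by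
  have h1 : 7 * Complex.exp (φ * I) - c
      = (7 * Complex.exp (((φ - Complex.arg c : ℝ) : ℂ) * I) - ‖c‖) * Complex.exp (Complex.arg c * I) := by
    rw [sub_mul, Complex.norm_mul_exp_arg_mul_I, mul_assoc, ← Complex.exp_add]
    congr 3; push_cast; ring
  rw [h1, norm_mul, Complex.norm_exp_ofReal_mul_I, mul_one]
  refine le_trans ?_ (Complex.abs_im_le_norm _)
  rw [Complex.sub_im, Complex.ofReal_im, sub_zero, Complex.mul_im, Complex.exp_ofReal_mul_I_im]
  simp [abs_mul]

/-- The product (s - r)(s + r) is the difference of a point of the circle and r² - 4, at least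
7|sin|. Since |s + r| ≤ 14, this gives |s - r| ≥ |sin|/2, while |s + conj r| ≤ 14. -/
lemma blaschkeLog_le_of_norm_le {r : ℂ} (hr : 0 < r.re) (h10 : ‖r‖ ≤ 10) {φ : ℝ}
    (hsin : Real.sin (φ - Complex.arg (r ^ 2 - 4)) ≠ 0) :
    blaschkeLog r (ovalArc φ) ≤ Real.log 28 + |Real.log (Real.sin (φ - Complex.arg (r ^ 2 - 4)))| := by
  set σ := Real.sin (φ - Complex.arg (r ^ 2 - 4)) with hσ
  have h1 := norm_circle_sub_ge (r ^ 2 - 4) φ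
  have h2 : 7 * Complex.exp (φ * I) - (r ^ 2 - 4) = (ovalArc φ - r) * (ovalArc φ + r) := by
    have := ovalArc_sq φ
    linear_combination -this
  rw [h2, norm_mul, ← hσ] at h1
  have hσ0 : 0 < |σ| := abs_pos.2 hsin
  have hs := norm_ovalArc_le φ
  have h3 : ‖ovalArc φ + r‖ ≤ 14 := (norm_add_le _ _).trans (by linarith)
  have h4 : ‖ovalArc φ + (starRingEnd ℂ) r‖ ≤ 14 := (norm_add_le _ _).trans (by
    rw [Complex.norm_conj]; linarith)
  have h5 : 0 < ‖ovalArc φ - r‖ * ‖ovalArc φ + r‖ := lt_of_lt_of_le (by positivity) h1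
  have h6 : 0 < ‖ovalArc φ - r‖ := by
    refine lt_of_le_of_ne (norm_nonneg _) fun h => ?_
    rw [← h, zero_mul] at h5; exact h5.false
  have h7 : 0 < ‖ovalArc φ + (starRingEnd ℂ) r‖ :=
    norm_pos_iff.2 (add_conj_ne_zero hr (ovalArc_re_nonneg φ))
  have h8 : |σ| / 2 ≤ ‖ovalArc φ - r‖ := by nlinarith
  have h9 : ‖ovalArc φ + (starRingEnd ℂ) r‖ / ‖ovalArc φ - r‖ ≤ 28 / |σ| := by
    rw [div_le_div_iff₀ h6 hσ0]; nlinarith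
  refine (Real.log_le_log (by positivity) h9).trans ?_
  rw [Real.log_div (by norm_num) hσ0.ne', Real.log_abs]
  have := neg_abs_le (Real.log σ)
  linarith

lemma blaschkeLog_le_of_lt_norm {r : ℂ} (hr : 0 < r.re) (hr1 : r.re ≤ 1) (h10 : 10 < ‖r‖) (φ : ℝ) :
    blaschkeLog r (ovalArc φ) ≤ 1 := by
  have hs := norm_ovalArc_le φ
  have h1 : 6 ≤ ‖ovalArc φ - r‖ := by
    have := norm_sub_norm_le r (ovalArc φ)
    rw [norm_sub_rev] at this
    linarith
  have h2 : ‖ovalArc φ + (starRingEnd ℂ) r‖ ≤ ‖ovalArc φ - r‖ + 2 := by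
    have e : ovalArc φ + (starRingEnd ℂ) r = (ovalArc φ - r) + ((2 * r.re : ℝ) : ℂ) := by
      have := Complex.add_conj r
      rw [← this]; ring
    rw [e]
    refine (norm_add_le _ _).trans ?_
    rw [Complex.norm_real, Real.norm_of_nonneg (by linarith)]
    linarith
  have h7 : 0 < ‖ovalArc φ + (starRingEnd ℂ) r‖ :=
    norm_pos_iff.2 (add_conj_ne_zero hr (ovalArc_re_nonneg φ))
  have h3 : 0 < ‖ovalArc φ + (starRingEnd ℂ) r‖ / ‖ovalArc φ - r‖ := div_pos h7 (by linarith)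
  have h4 := Real.log_le_sub_one_of_pos h3
  have h5 : ‖ovalArc φ + (starRingEnd ℂ) r‖ / ‖ovalArc φ - r‖ ≤ 2 := by
    rw [div_le_iff₀ (by linarith)]; linarith
  rw [blaschkeLog]
  linarith

/-- The point is uniformity in r: the singularity of a near pole is dominated by a translate of log
|sin|, and a far pole contributes a bounded function. -/
lemma exists_setIntegral_blaschkeLog_le {δ : ℝ} (hδ : 0 < δ) : ∃ η₀ : ℝ, 0 < η₀ ∧
    ∀ η, 0 ≤ η → η ≤ η₀ → ∀ r : ℂ, 0 < r.re → r.re ≤ 1 →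
      ∫ φ in arcNear η, blaschkeLog r (ovalArc φ) ≤ δ := by
  have hpi := Real.pi_pos
  obtain ⟨κ, hκ, hκ'⟩ := exists_setIntegral_log_sin_le (ε := δ / 2) (by linarith)
  have hlog : 1 ≤ Real.log 28 := by
    rw [Real.le_log_iff_exp_le (by norm_num)]
    linarith [Real.exp_one_lt_d9]
  refine ⟨min (κ / (4 * π)) (δ / (4 * π * Real.log 28)), by positivity, ?_⟩
  intro η hη0 hη r hr hr1
  have hη1 : 2 * π * η < κ := by
    have h1 := hη.trans (min_le_left _ _)
    rw [le_div_iff₀ (by positivity)] at h1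
    nlinarith
  have hη2 : 2 * π * η * Real.log 28 ≤ δ / 2 := by
    have h1 := hη.trans (min_le_right _ _)
    rw [le_div_iff₀ (by positivity)] at h1
    linarith
  have hsub : arcNear η ⊆ Set.Ioc (-π) π := fun φ h => h.1
  have hA := measurableSet_arcNear η
  have hvol := volume_arcNear_le hη0
  have hvolR : volume.real (arcNear η) ≤ 2 * π * η := ENNReal.toReal_le_of_le_ofReal (by positivity) hvol
  have hfin : volume (arcNear η) ≠ ⊤ := ne_top_of_le_ne_top ENNReal.ofReal_ne_top hvol
  have hbi := (integrableOn_blaschkeLog hr).mono_set hsub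
  have hci : ∀ c : ℝ, IntegrableOn (fun _ : ℝ => c) (arcNear η) := fun c => integrableOn_const hfin
  rcases le_or_gt ‖r‖ 10 with h10 | h10
  · have hψ : Complex.arg (r ^ 2 - 4) ∈ Set.Icc (-π) π :=
      ⟨(Complex.neg_pi_lt_arg _).le, Complex.arg_le_pi _⟩
    obtain ⟨hi, hle⟩ := hκ' _ hA hsub (hvol.trans_lt (ENNReal.ofReal_lt_ofReal_iff hκ |>.2 hη1)) _ hψ
    have hae : ∀ᵐ φ : ℝ, Real.sin (φ - Complex.arg (r ^ 2 - 4)) ≠ 0 := by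
      have hc : {φ : ℝ | Real.sin (φ - Complex.arg (r ^ 2 - 4)) = 0}.Countable := by
        refine (Set.countable_range fun n : ℤ => (n * π + Complex.arg (r ^ 2 - 4) : ℝ)).mono ?_
        intro φ hφ
        obtain ⟨n, hn⟩ := Real.sin_eq_zero_iff.1 hφ
        exact ⟨n, by simp only; linarith⟩
      have := hc.measure_zero volume
      rw [← compl_mem_ae_iff] at this
      exact this
    have h1 : ∫ φ in arcNear η, blaschkeLog r (ovalArc φ)
        ≤ ∫ φ in arcNear η, (Real.log 28 + |Real.log (Real.sin (φ - Complex.arg (r ^ 2 - 4)))|) := by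
      refine setIntegral_mono_ae hbi ((hci _).add hi) ?_
      filter_upwards [hae] with φ hφ
      exact blaschkeLog_le_of_norm_le hr h10 hφ
    rw [integral_add (hci _) hi, setIntegral_const, smul_eq_mul] at h1
    nlinarith
  · have h1 : ∫ φ in arcNear η, blaschkeLog r (ovalArc φ) ≤ ∫ φ in arcNear η, (1 : ℝ) :=
      setIntegral_mono_ae hbi (hci _) (ae_of_all _ fun φ => blaschkeLog_le_of_lt_norm hr hr1 h10 φ)
    rw [setIntegral_const, smul_eq_mul] at h1
    nlinarith [mul_nonneg hpi.le hη0]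

/-- The imaginary part of s² = 4 + 7 exp(iφ) reads 7 sin φ = 2 Re s Im s, and |Im s| ≤ 4, so |sin φ|
≤ 8x/7. -/
lemma mem_arcNear_of_re_le {x φ : ℝ} (hφ : φ ∈ Set.Ioc (-π) π) (hx : (ovalArc φ).re ≤ x) :
    φ ∈ arcNear (2 * x) := by
  refine ⟨hφ, ?_⟩
  have h1 := congrArg Complex.im (ovalArc_sq φ)
  rw [ovalArc_base_im, sq, Complex.mul_im] at h1
  have h2 := (Complex.abs_im_le_norm (ovalArc φ)).trans (norm_ovalArc_le φ)
  have h3 := ovalArc_re_nonneg φ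
  have h4 : 7 * |Real.sin φ| = 2 * ((ovalArc φ).re * |(ovalArc φ).im|) := by
    have h5 := congrArg abs h1
    rw [abs_mul, abs_of_pos (by norm_num : (0 : ℝ) < 7)] at h5
    rw [← h5, show (ovalArc φ).re * (ovalArc φ).im + (ovalArc φ).im * (ovalArc φ).re
      = 2 * ((ovalArc φ).re * (ovalArc φ).im) by ring, abs_mul, abs_mul, abs_of_nonneg h3]
    norm_num
  nlinarith [mul_le_mul hx h2 (abs_nonneg _) (h3.trans hx)]

/-- The mean of `log |q|` over the arc is small if `|q| ≤ 2` away from the imaginary axis. -/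
theorem integral_log_norm_arc_le {δ : ℝ} (hδ : 0 < δ) : ∃ x₀ : ℝ, 0 < x₀ ∧ ∀ x, 0 ≤ x → x ≤ x₀ →
    ∀ (q : ℂ → ℂ) (P : Finset ℂ) (n : ℂ → ℕ) (C : ℝ), 0 ≤ C → (∀ r ∈ P, 0 < r.re ∧ r.re ≤ 1) →
      (∀ φ, x < (ovalArc φ).re → ‖q (ovalArc φ)‖ ≤ 2) →
      (∀ φ, (ovalArc φ).re ≤ x → ovalArc φ ∉ P → Real.log ‖q (ovalArc φ)‖
        ≤ Real.log 2 + C + ∑ r ∈ P, n r * blaschkeLog r (ovalArc φ)) →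
      ∫ φ in (-π)..π, Real.log ‖q (ovalArc φ)‖
        ≤ 2 * π * Real.log 2 + 4 * π * C * x + δ * ∑ r ∈ P, (n r : ℝ) := by
  have hpi := Real.pi_pos
  obtain ⟨η₀, hη₀, hη⟩ := exists_setIntegral_blaschkeLog_le hδ
  refine ⟨η₀ / 2, by linarith, fun x hx0 hx q P n C hC hP hfar hnear => ?_⟩
  have hηx := hη (2 * x) (by linarith) (by linarith)
  set A := arcNear (2 * x) with hAdef
  have hsub : A ⊆ Set.Ioc (-π) π := fun φ h => h.1
  have hA : MeasurableSet A := measurableSet_arcNear _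
  have hvol := volume_arcNear_le (η := 2 * x) (by linarith)
  have hvolR : volume.real A ≤ 2 * π * (2 * x) := ENNReal.toReal_le_of_le_ofReal (by positivity) hvol
  have hfin : volume A ≠ ⊤ := ne_top_of_le_ne_top ENNReal.ofReal_ne_top hvol
  have hlog2 : 0 ≤ Real.log 2 := Real.log_nonneg (by norm_num)
  let g : ℝ → ℝ := fun φ => C + ∑ r ∈ P, n r * blaschkeLog r (ovalArc φ)
  have hbn : ∀ r ∈ P, ∀ φ, 0 ≤ (n r : ℝ) * blaschkeLog r (ovalArc φ) := fun r hr φ =>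
    mul_nonneg (Nat.cast_nonneg _) (blaschkeLog_nonneg (hP r hr).1.le (ovalArc_re_nonneg φ))
  have hg0 : ∀ φ, 0 ≤ g φ := fun φ => add_nonneg hC (Finset.sum_nonneg fun r hr => hbn r hr φ)
  have hbi : ∀ r ∈ P, IntegrableOn (fun φ => (n r : ℝ) * blaschkeLog r (ovalArc φ)) A :=
    fun r hr => ((integrableOn_blaschkeLog (hP r hr).1).mono_set hsub).const_mul _
  have hgi : IntegrableOn g A := (integrableOn_const hfin).add (integrable_finsetSum _ hbi)
  have hgint : ∫ φ in A, g φ ≤ 4 * π * C * x + δ * ∑ r ∈ P, (n r : ℝ) := by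
    have hci : IntegrableOn (fun _ : ℝ => C) A := integrableOn_const hfin
    rw [integral_add hci (integrable_finsetSum _ hbi), setIntegral_const,
      smul_eq_mul, integral_finsetSum _ hbi]
    refine add_le_add (by nlinarith) ?_
    rw [Finset.mul_sum]
    refine Finset.sum_le_sum fun r hr => ?_
    rw [integral_const_mul]
    have := hηx r (hP r hr).1 (hP r hr).2
    have hn : (0 : ℝ) ≤ n r := Nat.cast_nonneg _
    nlinarith
  have hnn : 0 ≤ ∫ φ in A, g φ := setIntegral_nonneg hA fun φ _ => hg0 φ
  -- Nothing is assumed about the regularity of q; if the integrand is not integrable, its integral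
  -- is 0 by convention and the right side is nonnegative.
  by_cases hi : IntervalIntegrable (fun φ => Real.log ‖q (ovalArc φ)‖) volume (-π) π
  · rw [intervalIntegral.integral_of_le (by linarith)]
    rw [intervalIntegrable_iff_integrableOn_Ioc_of_le (by linarith)] at hi
    have hci : IntegrableOn (fun _ : ℝ => Real.log 2) (Set.Ioc (-π) π) :=
      integrableOn_const (by simp)
    have hgi' : IntegrableOn (A.indicator g) (Set.Ioc (-π) π) :=
      (hgi.integrable_indicator hA).integrableOn
    have hle : ∫ φ in Set.Ioc (-π) π, Real.log ‖q (ovalArc φ)‖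
        ≤ ∫ φ in Set.Ioc (-π) π, (Real.log 2 + A.indicator g φ) := by
      refine setIntegral_mono_on_ae hi (hci.add hgi') measurableSet_Ioc ?_
      filter_upwards [ae_ovalArc_notMem P.finite_toSet] with φ h1 h2
      rcases le_or_gt (ovalArc φ).re x with h | h
      · rw [Set.indicator_of_mem (mem_arcNear_of_re_le h2 h)]
        have := hnear φ h (by simpa using h1 h2)
        simp only [g]; linarith
      · have h3 : 0 ≤ A.indicator g φ := Set.indicator_nonneg (fun φ _ => hg0 φ) φ
        have h4 : Real.log ‖q (ovalArc φ)‖ ≤ Real.log 2 := by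
          rcases eq_or_ne (q (ovalArc φ)) 0 with h0 | h0
          · rw [h0, norm_zero, Real.log_zero]; exact hlog2
          · exact Real.log_le_log (norm_pos_iff.2 h0) (hfar φ h)
        linarith
    refine hle.trans ?_
    rw [integral_add hci hgi', setIntegral_const, smul_eq_mul, setIntegral_indicator hA,
      Set.inter_eq_right.2 hsub]
    have : volume.real (Set.Ioc (-π) π) = 2 * π := by
      rw [Real.volume_real_Ioc_of_le (by linarith)]; ring
    rw [this]
    linarith
  · rw [intervalIntegral.integral_undef hi]
    have : 0 ≤ 2 * π * Real.log 2 := by positivity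
    linarith

end ArcError

/-! ### Conjugation, reflection, and the factorisation f = h p. -/

section Symmetry

open Complex Real MeasureTheory Metric
open scoped ComplexConjugate

lemma tendsto_conj_nhdsNE (s : ℂ) : Tendsto conj (𝓝[≠] (conj s)) (𝓝[≠] s) := by
  have h := (Complex.continuous_conj.continuousWithinAt (s := {conj s}ᶜ) (x := conj s)).tendsto_nhdsWithin
    (t := {s}ᶜ) (fun z (hz : z ≠ conj s) (h : conj z = s) => hz (by rw [← h, Complex.conj_conj]))
  rwa [Complex.conj_conj] at h

lemma tendsto_reflect_nhdsNE (b s : ℂ) : Tendsto (fun z => b - z) (𝓝[≠] s) (𝓝[≠] (b - s)) :=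
  ((continuous_const.sub continuous_id).continuousWithinAt (s := {s}ᶜ) (x := s)).tendsto_nhdsWithin
    (t := {b - s}ᶜ) (fun _ (hz : _ ≠ s) h => hz (sub_right_injective h))

lemma meromorphicOrderAt_comp_reflect (f : ℂ → ℂ) (b s : ℂ) :
    meromorphicOrderAt (fun z => f (b - z)) s = meromorphicOrderAt f (b - s) := by
  have h : HasDerivAt (fun z : ℂ => b - z) (-1) s := by
    simpa using (hasDerivAt_id s).const_sub b
  exact meromorphicOrderAt_comp_of_deriv_ne_zero (f := f) (g := fun z => b - z)
    (analyticAt_const.sub analyticAt_id) (by rw [h.deriv]; norm_num)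

lemma meromorphicOrderAt_comp_affine (f : ℂ → ℂ) (b : ℂ) {c : ℂ} (hc : c ≠ 0) (s : ℂ) :
    meromorphicOrderAt (fun z => f (b + c * z)) s = meromorphicOrderAt f (b + c * s) := by
  have h : HasDerivAt (fun z : ℂ => b + c * z) c s := by
    simpa using ((hasDerivAt_id s).const_mul c).const_add b
  exact meromorphicOrderAt_comp_of_deriv_ne_zero (f := f) (g := fun z => b + c * z)
    (analyticAt_const.add (analyticAt_const.mul analyticAt_id)) (by rw [h.deriv]; exact hc)

lemma Meromorphic.comp_affine {f : ℂ → ℂ} (hf : Meromorphic f) (b c : ℂ) :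
    Meromorphic fun z => f (b + c * z) := fun s =>
  (hf (b + c * s)).comp_analyticAt (g := fun z => b + c * z)
    (analyticAt_const.add (analyticAt_const.mul analyticAt_id))

lemma Meromorphic.comp_reflect {f : ℂ → ℂ} (hf : Meromorphic f) (b : ℂ) :
    Meromorphic fun z => f (b - z) := fun s =>
  (hf (b - s)).comp_analyticAt (g := fun z => b - z) (analyticAt_const.sub analyticAt_id)

lemma AnalyticAt.conj_comp_conj {g : ℂ → ℂ} {s : ℂ} (hg : AnalyticAt ℂ g s) :
    AnalyticAt ℂ (fun z => conj (g (conj z))) (conj s) := by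
  rw [Complex.analyticAt_iff_eventually_differentiableAt] at hg ⊢
  have h1 : Tendsto conj (𝓝 (conj s)) (𝓝 s) := by
    have := Complex.continuous_conj.tendsto (conj s)
    rwa [Complex.conj_conj] at this
  filter_upwards [h1.eventually hg] with z hz
  have := hz.star_star
  rw [show star (conj z) = z from Complex.conj_conj z] at this
  exact this

lemma MeromorphicAt.conj_comp_conj {f : ℂ → ℂ} {s : ℂ} (hf : MeromorphicAt f s) :
    MeromorphicAt (fun z => conj (f (conj z))) (conj s) := by
  obtain ⟨n, hn⟩ := hf
  refine ⟨n, ?_⟩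
  refine hn.conj_comp_conj.congr (Eventually.of_forall fun z => ?_)
  simp

lemma meromorphicOrderAt_conj_comp_conj {f : ℂ → ℂ} {s : ℂ} (hf : MeromorphicAt f s) :
    meromorphicOrderAt (fun z => conj (f (conj z))) (conj s) = meromorphicOrderAt f s := by
  rcases eq_or_ne (meromorphicOrderAt f s) ⊤ with h | h
  · rw [h, meromorphicOrderAt_eq_top_iff]
    filter_upwards [(tendsto_conj_nhdsNE s).eventually (meromorphicOrderAt_eq_top_iff.1 h)] with z hz
    rw [hz, map_zero]
  · obtain ⟨n, hn⟩ := WithTop.ne_top_iff_exists.1 h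
    rw [← hn]
    obtain ⟨g, hg, hg0, he⟩ := (meromorphicOrderAt_eq_int_iff hf).1 hn.symm
    refine (meromorphicOrderAt_eq_int_iff hf.conj_comp_conj).2
      ⟨fun z => conj (g (conj z)), hg.conj_comp_conj, ?_, ?_⟩
    · simpa using hg0
    · filter_upwards [(tendsto_conj_nhdsNE s).eventually he] with z hz
      rw [hz]; simp

/-- The identity theorem: a meromorphic function that is real on the real axis commutes with
complex conjugation. -/
lemma eventually_conj_comm {h : ℂ → ℂ} (h_mero : Meromorphic h)
    (h_real : ∀ x : ℝ, AnalyticAt ℂ h (x : ℂ) → (h (x : ℂ)).im = 0) (s : ℂ) :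
    ∀ᶠ z in 𝓝[≠] s, h (conj z) = conj (h z) := by
  have hk : Meromorphic fun z => conj (h (conj z)) := fun z => by
    have := (h_mero (conj z)).conj_comp_conj
    rwa [Complex.conj_conj] at this
  set d : ℂ → ℂ := (fun z => conj (h (conj z))) - h with hd
  have hdm : Meromorphic d := hk.sub h_mero
  have h0 : meromorphicOrderAt d 0 = ⊤ := by
    rw [meromorphicOrderAt_eq_top_iff]
    -- Near 0 the function h is analytic except perhaps at 0, so the difference vanishes at nonzero
    -- real points arbitrarily close to 0.
    refine (hdm 0).eventually_eq_zero_or_eventually_ne_zero.resolve_right fun hne => ?_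
    have h1 : ∀ᶠ z in 𝓝[≠] (0 : ℂ), AnalyticAt ℂ h z := (h_mero 0).eventually_analyticAt
    have h2 : Tendsto (fun x : ℝ => (x : ℂ)) (𝓝[≠] 0) (𝓝[≠] 0) := by
      have := (Complex.continuous_ofReal.continuousWithinAt (s := {0}ᶜ) (x := 0)).tendsto_nhdsWithin
        (t := {0}ᶜ) (fun x (hx : x ≠ 0) h => hx (by simpa using h))
      simpa using this
    obtain ⟨x, hx1, hx2⟩ := (h2.eventually (h1.and hne)).exists
    refine hx2 ?_
    have := h_real x hx1
    simp only [hd, Pi.sub_apply, Complex.conj_ofReal]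
    rw [Complex.conj_eq_iff_im.2 this, sub_self]
  have hall : meromorphicOrderAt d s = ⊤ := by
    by_contra hne
    exact (hdm.exists_meromorphicOrderAt_ne_top_iff_forall.1 ⟨s, hne⟩) 0 h0
  filter_upwards [meromorphicOrderAt_eq_top_iff.1 hall] with z hz
  simp only [hd, Pi.sub_apply, sub_eq_zero] at hz
  rw [← hz, Complex.conj_conj]

lemma ordZ_conj {h : ℂ → ℂ} (h_mero : Meromorphic h)
    (hc : ∀ s, ∀ᶠ z in 𝓝[≠] s, h (conj z) = conj (h z)) (s : ℂ) : ordZ h (conj s) = ordZ h s := by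
  unfold ordZ
  rw [← meromorphicOrderAt_conj_comp_conj (h_mero s), meromorphicOrderAt_congr]
  filter_upwards [hc (conj s)] with z hz
  rw [hz, Complex.conj_conj]

/-- The quotient `h(2a - s) / h(s)` in normal form. -/
noncomputable def quotientNF (h : ℂ → ℂ) (a : ℝ) : ℂ → ℂ :=
  toMeromorphicNFOn (reflectedQuotient h a) Set.univ

/-- The factor `f / h = 1 + ε F`. -/
noncomputable def sumFactor (h : ℂ → ℂ) (a : ℝ) (ε : ℂ) : ℂ → ℂ := fun s => 1 + ε * quotientNF h a s

variable {h : ℂ → ℂ} {a : ℝ} {ε : ℂ}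

lemma meromorphic_reflectedQuotient (h_mero : Meromorphic h) : Meromorphic (reflectedQuotient h a) :=
  (h_mero.comp_reflect _).div h_mero

lemma quotientNF_eq (h_mero : Meromorphic h) (s : ℂ) :
    reflectedQuotient h a =ᶠ[𝓝[≠] s] quotientNF h a :=
  (MeromorphicOn.toMeromorphicNFOn_eq_self_on_nhdsNE
    (meromorphic_reflectedQuotient h_mero).meromorphicOn (Set.mem_univ s)).symm

lemma meromorphicOrderAt_quotientNF (h_mero : Meromorphic h) (s : ℂ) :
    meromorphicOrderAt (quotientNF h a) s
      = meromorphicOrderAt h (2 * (a : ℂ) - s) - meromorphicOrderAt h s := by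
  rw [← meromorphicOrderAt_congr (quotientNF_eq h_mero s), ← meromorphicOrderAt_comp_reflect,
    ← meromorphicOrderAt_div ((h_mero.comp_reflect _) s) (h_mero s)]
  rfl

lemma meromorphic_quotientNF (h_mero : Meromorphic h) : Meromorphic (quotientNF h a) := fun s =>
  (meromorphic_reflectedQuotient h_mero s).congr (quotientNF_eq h_mero s)

lemma meromorphicOrderAt_quotientNF_ne_top (h_mero : Meromorphic h)
    (htop : ∀ s, meromorphicOrderAt h s ≠ ⊤) (s : ℂ) :
    meromorphicOrderAt (quotientNF h a) s ≠ ⊤ := by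
  rw [meromorphicOrderAt_quotientNF h_mero, ← coe_ordZ (htop _), ← coe_ordZ (htop s)]
  exact WithTop.coe_ne_top

lemma ordZ_quotientNF (h_mero : Meromorphic h) (htop : ∀ s, meromorphicOrderAt h s ≠ ⊤) (s : ℂ) :
    ordZ (quotientNF h a) s = ordZ h (2 * (a : ℂ) - s) - ordZ h s := by
  have h1 := meromorphicOrderAt_quotientNF (a := a) h_mero s
  rw [← coe_ordZ (htop _), ← coe_ordZ (htop s),
    ← coe_ordZ (meromorphicOrderAt_quotientNF_ne_top h_mero htop s)] at h1
  exact_mod_cast h1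

lemma analyticAt_quotientNF (h_mero : Meromorphic h) (htop : ∀ s, meromorphicOrderAt h s ≠ ⊤)
    {s : ℂ} (hs : 0 ≤ ordZ (quotientNF h a) s) : AnalyticAt ℂ (quotientNF h a) s := by
  refine ((meromorphicNFOn_toMeromorphicNFOn _ _
    (Set.mem_univ s)).meromorphicOrderAt_nonneg_iff_analyticAt).1 ?_
  change 0 ≤ meromorphicOrderAt (quotientNF h a) s
  rw [← coe_ordZ (meromorphicOrderAt_quotientNF_ne_top h_mero htop s)]
  exact_mod_cast hs

lemma quotientNF_of_meroNormLt (h_mero : Meromorphic h) {s : ℂ} {c : ℝ}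
    (hs : MeroNormLt (reflectedQuotient h a) s c) :
    AnalyticAt ℂ (quotientNF h a) s ∧ ‖quotientNF h a s‖ < c := by
  obtain ⟨w, hw, hwc⟩ := hs
  have hw' : Tendsto (quotientNF h a) (𝓝[≠] s) (𝓝 w) := hw.congr' (quotientNF_eq h_mero s)
  have han : AnalyticAt ℂ (quotientNF h a) s := by
    refine ((meromorphicNFOn_toMeromorphicNFOn _ _
      (Set.mem_univ s)).meromorphicOrderAt_nonneg_iff_analyticAt).1 ?_
    exact (tendsto_nhds_iff_meromorphicOrderAt_nonneg (meromorphic_quotientNF h_mero s)).1 ⟨w, hw'⟩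
  refine ⟨han, ?_⟩
  rwa [tendsto_nhds_unique (han.continuousAt.tendsto.mono_left nhdsWithin_le_nhds) hw']

lemma two_mul_sub_of_re_eq {s : ℂ} (hs : s.re = a) : 2 * (a : ℂ) - s = conj s := by
  apply Complex.ext <;> simp [hs]
  ring

/-- The quotient has modulus one on the axis of symmetry. -/
lemma norm_quotientNF_of_re_eq (h_mero : Meromorphic h) (htop : ∀ s, meromorphicOrderAt h s ≠ ⊤)
    (hc : ∀ s, ∀ᶠ z in 𝓝[≠] s, h (conj z) = conj (h z)) {s : ℂ} (hs : s.re = a) :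
    AnalyticAt ℂ (quotientNF h a) s ∧ ‖quotientNF h a s‖ = 1 := by
  have han : AnalyticAt ℂ (quotientNF h a) s := by
    refine analyticAt_quotientNF h_mero htop ?_
    rw [ordZ_quotientNF h_mero htop, two_mul_sub_of_re_eq hs, ordZ_conj h_mero hc, sub_self]
  refine ⟨han, ?_⟩
  -- The modulus is computed at nearby points of the line, where h neither vanishes nor differs from
  -- its reflection, and passes to the limit; s itself may be a zero or pole of h.
  have hline : Tendsto (fun t : ℝ => s + (t : ℂ) * I) (𝓝[≠] 0) (𝓝[≠] s) := by
    have hcont : Continuous fun t : ℝ => s + (t : ℂ) * I := by fun_prop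
    have := (hcont.continuousWithinAt (s := {0}ᶜ) (x := 0)).tendsto_nhdsWithin
      (t := {s}ᶜ) (fun x (hx : x ≠ 0) h => hx (by simpa using h))
    simpa using this
  have h1 : Tendsto (fun t : ℝ => ‖quotientNF h a (s + (t : ℂ) * I)‖) (𝓝[≠] 0)
      (𝓝 ‖quotientNF h a s‖) :=
    ((han.continuousAt.tendsto.mono_left nhdsWithin_le_nhds).comp hline).norm
  have h2 : ∀ᶠ t : ℝ in 𝓝[≠] 0, ‖quotientNF h a (s + (t : ℂ) * I)‖ = 1 := by
    have hne := (meromorphicOrderAt_ne_top_iff_eventually_ne_zero (h_mero s)).1 (htop s)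
    filter_upwards [hline.eventually (hc s), hline.eventually hne,
      hline.eventually (quotientNF_eq (a := a) h_mero s)] with t ht1 ht2 ht3
    rw [← ht3, reflectedQuotient, two_mul_sub_of_re_eq (by simpa using hs), ht1, norm_div,
      Complex.norm_conj, div_self (norm_ne_zero_iff.2 ht2)]
  exact tendsto_nhds_unique h1 (tendsto_const_nhds.congr' (h2.mono fun _ h => h.symm))

lemma meromorphic_sumFactor (h_mero : Meromorphic h) : Meromorphic (sumFactor h a ε) := fun s =>
  (MeromorphicAt.const 1 s).add ((MeromorphicAt.const ε s).mul (meromorphic_quotientNF h_mero s))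

lemma analyticAt_sumFactor {s : ℂ} (hs : AnalyticAt ℂ (quotientNF h a) s) :
    AnalyticAt ℂ (sumFactor h a ε) s :=
  analyticAt_const.add (analyticAt_const.mul hs)

lemma reflectedSum_eq (h_mero : Meromorphic h) (htop : ∀ s, meromorphicOrderAt h s ≠ ⊤) (s : ℂ) :
    reflectedSum h a ε =ᶠ[𝓝[≠] s] h * sumFactor h a ε := by
  have hne := (meromorphicOrderAt_ne_top_iff_eventually_ne_zero (h_mero s)).1 (htop s)
  filter_upwards [hne, quotientNF_eq (a := a) h_mero s] with z h1 h2
  rw [Pi.mul_apply, sumFactor, ← h2, reflectedSum, reflectedQuotient]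
  field_simp

lemma meromorphic_reflectedSum (h_mero : Meromorphic h) : Meromorphic (reflectedSum h a ε) := fun s =>
  (h_mero s).add ((MeromorphicAt.const ε s).mul (h_mero.comp_reflect _ s))

lemma norm_of_sign (hε : ε = 1 ∨ ε = -1) : ‖ε‖ = 1 := by
  rcases hε with rfl | rfl <;> simp

lemma sign_sq (hε : ε = 1 ∨ ε = -1) : ε * ε = 1 := by
  rcases hε with rfl | rfl <;> simp

lemma sumFactor_ne_zero_of_norm_lt (hε : ε = 1 ∨ ε = -1) {s : ℂ} (hs : ‖quotientNF h a s‖ < 1) :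
    sumFactor h a ε s ≠ 0 := by
  intro h0
  have h1 : ε * quotientNF h a s = -1 := by
    rw [sumFactor] at h0; linear_combination h0
  have h2 := congrArg norm h1
  rw [norm_mul, norm_of_sign hε, norm_neg, norm_one, one_mul] at h2
  linarith

lemma meromorphicOrderAt_sumFactor_ne_top (h_mero : Meromorphic h) (hε : ε = 1 ∨ ε = -1)
    {s₀ : ℂ} (hs₀ : MeroNormLt (reflectedQuotient h a) s₀ 1) (s : ℂ) :
    meromorphicOrderAt (sumFactor h a ε) s ≠ ⊤ := by
  refine ((meromorphic_sumFactor h_mero).exists_meromorphicOrderAt_ne_top_iff_forall.1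
    ⟨s₀, ?_⟩) s
  obtain ⟨h1, h2⟩ := quotientNF_of_meroNormLt h_mero hs₀
  have h3 : meromorphicOrderAt (sumFactor h a ε) s₀ = 0 :=
    (analyticAt_sumFactor h1).meromorphicNFAt.meromorphicOrderAt_eq_zero_iff.2 (sumFactor_ne_zero_of_norm_lt hε h2)
  rw [h3]
  exact WithTop.zero_ne_top

lemma meromorphicOrderAt_reflectedSum (h_mero : Meromorphic h)
    (htop : ∀ s, meromorphicOrderAt h s ≠ ⊤) (s : ℂ) :
    meromorphicOrderAt (reflectedSum h a ε) s
      = meromorphicOrderAt h s + meromorphicOrderAt (sumFactor h a ε) s := by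
  rw [meromorphicOrderAt_congr (reflectedSum_eq h_mero htop s),
    meromorphicOrderAt_mul (h_mero s) (meromorphic_sumFactor h_mero s)]

lemma meromorphicOrderAt_reflectedSum_ne_top (h_mero : Meromorphic h)
    (htop : ∀ s, meromorphicOrderAt h s ≠ ⊤)
    (hptop : ∀ s, meromorphicOrderAt (sumFactor h a ε) s ≠ ⊤) (s : ℂ) :
    meromorphicOrderAt (reflectedSum h a ε) s ≠ ⊤ := by
  rw [meromorphicOrderAt_reflectedSum h_mero htop, ← coe_ordZ (htop s), ← coe_ordZ (hptop s)]
  exact WithTop.coe_ne_top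

lemma ordZ_reflectedSum (h_mero : Meromorphic h) (htop : ∀ s, meromorphicOrderAt h s ≠ ⊤)
    (hptop : ∀ s, meromorphicOrderAt (sumFactor h a ε) s ≠ ⊤) (s : ℂ) :
    ordZ (reflectedSum h a ε) s = ordZ h s + ordZ (sumFactor h a ε) s := by
  have h1 := meromorphicOrderAt_reflectedSum (a := a) (ε := ε) h_mero htop s
  rw [← coe_ordZ (htop _), ← coe_ordZ (hptop s),
    ← coe_ordZ (meromorphicOrderAt_reflectedSum_ne_top h_mero htop hptop s)] at h1
  exact_mod_cast h1

/-- Because ε² = 1, f(2a - s) = ε f(s). -/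
lemma ordZ_reflectedSum_reflect (hε : ε = 1 ∨ ε = -1) (s : ℂ) :
    ordZ (reflectedSum h a ε) (2 * (a : ℂ) - s) = ordZ (reflectedSum h a ε) s := by
  unfold ordZ
  rw [← meromorphicOrderAt_comp_reflect]
  have h1 : (fun z => reflectedSum h a ε (2 * (a : ℂ) - z)) = (fun _ => ε) * reflectedSum h a ε := by
    ext z
    simp only [reflectedSum, Pi.mul_apply, sub_sub_cancel]
    linear_combination (-h (2 * (a : ℂ) - z)) * sign_sq hε
  rw [h1, meromorphicOrderAt_mul_of_ne_zero analyticAt_const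
    (norm_ne_zero_iff.1 (by rw [norm_of_sign hε]; norm_num))]

lemma eventually_reflectedSum_conj_comm (hε : ε = 1 ∨ ε = -1)
    (hc : ∀ s, ∀ᶠ z in 𝓝[≠] s, h (conj z) = conj (h z)) (s : ℂ) :
    ∀ᶠ z in 𝓝[≠] s, reflectedSum h a ε (conj z) = conj (reflectedSum h a ε z) := by
  have hεc : conj ε = ε := by rcases hε with rfl | rfl <;> simp
  filter_upwards [hc s, (tendsto_reflect_nhdsNE (2 * (a : ℂ)) s).eventually (hc _)] with z h1 h2
  rw [reflectedSum, reflectedSum, map_add, map_mul, hεc, h1, ← h2, map_sub, map_mul,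
    Complex.conj_ofReal, Complex.conj_ofNat]

/-- Since F = ε(p - 1), the quotient has no pole where p has none, and being in normal form it is
analytic there. -/
lemma sumFactor_nf (h_mero : Meromorphic h) (hε : ε = 1 ∨ ε = -1)
    (hptop : ∀ s, meromorphicOrderAt (sumFactor h a ε) s ≠ ⊤) {s : ℂ}
    (hs : 0 ≤ ordZ (sumFactor h a ε) s) : AnalyticAt ℂ (quotientNF h a) s := by
  refine ((meromorphicNFOn_toMeromorphicNFOn _ _
    (Set.mem_univ s)).meromorphicOrderAt_nonneg_iff_analyticAt).1 ?_
  change 0 ≤ meromorphicOrderAt (quotientNF h a) s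
  have h0 : 0 ≤ meromorphicOrderAt (sumFactor h a ε) s := by
    rw [← coe_ordZ (hptop s)]; exact_mod_cast hs
  obtain ⟨w, hw⟩ := (tendsto_nhds_iff_meromorphicOrderAt_nonneg (meromorphic_sumFactor h_mero s)).2 h0
  refine (tendsto_nhds_iff_meromorphicOrderAt_nonneg (meromorphic_quotientNF h_mero s)).1
    ⟨ε * (w - 1), ?_⟩
  refine ((hw.sub_const 1).const_mul ε).congr fun z => ?_
  simp only [sumFactor]
  linear_combination quotientNF h a z * sign_sq hε

end Symmetry

/-! ### Counting zeros with and without weights. -/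

section Counting

open Complex Real MeasureTheory Metric
open scoped ComplexConjugate

variable {f : ℂ → ℂ}

lemma mem_zerosOf_iff {s : ℂ} (h : meromorphicOrderAt f s ≠ ⊤) : s ∈ zerosOf f ↔ 0 < ordZ f s := by
  rw [zerosOf, Set.mem_ofPred_eq, ← coe_ordZ h]
  exact_mod_cast Iff.rfl

lemma mem_polesOf_iff {s : ℂ} (h : meromorphicOrderAt f s ≠ ⊤) : s ∈ polesOf f ↔ ordZ f s < 0 := by
  rw [polesOf, Set.mem_ofPred_eq, ← coe_ordZ h]
  exact_mod_cast Iff.rfl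

lemma mem_zerosOf_of_ordZ_pos {s : ℂ} (h : 0 < ordZ f s) : s ∈ zerosOf f := by
  rcases eq_or_ne (meromorphicOrderAt f s) ⊤ with ht | ht
  · rw [zerosOf, Set.mem_ofPred_eq, ht]; exact WithTop.coe_lt_top 0
  · exact (mem_zerosOf_iff ht).2 h

lemma finite_zerosOf_inter (hf : Meromorphic f) (htop : ∀ s, meromorphicOrderAt f s ≠ ⊤) {X : Set ℂ}
    {R : ℝ} (hX : ∀ s ∈ zerosOf f ∩ X, ‖s‖ ≤ R) : (zerosOf f ∩ X).Finite := by
  refine (finite_ordZ_ne_zero hf (isCompact_closedBall (0 : ℂ) R)).subset fun s hs => ⟨?_, ?_⟩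
  · simpa using hX s hs
  · exact ((mem_zerosOf_iff (htop s)).1 hs.1).ne'

lemma countZeros_eq_sum {X : Set ℂ} (hfin : (zerosOf f ∩ X).Finite) :
    countZeros f X = ∑ s ∈ hfin.toFinset, (ordZ f s).toNat :=
  finsum_mem_eq_finite_toFinset_sum _ hfin

lemma sum_toNat_le_countZeros {X : Set ℂ} (hfin : (zerosOf f ∩ X).Finite) {P : Finset ℂ}
    (hP : ∀ s ∈ P, 0 < ordZ f s → s ∈ X) : ∑ s ∈ P, (ordZ f s).toNat ≤ countZeros f X := by
  rw [countZeros_eq_sum hfin]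
  refine Finset.sum_le_sum_of_ne_zero fun s hs h0 => ?_
  have hpos : 0 < ordZ f s := by omega
  exact hfin.mem_toFinset.2 ⟨mem_zerosOf_of_ordZ_pos hpos, hP s hs hpos⟩

lemma countZeros_mono {X Y : Set ℂ} (hfin : (zerosOf f ∩ Y).Finite) (hXY : X ⊆ Y) :
    countZeros f X ≤ countZeros f Y := by
  have hX : (zerosOf f ∩ X).Finite := hfin.subset (Set.inter_subset_inter_right _ hXY)
  rw [countZeros_eq_sum hX]
  exact sum_toNat_le_countZeros hfin fun s hs _ => hXY (hX.mem_toFinset.1 hs).2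

/-- The zeros in a symmetric strip are counted by those above and those on the real axis. -/
lemma countZeros_abs_im_le (hconj : ∀ s, ordZ f (conj s) = ordZ f s) {a H : ℝ}
    (hfin : (zerosOf f ∩ {s | a ≤ s.re ∧ |s.im| < H}).Finite)
    (hreal : (zerosOf f ∩ {s | a ≤ s.re ∧ s.im = 0}).Finite) :
    countZeros f {s | a ≤ s.re ∧ |s.im| < H} ≤ 2 * countZeros f ({s | a ≤ s.re} ∩ openStrip H)
      + countZeros f {s | a ≤ s.re ∧ s.im = 0} := by
  classical
  have hstrip : (zerosOf f ∩ ({s | a ≤ s.re} ∩ openStrip H)).Finite :=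
    hfin.subset fun s hs => ⟨hs.1, hs.2.1, by
      rw [abs_of_pos hs.2.2.1]; exact hs.2.2.2⟩
  rw [countZeros_eq_sum hfin]
  set W := hfin.toFinset
  have hWm : ∀ s ∈ W, a ≤ s.re ∧ |s.im| < H := fun s hs => (hfin.mem_toFinset.1 hs).2
  rw [← Finset.sum_filter_add_sum_filter_not W fun s => 0 < s.im,
    ← Finset.sum_filter_add_sum_filter_not (W.filter fun s => ¬ 0 < s.im) fun s => s.im = 0]
  have h1 : ∑ s ∈ W with 0 < s.im, (ordZ f s).toNat ≤ countZeros f ({s | a ≤ s.re} ∩ openStrip H) := by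
    refine sum_toNat_le_countZeros hstrip fun s hs _ => ?_
    obtain ⟨hs, h⟩ := Finset.mem_filter.1 hs
    exact ⟨(hWm s hs).1, h, (abs_lt.1 (hWm s hs).2).2⟩
  have h2 : ∑ s ∈ W.filter (fun s => ¬ 0 < s.im) with s.im = 0, (ordZ f s).toNat
      ≤ countZeros f {s | a ≤ s.re ∧ s.im = 0} := by
    refine sum_toNat_le_countZeros hreal fun s hs _ => ?_
    obtain ⟨hs, h⟩ := Finset.mem_filter.1 hs
    exact ⟨(hWm s (Finset.mem_filter.1 hs).1).1, h⟩
  have h3 : ∑ s ∈ W.filter (fun s => ¬ 0 < s.im) with ¬ s.im = 0, (ordZ f s).toNat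
      ≤ countZeros f ({s | a ≤ s.re} ∩ openStrip H) := by
    have e : ∑ s ∈ W.filter (fun s => ¬ 0 < s.im) with ¬ s.im = 0, (ordZ f s).toNat
        = ∑ s ∈ ((W.filter (fun s => ¬ 0 < s.im)).filter fun s => ¬ s.im = 0).image conj,
          (ordZ f s).toNat := by
      rw [Finset.sum_image fun x _ y _ h => (starRingEnd ℂ).injective h]
      exact Finset.sum_congr rfl fun s _ => by rw [hconj]
    rw [e]
    refine sum_toNat_le_countZeros hstrip fun s hs _ => ?_
    obtain ⟨z, hz, rfl⟩ := Finset.mem_image.1 hs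
    obtain ⟨hz, h0⟩ := Finset.mem_filter.1 hz
    obtain ⟨hz, hneg⟩ := Finset.mem_filter.1 hz
    have hlt : z.im < 0 := lt_of_le_of_ne (not_lt.1 hneg) h0
    refine ⟨by simpa using (hWm z hz).1, ?_, ?_⟩
    · simpa using hlt
    · have := (abs_lt.1 (hWm z hz).2).1
      simp only [Complex.conj_im]; linarith
  linarith

/-- The contribution of a point to `N(T) - N₀'(T)`, points to the left of the axis being counted
with their mirror images. -/
noncomputable def zeroExcess (f : ℂ → ℂ) (a : ℝ) (s : ℂ) : ℝ :=
  if a < s.re then 2 * ((ordZ f s).toNat : ℝ)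
  else if s.re = a then ((ordZ f s).toNat : ℝ) - (if 0 < ordZ f s then 1 else 0) else 0

lemma zeroExcess_nonneg (a : ℝ) (s : ℂ) : 0 ≤ zeroExcess f a s := by
  unfold zeroExcess
  split_ifs with h1 h2 h3
  · positivity
  · have : 1 ≤ (ordZ f s).toNat := by omega
    have : (1 : ℝ) ≤ (ordZ f s).toNat := by exact_mod_cast this
    linarith
  · simp
  · exact le_rfl

/-- The map s ↦ 2a - conj s keeps the height and exchanges the two sides of the line, so zeros on
the left may be counted on the right. The factor 2 comes from conjugation: the weight is available
on both sides of the real axis. -/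
lemma two_mul_excess_le (htop : ∀ s, meromorphicOrderAt f s ≠ ⊤) {a T : ℝ}
    (hconj : ∀ s, ordZ f (conj s) = ordZ f s)
    (hrefl : ∀ s, ordZ f (2 * (a : ℂ) - s) = ordZ f s)
    (hfin : (zerosOf f ∩ openStrip T).Finite) {V : Finset ℂ}
    (hV : ∀ s, a ≤ s.re → |s.im| < T → 0 < ordZ f s → s ∈ V) :
    2 * ((zeroCount f T : ℝ) - distinctCriticalZeroCount f a T)
      ≤ ∑ s ∈ V with |s.im| < T, zeroExcess f a s := by
  classical
  set Z := hfin.toFinset with hZ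
  have hZm : ∀ s, s ∈ Z ↔ 0 < ordZ f s ∧ 0 < s.im ∧ s.im < T := fun s => by
    rw [hZ, hfin.mem_toFinset, Set.mem_inter_iff, mem_zerosOf_iff (htop s)]; rfl
  have hN : (zeroCount f T : ℝ) = ∑ s ∈ Z, ((ordZ f s).toNat : ℝ) := by
    rw [zeroCount, countZeros_eq_sum hfin]
    push_cast; rfl
  have hN0 : (distinctCriticalZeroCount f a T : ℝ) = ∑ s ∈ Z, (if s.re = a then (1 : ℝ) else 0) := by
    have : zerosOf f ∩ {s | s.re = a} ∩ openStrip T = ((Z.filter fun s => s.re = a : Finset ℂ) : Set ℂ) := by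
      ext s
      rw [Finset.coe_filter, Set.mem_ofPred_eq, hZm, ← mem_zerosOf_iff (htop s)]
      exact ⟨fun h => ⟨⟨h.1.1, h.2⟩, h.1.2⟩, fun h => ⟨⟨h.1.1, h.2⟩, h.1.2⟩⟩
    rw [distinctCriticalZeroCount, this, Set.ncard_coe_finset, Finset.card_filter]
    push_cast; rfl
  have hswap : ∑ s ∈ Z, (if s.re < a then ((ordZ f s).toNat : ℝ) else 0)
      = ∑ s ∈ Z, (if a < s.re then ((ordZ f s).toNat : ℝ) else 0) := by
    have hmem : ∀ s ∈ Z, 2 * (a : ℂ) - conj s ∈ Z := by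
      intro s hs
      rw [hZm] at hs ⊢
      rw [hrefl, hconj]
      simpa using hs
    have hinv : ∀ s : ℂ, 2 * (a : ℂ) - conj (2 * (a : ℂ) - conj s) = s := by
      intro s
      rw [map_sub, map_mul, Complex.conj_ofReal, Complex.conj_ofNat, Complex.conj_conj]; ring
    refine Finset.sum_bij' (fun s _ => 2 * (a : ℂ) - conj s) (fun s _ => 2 * (a : ℂ) - conj s)
      hmem hmem (fun s _ => hinv s) (fun s _ => hinv s) fun s _ => ?_
    rw [hrefl, hconj]
    have : (2 * (a : ℂ) - conj s).re = 2 * a - s.re := by simp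
    rw [this]
    congr 1
    exact propext ⟨fun h => by linarith, fun h => by linarith⟩
  have hD : (zeroCount f T : ℝ) - distinctCriticalZeroCount f a T = ∑ s ∈ Z, zeroExcess f a s := by
    have e : ∑ s ∈ Z, zeroExcess f a s = ∑ s ∈ Z, (((ordZ f s).toNat : ℝ)
        - (if s.re = a then (1 : ℝ) else 0) + (if a < s.re then ((ordZ f s).toNat : ℝ) else 0)
        - (if s.re < a then ((ordZ f s).toNat : ℝ) else 0)) := by
      refine Finset.sum_congr rfl fun s hs => ?_
      rw [zeroExcess, if_pos ((hZm s).1 hs).1]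
      rcases lt_trichotomy s.re a with h | h | h
      · simp [h, h.ne, h.not_gt]
      · simp [h]
      · simp [h, h.ne', h.not_gt]; ring
    rw [e, Finset.sum_sub_distrib, Finset.sum_add_distrib, Finset.sum_sub_distrib, hswap, hN, hN0]
    ring
  have hDconj : ∑ s ∈ Z.image conj, zeroExcess f a s = ∑ s ∈ Z, zeroExcess f a s := by
    rw [Finset.sum_image fun x _ y _ h => (starRingEnd ℂ).injective h]
    refine Finset.sum_congr rfl fun s _ => ?_
    simp only [zeroExcess, hconj, Complex.conj_re]
  have hdisj : Disjoint Z (Z.image conj) := by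
    rw [Finset.disjoint_left]
    intro s hs hs'
    obtain ⟨z, hz, rfl⟩ := Finset.mem_image.1 hs'
    have h1 := ((hZm _).1 hs).2.1
    have h2 := ((hZm _).1 hz).2.1
    rw [Complex.conj_im] at h1
    linarith
  rw [hD, two_mul]
  nth_rewrite 2 [← hDconj]
  rw [← Finset.sum_union hdisj]
  have hsub : ∀ s ∈ Z ∪ Z.image conj, 0 < ordZ f s ∧ |s.im| < T := by
    intro s hs
    rcases Finset.mem_union.1 hs with hs | hs
    · have := (hZm s).1 hs
      exact ⟨this.1, by rw [abs_of_pos this.2.1]; exact this.2.2⟩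
    · obtain ⟨z, hz, rfl⟩ := Finset.mem_image.1 hs
      have := (hZm z).1 hz
      rw [hconj, Complex.conj_im, abs_neg, abs_of_pos this.2.1]
      exact ⟨this.1, this.2.2⟩
  rw [← Finset.sum_filter_add_sum_filter_not (Z ∪ Z.image conj) fun s => a ≤ s.re]
  have hzero : ∑ s ∈ Z ∪ Z.image conj with ¬ a ≤ s.re, zeroExcess f a s = 0 := by
    refine Finset.sum_eq_zero fun s hs => ?_
    have h := not_le.1 (Finset.mem_filter.1 hs).2
    simp [zeroExcess, h.not_gt, h.ne]
  rw [hzero, add_zero]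
  refine Finset.sum_le_sum_of_subset_of_nonneg (fun s hs => ?_) fun s _ _ => zeroExcess_nonneg a s
  obtain ⟨hs, h⟩ := Finset.mem_filter.1 hs
  exact Finset.mem_filter.2 ⟨hV s h (hsub s hs).2 (hsub s hs).1, (hsub s hs).2⟩

open Classical in
/-- From a weighted count of the zeros of the factor `p` in `f = h p` to a count of the zeros
of `f`. -/
lemma excess_le_of_weighted_count {g p : ℂ → ℂ} (hord : ∀ s, ordZ f s = ordZ g s + ordZ p s)
    {Ψ : ℂ → ℝ} (hΨ : ∀ s, 0 ≤ Ψ s) {a T E ψ₁ ψ₂ : ℝ} (hψ₂ : 0 ≤ ψ₂) {V : Finset ℂ}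
    (hE : ∑ s ∈ V, ((if a < s.re then 2 * (ordZ p s * Ψ s) else 0)
      + (if s.re = a then (ordZ p s - if 0 < ordZ p s then 1 else 0) * Ψ s else 0)) ≤ E)
    (hlow : ∀ s, a ≤ s.re → 0 < ordZ f s → |s.im| < T → ψ₁ ≤ Ψ s)
    (hup : ∀ s, a ≤ s.re → (ordZ f s < 0 ∨ 0 < ordZ g s) → Ψ s ≤ ψ₂)
    (hvan : ∀ s, a ≤ s.re → 0 < ordZ g s → 2 * T ≤ |s.im| → Ψ s = 0) :
    ψ₁ * ∑ s ∈ V with |s.im| < T, zeroExcess f a s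
      ≤ E + 2 * ψ₂ * ∑ s ∈ V, ((-ordZ f s).toNat : ℝ)
        + 2 * ψ₂ * ∑ s ∈ V with a ≤ s.re ∧ |s.im| < 2 * T, ((ordZ g s).toNat : ℝ) := by
  refine le_trans ?_ (add_le_add_left (add_le_add_left hE _) _)
  rw [Finset.sum_filter, Finset.sum_filter, Finset.mul_sum, Finset.mul_sum, Finset.mul_sum,
    ← Finset.sum_add_distrib, ← Finset.sum_add_distrib]
  refine Finset.sum_le_sum fun s _ => ?_
  have hΨs := hΨ s
  have ho := hord s
  have hN1 : (0 : ℝ) ≤ ((-ordZ f s).toNat : ℝ) := Nat.cast_nonneg _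
  have hN2 : (0 : ℝ) ≤ ((ordZ g s).toNat : ℝ) := Nat.cast_nonneg _
  have hN3 : 0 ≤ 2 * ψ₂ * ((-ordZ f s).toNat : ℝ) := by positivity
  have hN4 : 0 ≤ 2 * ψ₂ * (if a ≤ s.re ∧ |s.im| < 2 * T then ((ordZ g s).toNat : ℝ) else 0) := by
    split_ifs <;> positivity
  rcases lt_or_ge s.re a with hre | hre
  · have : zeroExcess f a s = 0 := by simp [zeroExcess, hre.not_gt, hre.ne]
    simp only [this, hre.not_gt, hre.ne, if_false, ite_self, mul_zero, zero_add, add_zero]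
    linarith
  have hf : ((-ordZ f s).toNat : ℝ) * Ψ s ≤ ψ₂ * ((-ordZ f s).toNat : ℝ) := by
    rcases lt_or_ge (ordZ f s) 0 with h | h
    · rw [mul_comm]; exact mul_le_mul_of_nonneg_right (hup s hre (Or.inl h)) hN1
    · have : (-ordZ f s).toNat = 0 := by omega
      simp [this]
  have hg : ((ordZ g s).toNat : ℝ) * Ψ s
      ≤ ψ₂ * (if a ≤ s.re ∧ |s.im| < 2 * T then ((ordZ g s).toNat : ℝ) else 0) := by
    rcases lt_or_ge 0 (ordZ g s) with h | h
    · rcases lt_or_ge |s.im| (2 * T) with h' | h'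
      · rw [if_pos ⟨hre, h'⟩, mul_comm]
        exact mul_le_mul_of_nonneg_right (hup s hre (Or.inr h)) hN2
      · rw [hvan s hre h h', if_neg fun h => (not_lt.2 h') h.2]; simp
    · have : (ordZ g s).toNat = 0 := by omega
      simp [this]
  have hex : ψ₁ * (if |s.im| < T then zeroExcess f a s else 0) ≤ zeroExcess f a s * Ψ s := by
    have h0 := zeroExcess_nonneg (f := f) a s
    split_ifs with h
    · rcases lt_or_ge 0 (ordZ f s) with h' | h'
      · rw [mul_comm]; exact mul_le_mul_of_nonneg_left (hlow s hre h' h) h0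
      · have h1 : (ordZ f s).toNat = 0 := by omega
        have : zeroExcess f a s = 0 := by simp [zeroExcess, h1, h'.not_gt]
        simp [this]
    · rw [mul_zero]; positivity
  refine hex.trans ?_
  rcases hre.eq_or_lt with hre' | hre'
  · have h1 : zeroExcess f a s = ((ordZ f s).toNat : ℝ) - (if 0 < ordZ f s then 1 else 0) := by
      simp [zeroExcess, hre']
    -- If f vanishes but p does not, the discount for p is missing, which only helps. If p vanishes
    -- but f does not, its discounted order is still nonnegative.
    have h2 : ((ordZ f s).toNat : ℤ) - (if 0 < ordZ f s then 1 else 0)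
        ≤ (ordZ p s - if 0 < ordZ p s then 1 else 0) + ((ordZ g s).toNat : ℤ)
          + ((-ordZ f s).toNat : ℤ) := by
      split_ifs <;> omega
    have h3 : zeroExcess f a s ≤ (ordZ p s - if 0 < ordZ p s then 1 else 0)
        + ((ordZ g s).toNat : ℝ) + ((-ordZ f s).toNat : ℝ) := by
      rw [h1]; exact_mod_cast h2
    have h4 := mul_le_mul_of_nonneg_right h3 hΨs
    rw [add_mul, add_mul] at h4
    rw [if_neg hre'.not_lt, if_pos hre'.symm]
    have h5 : 0 ≤ ((ordZ g s).toNat : ℝ) * Ψ s := by positivity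
    have h6 : 0 ≤ ((-ordZ f s).toNat : ℝ) * Ψ s := by positivity
    linarith
  · have h1 : zeroExcess f a s = 2 * ((ordZ f s).toNat : ℝ) := by simp [zeroExcess, hre']
    have h2 : ((ordZ f s).toNat : ℤ) ≤ ordZ p s + ((ordZ g s).toNat : ℤ)
          + ((-ordZ f s).toNat : ℤ) := by omega
    have h3 : ((ordZ f s).toNat : ℝ) ≤ ordZ p s + ((ordZ g s).toNat : ℝ)
          + ((-ordZ f s).toNat : ℝ) := by exact_mod_cast h2
    have h4 := mul_le_mul_of_nonneg_right h3 hΨs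
    rw [add_mul, add_mul] at h4
    rw [if_pos hre', if_neg hre'.ne', h1]
    linarith

end Counting

/-! ### The arc mean of log |p| for large T. -/

section ArcBound

open Complex Real MeasureTheory Metric
open scoped ComplexConjugate

lemma exists_bracket {t : ℕ → ℝ} (ht : Tendsto t atTop atTop) {x : ℝ} (h0 : t 0 ≤ x) :
    ∃ n, t n ≤ x ∧ x < t (n + 1) := by
  classical
  have hex : ∃ N, x < t N := (ht.eventually_gt_atTop x).exists
  obtain ⟨n, hn⟩ := Nat.exists_eq_succ_of_ne_zero (n := Nat.find hex) fun h =>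
    absurd (Nat.find_spec hex) (by rw [h]; exact not_lt.2 h0)
  refine ⟨n, not_lt.1 (Nat.find_min hex (m := n) (by omega)), ?_⟩
  have := Nat.find_spec hex
  rwa [hn] at this

lemma blaschkeLog_mul {T : ℝ} (hT : 0 < T) (r s : ℂ) :
    blaschkeLog (T * r) (T * s) = blaschkeLog r s := by
  unfold blaschkeLog
  rw [map_mul, Complex.conj_ofReal, ← mul_add, ← mul_sub, norm_mul, norm_mul, Complex.norm_real,
    mul_div_mul_left _ _ (norm_ne_zero_iff.2 hT.ne')]

/-- From Re s² ≥ -3 follows (Im s)² ≤ (Re s)² + 3. After scaling by T this part of the arc stays at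
height at most 2T, inside the rectangle. -/
lemma abs_im_ovalArc_le {φ : ℝ} (h : (ovalArc φ).re ≤ 1) : |(ovalArc φ).im| ≤ 2 := by
  have h1 := congrArg Complex.re (ovalArc_sq φ)
  have h2 : -7 ≤ (7 * Complex.exp (φ * I)).re := by
    have := Complex.abs_re_le_norm (7 * Complex.exp (φ * I))
    rw [norm_mul, Complex.norm_exp_ofReal_mul_I] at this
    norm_num at this
    have := (abs_le.1 this).1
    simp at this ⊢
    linarith
  rw [sq, Complex.mul_re, Complex.add_re] at h1
  have h3 := ovalArc_re_nonneg φ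
  have h4 : (4 : ℂ).re = 4 := rfl
  rw [h4] at h1
  refine abs_le_of_sq_le_sq ?_ (by norm_num)
  nlinarith

lemma log_norm_one_add_mul_le {ε z : ℂ} (hε : ‖ε‖ = 1) :
    Real.log ‖1 + ε * z‖ ≤ Real.log 2 + Real.posLog ‖z‖ := by
  have h1 : ‖1 + ε * z‖ ≤ 2 * max 1 ‖z‖ := by
    refine (norm_add_le _ _).trans ?_
    rw [norm_one, norm_mul, hε, one_mul]
    have := le_max_left 1 ‖z‖
    have := le_max_right 1 ‖z‖
    linarith
  have hm : 0 < max 1 ‖z‖ := one_pos.trans_le (le_max_left _ _)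
  rw [Real.posLog_eq_log_max_one (norm_nonneg _), ← Real.log_mul (by norm_num) hm.ne']
  rcases eq_or_ne ‖1 + ε * z‖ 0 with h0 | h0
  · rw [h0, Real.log_zero]
    exact Real.log_nonneg (by have := le_max_left 1 ‖z‖; linarith)
  · exact Real.log_le_log (lt_of_le_of_ne (norm_nonneg _) (Ne.symm h0)) h1

variable {h : ℂ → ℂ} {a : ℝ} {ε : ℂ}

/-- The rectangle bound is of size T but is needed only on an arc of angular measure O(w/T), so it
contributes a constant. Only the poles of F remain, each at the cost δ. -/
theorem exists_arc_bound {φ : ℝ → ℝ} (h_mero : Meromorphic h)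
    (htop : ∀ s, meromorphicOrderAt h s ≠ ⊤)
    (hc : ∀ s, ∀ᶠ z in 𝓝[≠] s, h (conj z) = conj (h z)) (hε : ε = 1 ∨ ε = -1) {w : ℝ} (hw : 0 < w)
    (hfar : ∀ s : ℂ, a + w ≤ s.re → MeroNormLt (reflectedQuotient h a) s (1 / 2))
    (hφ : Monotone φ) (h_growth : GrowthOnSegments (reflectedQuotient h a) a φ) {δ : ℝ}
    (hδ : 0 < δ) : ∃ C T₀ : ℝ, ∀ T ≥ T₀, ∃ (H : ℝ) (P : Finset ℂ), 2 * T < H ∧ H ≤ φ (2 * T) ∧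
      (∀ s ∈ P, a < s.re ∧ |s.im| < H) ∧
      2 * (∫ φ in (-π)..π, Real.log ‖sumFactor h a ε (a + T * ovalArc φ)‖)
        - 4 * π * Real.log ‖sumFactor h a ε (a + T * 2)‖ + 2 * π * Real.log (7 / 4)
      ≤ C + 2 * δ * ∑ s ∈ P, ((-ordZ (quotientNF h a) s).toNat : ℝ) := by
  have hpi := Real.pi_pos
  obtain ⟨K, t, hK, ht, hmono, hgr⟩ := h_growth (a + w) (by linarith)
  obtain ⟨x₀, hx₀, harc⟩ := integral_log_norm_arc_le hδ
  set K' := K * (1 + w + |a|) with hK'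
  have hK'pos : 0 < K' := by positivity
  set C₀ := 4 * K' * (2 + w) with hC₀
  have hC₀pos : 0 < C₀ := by positivity
  refine ⟨2 * (2 * π * Real.log 2 + 4 * π * (C₀ * w)) + 4 * π * Real.log 2 + 2 * π * Real.log (7 / 4),
    max (max 1 (w / x₀)) (max w |t 0|), fun T hT => ?_⟩
  have hT1 : 1 ≤ T := (le_max_left _ _).trans ((le_max_left _ _).trans hT)
  have hTx : w / x₀ ≤ T := (le_max_right _ _).trans ((le_max_left _ _).trans hT)
  have hTw : w ≤ T := (le_max_left _ _).trans ((le_max_right _ _).trans hT)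
  have hTt : t 0 ≤ T := (le_abs_self _).trans ((le_max_right _ _).trans ((le_max_right _ _).trans hT))
  have hTpos : 0 < T := by linarith
  have hTc : (T : ℂ) ≠ 0 := by exact_mod_cast hTpos.ne'
  obtain ⟨n, hn1, hn2⟩ := exists_bracket ht (x := 2 * T) (by linarith)
  -- With t n ≤ 2T < t (n + 1), monotonicity of φ gives H ≤ φ(t n) ≤ φ(2T).
  set H := t (n + 1) with hH
  have hHφ : H ≤ φ (2 * T) := (hmono n).2.trans (hφ hn1)
  -- the quotient centred at the axis
  set F := quotientNF h a with hF
  let G : ℂ → ℂ := fun z => F (a + z)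
  have hGord : ∀ z, meromorphicOrderAt G z = meromorphicOrderAt F (a + z) := fun z => by
    simpa using meromorphicOrderAt_comp_affine F a one_ne_zero z
  have hGordZ : ∀ z, ordZ G z = ordZ F (a + z) := fun z => by rw [ordZ, hGord, ordZ]
  have hGmer : Meromorphic G := by
    simpa using (meromorphic_quotientNF (a := a) h_mero).comp_affine a 1
  have hGtop : ∀ z, meromorphicOrderAt G z ≠ ⊤ := fun z => by
    rw [hGord]; exact meromorphicOrderAt_quotientNF_ne_top h_mero htop _
  have hGan : ∀ z, AnalyticAt ℂ F (a + z) → AnalyticAt ℂ G z := fun z hz =>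
    hz.fun_comp (analyticAt_const.add analyticAt_id)
  have hGnf : ∀ z, 0 ≤ ordZ G z → AnalyticAt ℂ G z := fun z hz =>
    hGan z (analyticAt_quotientNF h_mero htop (by rwa [← hGordZ]))
  have hfin : {z : ℂ | (0 < z.re ∧ z.re < w ∧ |z.im| < H) ∧ ordZ G z < 0}.Finite := by
    refine (finite_ordZ_ne_zero hGmer (isCompact_closedBall (0 : ℂ) (w + H))).subset ?_
    rintro z ⟨⟨h1, h2, h3⟩, h4⟩
    refine ⟨?_, h4.ne⟩
    rw [mem_closedBall_zero_iff]
    refine (Complex.norm_le_abs_re_add_abs_im z).trans ?_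
    rw [abs_of_pos h1]; linarith
  set P := hfin.toFinset with hP
  have hPm : ∀ z, z ∈ P ↔ (0 < z.re ∧ z.re < w ∧ |z.im| < H) ∧ ordZ G z < 0 := fun z =>
    hfin.mem_toFinset
  have hrect : ∀ z : ℂ, 0 ≤ z.re → z.re ≤ w → |z.im| ≤ 2 * T → z ∉ P →
      Real.posLog ‖G z‖ ≤ C₀ * T + ∑ r ∈ P, ((-ordZ G r).toNat : ℝ) * blaschkeLog r z := by
    intro z hz0 hzw hzT hzP
    have h1 := posLog_le_of_rectangle hGmer hGtop hGnf hw (M := K' * H) (H := H)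
      (mul_nonneg hK'pos.le (by linarith)) ?_ ?_ ?_ P hPm hz0 hzw (hzT.trans_lt hn2) hzP
    · refine h1.trans (add_le_add_left ?_ _)
      have h2 := mul_cosh_div_cosh_le hw (abs_nonneg z.im) (hzT.trans hn2.le)
      rw [show |z.im| / w = |z.im / w| by rw [abs_div, abs_of_pos hw], Real.cosh_abs] at h2
      calc 2 * (K' * H) * Real.cosh (z.im / w) / Real.cosh (H / w)
          = 2 * K' * (H * Real.cosh (z.im / w) / Real.cosh (H / w)) := by ring
        _ ≤ 2 * K' * (2 * (|z.im| + w)) := mul_le_mul_of_nonneg_left h2 (by positivity)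
        _ ≤ 2 * K' * (2 * ((2 + w) * T)) := by
            refine mul_le_mul_of_nonneg_left ?_ (by positivity)
            nlinarith
        _ = C₀ * T := by rw [hC₀]; ring
    · intro s hs
      obtain ⟨h1, h2⟩ := norm_quotientNF_of_re_eq h_mero htop hc (s := a + s) (a := a) (by simp [hs])
      exact ⟨hGan s h1, h2.le⟩
    · intro s hs
      obtain ⟨h1, h2⟩ := quotientNF_of_meroNormLt h_mero (hfar (a + s) (by simp [hs]))
      exact ⟨hGan s h1, h2.le.trans (by norm_num)⟩
    · intro s hs0 hsw hsH
      obtain ⟨h1, h2⟩ := quotientNF_of_meroNormLt h_mero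
        (hgr (n + 1) (a + s) (by simpa using hs0) (by simpa using hsw) (by simpa using hsH))
      refine ⟨hGan s h1, h2.le.trans (Real.exp_le_exp.2 ?_)⟩
      rw [hK', mul_assoc]
      refine mul_le_mul_of_nonneg_left ?_ hK.le
      have h3 : ‖(a : ℂ) + s‖ ≤ |a| + (w + H) := by
        refine (norm_add_le _ _).trans (add_le_add ?_ ?_)
        · rw [Complex.norm_real, Real.norm_eq_abs]
        · refine (Complex.norm_le_abs_re_add_abs_im s).trans ?_
          rw [abs_of_nonneg hs0, hsH]; linarith
      nlinarith [abs_nonneg a]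
  have hre2 : a + w ≤ ((a : ℂ) + T * 2).re := by simp; linarith
  have hfarq : ∀ s : ℂ, a + w ≤ s.re → ‖sumFactor h a ε s - 1‖ ≤ 1 / 2 := by
    intro s hs
    have := (quotientNF_of_meroNormLt h_mero (hfar s hs)).2
    rw [sumFactor, add_sub_cancel_left, norm_mul, norm_of_sign hε, one_mul]
    exact this.le
  -- The focus scales to a + 2T, far to the right, where |p| ≥ 1/2.
  have hq2 : -Real.log 2 ≤ Real.log ‖sumFactor h a ε (a + T * 2)‖ := by
    have h1 : 1 / 2 ≤ ‖sumFactor h a ε (a + T * 2)‖ := by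
      have h2 := hfarq _ hre2
      have h3 := norm_sub_norm_le (1 : ℂ) (sumFactor h a ε (a + T * 2))
      rw [norm_sub_rev, norm_one] at h3
      linarith
    rw [← Real.log_inv]
    exact Real.log_le_log (by norm_num) (by simpa using h1)
  have hint := harc (w / T) (by positivity) (by rw [div_le_iff₀ hTpos]; rwa [div_le_iff₀' hx₀] at hTx)
    (fun z => sumFactor h a ε (a + T * z)) (P.image fun r => r / T)
    (fun r => (-ordZ G (T * r)).toNat) (C₀ * T) (by positivity) ?_ ?_ ?_
  · have hinj : Set.InjOn (fun r : ℂ => r / T) P := fun x _ y _ hxy => by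
      simpa [div_left_inj' hTc] using hxy
    have hsum : ∑ r ∈ P.image (fun r => r / (T : ℂ)), ((-ordZ G (T * r)).toNat : ℝ)
        = ∑ s ∈ P.image (fun r => (a : ℂ) + r), ((-ordZ F s).toNat : ℝ) := by
      rw [Finset.sum_image hinj, Finset.sum_image fun x _ y _ hxy => add_left_cancel hxy]
      refine Finset.sum_congr rfl fun r _ => ?_
      rw [mul_div_cancel₀ _ hTc, hGordZ]
    refine ⟨H, P.image fun r => (a : ℂ) + r, hn2, hHφ, ?_, ?_⟩
    · intro s hs
      obtain ⟨r, hr, rfl⟩ := Finset.mem_image.1 hs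
      have := ((hPm r).1 hr).1
      exact ⟨by simpa using this.1, by simpa using this.2.2⟩
    · rw [hsum] at hint
      have e : 4 * π * (C₀ * T) * (w / T) = 4 * π * (C₀ * w) := by field_simp
      rw [e] at hint
      nlinarith [mul_le_mul_of_nonneg_left hq2 (by positivity : 0 ≤ 4 * π)]
  · intro r hr
    obtain ⟨z, hz, rfl⟩ := Finset.mem_image.1 hr
    have := ((hPm z).1 hz).1
    rw [Complex.div_ofReal_re]
    exact ⟨div_pos this.1 hTpos, (div_le_one hTpos).2 (this.2.1.le.trans hTw)⟩
  · intro φ hφx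
    rw [div_lt_iff₀ hTpos] at hφx
    have h1 := hfarq (a + T * ovalArc φ) (by simp; linarith)
    have h2 := norm_add_le (sumFactor h a ε (a + T * ovalArc φ) - 1) 1
    rw [sub_add_cancel, norm_one] at h2
    linarith
  · intro φ hφx hφP
    have hx1 : (ovalArc φ).re ≤ 1 := hφx.trans ((div_le_one hTpos).2 hTw)
    rw [le_div_iff₀ hTpos] at hφx
    have h1 := hrect (T * ovalArc φ)
      (by rw [Complex.re_ofReal_mul]; exact mul_nonneg hTpos.le (ovalArc_re_nonneg φ))
      (by rw [Complex.re_ofReal_mul]; linarith)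
      (by
        rw [Complex.im_ofReal_mul, abs_mul, abs_of_pos hTpos]
        nlinarith [abs_im_ovalArc_le hx1])
      (fun hmem => hφP (Finset.mem_image.2 ⟨_, hmem, by field_simp⟩))
    have h2 : ∑ r ∈ P.image (fun r => r / (T : ℂ)),
        ((-ordZ G (T * r)).toNat : ℝ) * blaschkeLog r (ovalArc φ)
        = ∑ r ∈ P, ((-ordZ G r).toNat : ℝ) * blaschkeLog r (T * ovalArc φ) := by
      rw [Finset.sum_image fun x _ y _ hxy => by simpa [div_left_inj' hTc] using hxy]
      refine Finset.sum_congr rfl fun r _ => ?_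
      rw [← blaschkeLog_mul hTpos, mul_div_cancel₀ _ hTc]
    rw [h2]
    have h3 := log_norm_one_add_mul_le (z := G (T * ovalArc φ)) (norm_of_sign hε)
    change Real.log ‖1 + ε * G (T * ovalArc φ)‖ ≤ _
    linarith

end ArcBound

/-! ### Numerical values of the weight and the count of zeros of p. -/

section ZeroCount

open Complex Real MeasureTheory Metric
open scoped ComplexConjugate

lemma sq_sub_four_re (u : ℂ) : (4 - u ^ 2).re = 4 - u.re ^ 2 + u.im ^ 2 := by
  rw [Complex.sub_re, sq, Complex.mul_re]
  have : (4 : ℂ).re = 4 := rfl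
  rw [this]; ring

lemma re_le_norm_sq_sub_four (u : ℂ) : 4 - u.re ^ 2 + u.im ^ 2 ≤ ‖u ^ 2 - 4‖ := by
  rw [← sq_sub_four_re, norm_sub_rev]
  exact Complex.re_le_norm _

/-- Here |u² - 4| ≤ 5 + 9/400, and 7 divided by this exceeds 1.39; the ideal value on the axis is
7/5. -/
lemma le_ovalWeight {u : ℂ} (h0 : 0 ≤ u.re) (h1 : u.re ≤ 3 / 20) (h2 : |u.im| < 1) :
    Real.log (139 / 100) ≤ ovalWeight u := by
  have hx : u.re ^ 2 ≤ (3 / 20) ^ 2 := pow_le_pow_left₀ h0 h1 2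
  have hy : u.im ^ 2 < 1 := (sq_lt_one_iff_abs_lt_one _).2 h2
  have hlow := re_le_norm_sq_sub_four u
  have hup : ‖u ^ 2 - 4‖ ≤ u.re ^ 2 + u.im ^ 2 + 4 := by
    refine (norm_sub_le _ _).trans ?_
    rw [norm_pow, ← Complex.normSq_eq_norm_sq, Complex.normSq_apply]
    norm_num
    nlinarith
  have hpos : 0 < ‖u ^ 2 - 4‖ := by nlinarith
  refine le_trans (Real.log_le_log (by norm_num) ?_) (le_max_right _ _)
  rw [le_div_iff₀ hpos]
  nlinarith

/-- Here |u² - 4| ≥ 4 - 9/400, and 7 divided by this is below 1.76; the ideal value on the axis is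
7/4. -/
lemma ovalWeight_le {u : ℂ} (h0 : 0 ≤ u.re) (h1 : u.re ≤ 3 / 20) :
    ovalWeight u ≤ Real.log (176 / 100) := by
  have hx : u.re ^ 2 ≤ (3 / 20) ^ 2 := pow_le_pow_left₀ h0 h1 2
  have hlow := re_le_norm_sq_sub_four u
  have hpos : 0 < ‖u ^ 2 - 4‖ := by nlinarith [sq_nonneg u.im]
  rw [ovalWeight, Real.posLog_eq_log_max_one (by positivity)]
  refine Real.log_le_log (one_pos.trans_le (le_max_left _ _)) (max_le (by norm_num) ?_)
  rw [div_le_iff₀ hpos]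
  nlinarith [sq_nonneg u.im]

lemma ovalWeight_eq_zero {u : ℂ} (h0 : 0 ≤ u.re) (h1 : u.re ≤ 3 / 20) (h2 : 2 ≤ |u.im|) :
    ovalWeight u = 0 := by
  have hx : u.re ^ 2 ≤ (3 / 20) ^ 2 := pow_le_pow_left₀ h0 h1 2
  have hy : 4 ≤ u.im ^ 2 := by rw [← sq_abs]; nlinarith
  have hlow := re_le_norm_sq_sub_four u
  have hpos : 0 < ‖u ^ 2 - 4‖ := by nlinarith
  rw [ovalWeight, Real.posLog_eq_log_max_one (by positivity), max_eq_left, Real.log_one]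
  rw [div_le_one hpos]
  nlinarith

/-- This inequality is what makes the constant 4 attainable; numerically, 1.39² = 1.9321 > 1.76. -/
lemma weight_gap : 0 < 2 * Real.log (139 / 100) - Real.log (176 / 100) := by
  have h1 : 2 * Real.log (139 / 100) = Real.log ((139 / 100) ^ 2) := by
    rw [Real.log_pow]; norm_num
  rw [h1, sub_pos]
  exact Real.log_lt_log (by norm_num) (by norm_num)

variable {h : ℂ → ℂ} {a : ℝ} {ε : ℂ}

lemma ordZ_reflectedSum_neg (h_mero : Meromorphic h) (htop : ∀ s, meromorphicOrderAt h s ≠ ⊤)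
    (hε : ε = 1 ∨ ε = -1) (hftop : ∀ s, meromorphicOrderAt (reflectedSum h a ε) s ≠ ⊤) {s : ℂ}
    (hs : ordZ (reflectedSum h a ε) s < 0) : ordZ h s < 0 ∨ ordZ h (2 * (a : ℂ) - s) < 0 := by
  by_contra! hcon
  have h1 : meromorphicOrderAt ((fun _ => ε) * fun z => h (2 * (a : ℂ) - z)) s
      = meromorphicOrderAt h (2 * (a : ℂ) - s) := by
    rw [meromorphicOrderAt_mul_of_ne_zero analyticAt_const
      (norm_ne_zero_iff.1 (by rw [norm_of_sign hε]; norm_num)), meromorphicOrderAt_comp_reflect]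
  have h2 := meromorphicOrderAt_add (h_mero s)
    ((MeromorphicAt.const ε s).mul (h_mero.comp_reflect (2 * (a : ℂ)) s))
  rw [h1, ← coe_ordZ (htop s), ← coe_ordZ (htop (2 * (a : ℂ) - s))] at h2
  change _ ≤ meromorphicOrderAt (reflectedSum h a ε) s at h2
  rw [← coe_ordZ (hftop s)] at h2
  have h3 : min (ordZ h s) (ordZ h (2 * (a : ℂ) - s)) ≤ ordZ (reflectedSum h a ε) s := by
    exact_mod_cast h2
  have := le_min hcon.1 hcon.2
  omega

/-- The zeros of the factor `p` in the oval of size `T` about the axis. -/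
lemma weighted_count_sumFactor (h_mero : Meromorphic h) (htop : ∀ s, meromorphicOrderAt h s ≠ ⊤)
    (hc : ∀ s, ∀ᶠ z in 𝓝[≠] s, h (conj z) = conj (h z)) (hε : ε = 1 ∨ ε = -1)
    (hptop : ∀ s, meromorphicOrderAt (sumFactor h a ε) s ≠ ⊤) {T : ℝ} (hT : 0 < T)
    (h2 : MeroNormLt (reflectedQuotient h a) (a + T * 2) 1) {V : Finset ℂ}
    (hV : ∀ s : ℂ, dist s a ≤ 4 * T → ordZ (sumFactor h a ε) s ≠ 0 → s ∈ V) :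
    2 * π * ∑ s ∈ V, ((if a < s.re then
        2 * (ordZ (sumFactor h a ε) s * ovalWeight ((s - a) / T)) else 0)
      + (if s.re = a then (ordZ (sumFactor h a ε) s - if 0 < ordZ (sumFactor h a ε) s then 1 else 0)
        * ovalWeight ((s - a) / T) else 0))
      ≤ 2 * (∫ φ in (-π)..π, Real.log ‖sumFactor h a ε (a + T * ovalArc φ)‖)
        - 4 * π * Real.log ‖sumFactor h a ε (a + T * 2)‖ + 2 * π * Real.log (7 / 4) := by
  have hTc : (T : ℂ) ≠ 0 := by exact_mod_cast hT.ne'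
  set p := sumFactor h a ε with hp
  let q : ℂ → ℂ := fun z => p (a + T * z)
  have hqord : ∀ z, meromorphicOrderAt q z = meromorphicOrderAt p (a + T * z) :=
    meromorphicOrderAt_comp_affine p a hTc
  have hqordZ : ∀ z, ordZ q z = ordZ p (a + T * z) := fun z => by rw [ordZ, hqord, ordZ]
  have hqan : ∀ z, AnalyticAt ℂ (quotientNF h a) (a + T * z) → AnalyticAt ℂ q z := fun z hz =>
    AnalyticAt.fun_comp (g := p) (f := fun z : ℂ => (a : ℂ) + T * z) (analyticAt_sumFactor hz)
      (analyticAt_const.add (analyticAt_const.mul analyticAt_id))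
  obtain ⟨h2an, h2lt⟩ := quotientNF_of_meroNormLt h_mero h2
  have key := oval_count (q := q) ((meromorphic_sumFactor h_mero).comp_affine a T)
    (fun z => by rw [hqord]; exact hptop _)
    (fun z hz => hqan z (sumFactor_nf h_mero hε hptop (by rwa [hqordZ] at hz)))
    (fun t => ?_) (hqan 2 h2an) (sumFactor_ne_zero_of_norm_lt hε h2lt)
    (V.image fun s => (s - a) / T) ?_
  · rw [Finset.sum_image fun x _ y _ hxy => by simpa [div_left_inj' hTc] using hxy] at key
    refine le_trans (le_of_eq ?_) key
    congr 1
    refine Finset.sum_congr rfl fun s _ => ?_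
    have e1 : ordZ q ((s - a) / T) = ordZ p s := by
      rw [hqordZ, mul_div_cancel₀ _ hTc, add_sub_cancel]
    have e2 : ((s - a) / T).re = (s.re - a) / T := by
      rw [Complex.div_ofReal_re, Complex.sub_re, Complex.ofReal_re]
    rw [e1, e2]
    congr 1
    · refine if_congr ?_ rfl rfl
      rw [div_pos_iff_of_pos_right hT, sub_pos]
    · refine if_congr ?_ rfl rfl
      rw [div_eq_zero_iff, or_iff_left hT.ne', sub_eq_zero]
  · obtain ⟨h3, h4⟩ := norm_quotientNF_of_re_eq (a := a) h_mero htop hc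
      (s := a + T * (t * I)) (by simp)
    refine ⟨hqan _ h3, ?_⟩
    simp only [q, hp, sumFactor]
    rw [add_sub_cancel_left, norm_mul, norm_of_sign hε, h4, mul_one]
  · intro u hu hu0
    rw [hqordZ] at hu0
    refine Finset.mem_image.2 ⟨a + T * u, hV _ ?_ hu0, ?_⟩
    · rw [dist_eq_norm, add_sub_cancel_left, norm_mul, Complex.norm_real, Real.norm_of_nonneg hT.le]
      have : ‖u‖ ≤ 4 := by nlinarith [hu.2, norm_nonneg u]
      nlinarith
    · rw [add_sub_cancel_left, mul_div_cancel_left₀ _ hTc]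

end ZeroCount

/-! ### Assembly of the estimates. -/

theorem mainTheorem4 (a : ℝ) (h : ℂ → ℂ) (ε : ℂ) (φ : ℝ → ℝ)
    (hε : ε = 1 ∨ ε = -1)
    (h_mero : Meromorphic h)
    (h_real : ∀ x : ℝ, AnalyticAt ℂ h (x : ℂ) → (h (x : ℂ)).im = 0)
    (h_poles : (polesOf h).Finite)
    (h_zeros : ∃ σ₁ : ℝ, ∀ s : ℂ, σ₁ ≤ s.re → s ∉ zerosOf h)
    (h_decay : UniformDecay (reflectedQuotient h a) a)
    (hφ : Monotone φ)
    (h_growth : GrowthOnSegments (reflectedQuotient h a) a φ) :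
    (∀ T : ℝ, (zerosOf (reflectedSum h a ε) ∩ openStrip T).Finite) ∧
    (∀ T : ℝ, (zerosOf h ∩ ({s | a ≤ s.re} ∩ openStrip T)).Finite) ∧
    ∃ C : ℝ, ∀ T : ℝ, 0 < T →
      (zeroCount (reflectedSum h a ε) T : ℝ)
          - (distinctCriticalZeroCount (reflectedSum h a ε) a T : ℝ)
        ≤ 4 * (rightZeroCount h a (φ (2 * T)) : ℝ) + C := by
  obtain ⟨σ₁, hσ₁⟩ := h_zeros
  obtain ⟨σ₀, -, hσ₀⟩ := h_decay (1 / 2) (by norm_num)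
  obtain ⟨R, hR⟩ := h_poles.isBounded.exists_norm_le
  have htop : ∀ s, meromorphicOrderAt h s ≠ ⊤ := by
    refine h_mero.exists_meromorphicOrderAt_ne_top_iff_forall.1 ⟨(σ₁ : ℂ), fun ht => ?_⟩
    -- Infinite order counts as a zero in `zerosOf`, so the absence of zeros far to the right
    -- excludes h ≡ 0.
    refine hσ₁ σ₁ (by simp) ?_
    rw [zerosOf, Set.mem_ofPred_eq, ht]
    exact WithTop.coe_lt_top 0
  have hc := eventually_conj_comm h_mero h_real
  set f := reflectedSum h a ε with hf
  set p := sumFactor h a ε with hp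
  have hptop : ∀ s, meromorphicOrderAt p s ≠ ⊤ := by
    obtain ⟨v, hv, hv'⟩ := hσ₀ (σ₀ : ℂ) (by simp)
    exact meromorphicOrderAt_sumFactor_ne_top h_mero hε ⟨v, hv, hv'.trans (by norm_num)⟩
  have hftop : ∀ s, meromorphicOrderAt f s ≠ ⊤ :=
    meromorphicOrderAt_reflectedSum_ne_top h_mero htop hptop
  have hf_mero : Meromorphic f := meromorphic_reflectedSum h_mero
  have hord : ∀ s, ordZ f s = ordZ h s + ordZ p s := ordZ_reflectedSum h_mero htop hptop
  have hhc : ∀ s, ordZ h ((starRingEnd ℂ) s) = ordZ h s := ordZ_conj h_mero hc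
  have hfc : ∀ s, ordZ f ((starRingEnd ℂ) s) = ordZ f s :=
    ordZ_conj hf_mero (eventually_reflectedSum_conj_comm hε hc)
  have hfr : ∀ s, ordZ f (2 * (a : ℂ) - s) = ordZ f s := ordZ_reflectedSum_reflect hε
  -- Beyond distance w to the right of the line |F| < 1/2 and h has neither zeros nor poles.
  obtain ⟨w, hw, hwσ₀, hwσ₁, hwR⟩ : ∃ w : ℝ, 0 < w ∧ σ₀ ≤ a + w ∧ σ₁ ≤ a + w ∧ R + |a| < w := by
    refine ⟨1 + |σ₀ - a| + |σ₁ - a| + |R| + |a|, by positivity, ?_, ?_, ?_⟩ <;>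
    linarith [le_abs_self (σ₀ - a), le_abs_self (σ₁ - a), le_abs_self R, abs_nonneg (σ₀ - a),
      abs_nonneg (σ₁ - a), abs_nonneg R, abs_nonneg a]
  have hpole : ∀ s, ordZ h s < 0 → |s.re - a| < w := by
    intro s hs
    have h1 := hR s ((mem_polesOf_iff (htop s)).2 hs)
    have h2 := Complex.abs_re_le_norm s
    have h3 := abs_sub s.re a
    linarith
  have hzh : ∀ s, 0 < ordZ h s → s.re < a + w := by
    intro s hs
    by_contra! hcon
    exact hσ₁ s (hwσ₁.trans hcon) (mem_zerosOf_of_ordZ_pos hs)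
  have hfar : ∀ s : ℂ, a + w ≤ s.re → MeroNormLt (reflectedQuotient h a) s (1 / 2) := fun s hs =>
    hσ₀ s (hwσ₀.trans hs)
  have hzf : ∀ s, ordZ f s ≠ 0 → |s.re - a| < w := by
    have key : ∀ s, ordZ f s ≠ 0 → s.re < a + w := by
      intro s hs
      by_contra! hcon
      refine hs ?_
      obtain ⟨h1, h2⟩ := quotientNF_of_meroNormLt h_mero (hfar s hcon)
      have h3 : ordZ p s = 0 := by
        have h4 : meromorphicOrderAt p s = 0 :=
          (analyticAt_sumFactor h1).meromorphicNFAt.meromorphicOrderAt_eq_zero_iff.2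
            (sumFactor_ne_zero_of_norm_lt hε (h2.trans (by norm_num)))
        simp [ordZ, h4]
      rw [hord, h3, add_zero]
      rcases lt_trichotomy (ordZ h s) 0 with h5 | h5 | h5
      · have := (abs_lt.1 (hpole s h5)).2
        linarith
      · exact h5
      · exact absurd (hzh s h5) (not_lt.2 hcon)
    intro s hs
    have h1 := key s hs
    -- The functional equation of f carries the bound on the right over to the left.
    have h2 := key (2 * (a : ℂ) - s) (by rwa [hfr])
    have h3 : (2 * (a : ℂ) - s).re = 2 * a - s.re := by simp
    rw [abs_lt]
    constructor <;> linarith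
  -- finiteness
  have hnorm : ∀ s : ℂ, ∀ y : ℝ, |s.re - a| ≤ w → |s.im| ≤ y → ‖s‖ ≤ |a| + w + y := by
    intro s y h1 h2
    have h3 := Complex.norm_le_abs_re_add_abs_im s
    have h4 := abs_add_le (s.re - a) a
    rw [sub_add_cancel] at h4
    linarith
  have hfin₁ : ∀ T : ℝ, (zerosOf f ∩ openStrip T).Finite := by
    intro T
    refine finite_zerosOf_inter hf_mero hftop (R := |a| + w + T) fun s hs => ?_
    refine hnorm s T (hzf s ((mem_zerosOf_iff (hftop s)).1 hs.1).ne').le ?_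
    rw [abs_of_pos hs.2.1]
    exact hs.2.2.le
  have hfin₂ : ∀ H : ℝ, (zerosOf h ∩ {s | a ≤ s.re ∧ |s.im| < H}).Finite := by
    intro H
    refine finite_zerosOf_inter h_mero htop (R := |a| + w + H) fun s hs => ?_
    refine hnorm s H ?_ hs.2.2.le
    have := hzh s ((mem_zerosOf_iff (htop s)).1 hs.1)
    rw [abs_of_nonneg (sub_nonneg.2 hs.2.1)]
    linarith
  have hfin₃ : ∀ T : ℝ, (zerosOf h ∩ ({s | a ≤ s.re} ∩ openStrip T)).Finite := fun T =>
    (hfin₂ T).subset fun s hs => ⟨hs.1, hs.2.1, by rw [abs_of_pos hs.2.2.1]; exact hs.2.2.2⟩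
  refine ⟨hfin₁, hfin₃, ?_⟩
  have hfin₄ : (zerosOf h ∩ {s | a ≤ s.re ∧ s.im = 0}).Finite :=
    (hfin₂ 1).subset fun s hs => ⟨hs.1, hs.2.1, by rw [hs.2.2]; simp⟩
  set R₀ := countZeros h {s | a ≤ s.re ∧ s.im = 0} with hR₀
  have hcount : ∀ H y : ℝ, H ≤ y → (countZeros h {s | a ≤ s.re ∧ |s.im| < H} : ℝ)
      ≤ 2 * rightZeroCount h a y + R₀ := by
    intro H y hHy
    have h1 := countZeros_abs_im_le hhc (hfin₂ H) hfin₄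
    have h2 : countZeros h ({s | a ≤ s.re} ∩ openStrip H) ≤ rightZeroCount h a y :=
      countZeros_mono (hfin₃ y) fun s hs => ⟨hs.1, hs.2.1, hs.2.2.trans_le hHy⟩
    have h3 : countZeros h {s | a ≤ s.re ∧ |s.im| < H} ≤ 2 * rightZeroCount h a y + R₀ := by omega
    exact_mod_cast h3
  -- poles
  have hQh : {s | ordZ h s < 0}.Finite := h_poles.subset fun s hs => (mem_polesOf_iff (htop s)).2 hs
  have hQf : {s | ordZ f s < 0}.Finite := by
    refine (hQh.union (hQh.preimage (f := fun s => 2 * (a : ℂ) - s)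
      fun x _ y _ hxy => sub_right_injective hxy)).subset fun s hs => ?_
    exact ordZ_reflectedSum_neg h_mero htop hε hftop hs
  set Mh := ∑ s ∈ hQh.toFinset, (-ordZ h s).toNat with hMh
  set Mf := ∑ s ∈ hQf.toFinset, (-ordZ f s).toNat with hMf
  have hpolef : ∀ V : Finset ℂ, ∑ s ∈ V, (-ordZ f s).toNat ≤ Mf := fun V =>
    Finset.sum_le_sum_of_ne_zero fun s _ h0 => hQf.mem_toFinset.2 (by
      change ordZ f s < 0
      omega)
  have hpoleF : ∀ (H y : ℝ) (P : Finset ℂ), H ≤ y → (∀ s ∈ P, a < s.re ∧ |s.im| < H) →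
      (∑ s ∈ P, ((-ordZ (quotientNF h a) s).toNat : ℝ)) ≤ 2 * rightZeroCount h a y + R₀ + Mh := by
    intro H y P hHy hP
    -- A pole of F is a zero of h or a reflected pole of h, and the latter are finitely many in all.
    have h1 : ∑ s ∈ P, (-ordZ (quotientNF h a) s).toNat
        ≤ ∑ s ∈ P, (ordZ h s).toNat + ∑ s ∈ P, (-ordZ h (2 * (a : ℂ) - s)).toNat := by
      rw [← Finset.sum_add_distrib]
      refine Finset.sum_le_sum fun s _ => ?_
      rw [ordZ_quotientNF h_mero htop]
      omega
    have h2 : ∑ s ∈ P, (ordZ h s).toNat ≤ countZeros h {s | a ≤ s.re ∧ |s.im| < H} :=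
      sum_toNat_le_countZeros (hfin₂ H) fun s hs _ => ⟨(hP s hs).1.le, (hP s hs).2⟩
    have h3 : ∑ s ∈ P, (-ordZ h (2 * (a : ℂ) - s)).toNat ≤ Mh := by
      rw [← Finset.sum_image (s := P) (g := fun s => 2 * (a : ℂ) - s)
        (f := fun s => (-ordZ h s).toNat) fun x _ y _ hxy => sub_right_injective hxy]
      exact Finset.sum_le_sum_of_ne_zero fun s _ h0 => hQh.mem_toFinset.2 (by
        change ordZ h s < 0
        omega)
    have h4 := hcount H y hHy
    have h5 : ((∑ s ∈ P, (-ordZ (quotientNF h a) s).toNat : ℕ) : ℝ)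
        ≤ countZeros h {s | a ≤ s.re ∧ |s.im| < H} + Mh := by
      exact_mod_cast h1.trans (add_le_add h2 h3)
    push_cast at h5
    linarith
  -- constants
  set ψ₁ := Real.log (139 / 100) with hψ₁
  set ψ₂ := Real.log (176 / 100) with hψ₂
  have hgap : 0 < 2 * ψ₁ - ψ₂ := weight_gap
  have hψ₂nn : 0 ≤ ψ₂ := Real.log_nonneg (by norm_num)
  have hψ₁pos : 0 < ψ₁ := Real.log_pos (by norm_num)
  have hpi := Real.pi_pos
  -- This δ spends the whole slack. With X = N_h(a, φ(2T)), the poles of F cost at most 4(2ψ₁ - ψ₂)X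
  -- and the zeros of h at most 4ψ₂X, up to constants. The sum 8ψ₁X, against 2ψ₁(N - N₀'), gives
  -- exactly the factor 4.
  obtain ⟨C, T₀, harc⟩ := exists_arc_bound h_mero htop hc hε hw hfar hφ h_growth
    (δ := 2 * Real.pi * (2 * ψ₁ - ψ₂)) (by positivity)
  -- The last term makes w/T ≤ 3/20, the width for which the weight bounds hold. Smaller T are
  -- covered by the constant N(T₁).
  set T₁ := max (max T₀ 1) (w / (3 / 20)) with hT₁
  set c := C / (2 * Real.pi) + 2 * (2 * ψ₁ - ψ₂) * (R₀ + Mh) + 2 * ψ₂ * Mf + 2 * ψ₂ * R₀ with hcdef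
  refine ⟨max (c / (2 * ψ₁)) (zeroCount f T₁), fun T hT => ?_⟩
  rcases lt_or_ge T T₁ with hTT | hTT
  · have h1 : zeroCount f T ≤ zeroCount f T₁ :=
      countZeros_mono (hfin₁ T₁) fun s hs => ⟨hs.1, hs.2.trans hTT⟩
    have h2 : (zeroCount f T : ℝ) ≤ zeroCount f T₁ := by exact_mod_cast h1
    have h3 := le_max_right (c / (2 * ψ₁)) (zeroCount f T₁ : ℝ)
    have h4 : (0 : ℝ) ≤ rightZeroCount h a (φ (2 * T)) := Nat.cast_nonneg _
    have h5 : (0 : ℝ) ≤ distinctCriticalZeroCount f a T := Nat.cast_nonneg _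
    linarith
  have hTT₀ : T₀ ≤ T := (le_max_left _ _).trans ((le_max_left _ _).trans hTT)
  have hTw : w ≤ 3 / 20 * T := by
    have := (le_max_right _ _).trans hTT
    rwa [div_le_iff₀' (by norm_num)] at this
  obtain ⟨H, P, hH1, hH2, hP, harcT⟩ := harc T hTT₀
  have hVfin : {s | s ∈ Metric.closedBall (a : ℂ) (4 * T) ∧ (ordZ f s ≠ 0 ∨ ordZ h s ≠ 0)}.Finite := by
    refine ((finite_ordZ_ne_zero hf_mero (isCompact_closedBall (a : ℂ) (4 * T))).union
      (finite_ordZ_ne_zero h_mero (isCompact_closedBall (a : ℂ) (4 * T)))).subset fun s hs => ?_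
    exact hs.2.imp (fun h => ⟨hs.1, h⟩) fun h => ⟨hs.1, h⟩
  set V := hVfin.toFinset with hV
  have hVm : ∀ s, s ∈ V ↔ dist s a ≤ 4 * T ∧ (ordZ f s ≠ 0 ∨ ordZ h s ≠ 0) := fun s =>
    hVfin.mem_toFinset
  have hT2 : a + w ≤ ((a : ℂ) + T * 2).re := by simp; linarith
  have hwc := weighted_count_sumFactor (V := V) h_mero htop hc hε hptop hT
    (by
      obtain ⟨v, hv, hv'⟩ := hfar _ hT2
      exact ⟨v, hv, hv'.trans (by norm_num)⟩)
    (fun s hs hs0 => (hVm s).2 ⟨hs, by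
      by_contra! hcon
      have := hord s
      rw [hcon.1, hcon.2, zero_add] at this
      exact hs0 this.symm⟩)
  have hE := (hwc.trans harcT)
  rw [← le_div_iff₀' (by positivity)] at hE
  have hre : ∀ s : ℂ, ((s - a) / T).re = (s.re - a) / T := fun s => by
    rw [Complex.div_ofReal_re, Complex.sub_re, Complex.ofReal_re]
  have him : ∀ s : ℂ, |((s - a) / T).im| = |s.im| / T := fun s => by
    rw [Complex.div_ofReal_im, Complex.sub_im, Complex.ofReal_im, sub_zero, abs_div, abs_of_pos hT]
  have hre0 : ∀ s : ℂ, a ≤ s.re → 0 ≤ ((s - a) / T).re := fun s hs => by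
    rw [hre]; exact div_nonneg (by linarith) hT.le
  have hre1 : ∀ s : ℂ, s.re ≤ a + w → ((s - a) / T).re ≤ 3 / 20 := fun s hs => by
    rw [hre, div_le_iff₀ hT]; linarith
  have hfw : ∀ s : ℂ, ordZ f s ≠ 0 → s.re ≤ a + w := fun s hs => by
    have := (abs_lt.1 (hzf s hs)).2
    linarith
  have hex := excess_le_of_weighted_count (T := T) (ψ₁ := ψ₁) (ψ₂ := ψ₂) hord
    (fun s => ovalWeight_nonneg ((s - a) / T)) hψ₂nn hE
    (fun s h1 h2 h3 => le_ovalWeight (hre0 s h1) (hre1 s (hfw s h2.ne')) (by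
      rw [him, div_lt_one hT]; exact h3))
    (fun s h1 h2 => ovalWeight_le (hre0 s h1) (hre1 s (h2.elim (fun h => hfw s h.ne)
      fun h => (hzh s h).le)))
    (fun s h1 h2 h3 => ovalWeight_eq_zero (hre0 s h1) (hre1 s (hzh s h2).le) (by
      rw [him, le_div_iff₀ hT]; exact h3))
  have hN := two_mul_excess_le (a := a) (T := T) hftop hfc hfr (hfin₁ T) (V := V)
    (fun s h1 h2 h3 => (hVm s).2 ⟨by
      rw [dist_eq_norm]
      refine (Complex.norm_le_abs_re_add_abs_im _).trans ?_
      have h4 := (hzf s h3.ne').le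
      rw [Complex.sub_re, Complex.sub_im, Complex.ofReal_re, Complex.ofReal_im, sub_zero]
      linarith, Or.inl h3.ne'⟩)
  have hm := hpoleF H (φ (2 * T)) P hH2 hP
  have hf₁ : ∑ s ∈ V, ((-ordZ f s).toNat : ℝ) ≤ Mf := by exact_mod_cast hpolef V
  have hh₁ : ∑ s ∈ V with a ≤ s.re ∧ |s.im| < 2 * T, ((ordZ h s).toNat : ℝ)
      ≤ 2 * rightZeroCount h a (φ (2 * T)) + R₀ := by
    refine le_trans ?_ (hcount (2 * T) (φ (2 * T)) (hH1.le.trans hH2))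
    have := sum_toNat_le_countZeros (f := h) (hfin₂ (2 * T))
      (P := V.filter fun s => a ≤ s.re ∧ |s.im| < 2 * T) fun s hs _ => (Finset.mem_filter.1 hs).2
    exact_mod_cast this
  set X : ℝ := (rightZeroCount h a (φ (2 * T)) : ℝ) with hX
  set m : ℝ := ∑ s ∈ P, ((-ordZ (quotientNF h a) s).toNat : ℝ) with hmdef
  have e1 : (C + 2 * (2 * Real.pi * (2 * ψ₁ - ψ₂)) * m) / (2 * Real.pi)
      = C / (2 * Real.pi) + 2 * (2 * ψ₁ - ψ₂) * m := by
    field_simp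
  rw [e1] at hex
  have h1 := mul_le_mul_of_nonneg_left hN hψ₁pos.le
  have h2 := mul_le_mul_of_nonneg_left hm (by positivity : 0 ≤ 2 * (2 * ψ₁ - ψ₂))
  have h3 := mul_le_mul_of_nonneg_left hf₁ (by positivity : 0 ≤ 2 * ψ₂)
  have h4 := mul_le_mul_of_nonneg_left hh₁ (by positivity : 0 ≤ 2 * ψ₂)
  have h5 : 2 * ψ₁ * ((zeroCount f T : ℝ) - distinctCriticalZeroCount f a T - 4 * X) ≤ c := by
    rw [hcdef]
    linarith
  rw [← le_div_iff₀' (by positivity)] at h5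
  have h6 := le_max_left (c / (2 * ψ₁)) (zeroCount f T₁ : ℝ)
  linarith
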